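/- **Setting.** An $\mathcal{AS}$-set is a semialgebraic subset $A$ of some $\mathbb P^N(\mathbb R)$ such that every real analytic arc $\gamma:(-1,1)\to\mathbb P^N(\mathbb R)$ with $\gamma((-1,0))\subset A$ satisfies $\gamma((0,\varepsilon))\subset A$ for some $\varepsilon>0$. An $\mathcal{AS}$-map is a map between $\mathcal{AS}$-sets whose graph is $\mathcal{AS}$. $K_0(\mathcal{AS})$ is the Grothendieck ring of $\mathcal{AS}$-sets up to bijections with $\mathcal{AS}$ graph, with $[X]=[X\setminus Y]+[Y]$ for $Y\subset X$ a closed $\mathcal{AS}$-subset and product the cartesian product. For $n\ge1$, $\mathrm{Var}^n_{\mathrm{mon}}$ has as objects the $\mathcal{AS}$-sets $X$ with an $\mathcal{AS}$ action of $\mathbb R^*$ and an $\mathcal{AS}$-map $\varphi:X\to\mathbb R^*$ with $\varphi(\lambda\cdot x)=\lambda^n\varphi(x)$. $K_0^n$ is its Grothendieck ring: the relations are (1) $[X]=[Y]$ if there is an equivariant bijection $X\to Y$ over $\mathbb R^*$ with $\mathcal{AS}$ graph; (2) $[X]=[X\setminus Y]+[Y]$ for $Y\subset X$ a closed invariant $\mathcal{AS}$-subset;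 (3) $[Y\times\mathbb R^m,\sigma]=[Y\times\mathbb R^m,\sigma']$ if $\sigma,\sigma'$ are two liftings of the same action on $Y$ and the map to $\mathbb R^*$ is $\varphi_Y\circ\mathrm{pr}_Y$. The product is the fibre product over $\mathbb R^*$ with the diagonal action, and the unit is $\mathbb 1=[\mathrm{id}:\mathbb R^*\to\mathbb R^*]$ with $\lambda\cdot a=\lambda^na$. For $n=km$, $K_0^m\to K_0^n$ replaces the action of $\lambda$ by that of $\lambda^k$, and $K_0=\varinjlim K_0^n$. It is a $K_0(\mathcal{AS})$-algebra by $[A]\mapsto[A\times\mathbb R^*\to\mathbb R^*]$ ($A$ with trivial action). Put $\mathbb L=[\mathbb R]\cdot\mathbb 1$ and $\mathcal M=K_0[\mathbb L^{-1}]$. Let $\mathcal F^m\mathcal M$ ($m\in\mathbb Z$) be the subgroup spanned by the $[S]\mathbb L^{-i}$ with $i-\dim S\ge m$, and let $\widehat{\mathcal M}$ be the completion of $\mathcal M$ for this filtration. Let $f=\sum_\nu c_\nu x^\nu\in\mathbb R[x_1,\dots,x_d]$ with $f(0)=0$. For $n\ge1$ let $\mathfrak X_n(f)$ be the set of truncated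 arcs $\gamma\in\mathcal L_n(\mathbb R^d)$ with $\gamma(0)=0$ and $f(\gamma(t))\equiv ct^n \bmod t^{n+1}$, $c\ne0$, with the map $\gamma\mapsto c$ and the action $(\lambda\cdot\gamma)(t)=\gamma(\lambda t)$; it is an object of $\mathrm{Var}^n_{\mathrm{mon}}$, and $$Z_f(T)=\sum_{n\ge1}[\mathfrak X_n(f)]\,\mathbb L^{-nd}T^n\in\mathcal M[[T]].$$ The Newton polyhedron $\Gamma_f$ is the convex hull of $\bigcup_{c_\nu\ne0}(\nu+\mathbb R_{\ge0}^d)$. For a (non-empty) face $\tau$ put $f_\tau=\sum_{\nu\in\tau}c_\nu x^\nu$. For $k\in\mathbb R_{\ge0}^d$ put $m(k)=\inf_{x\in\Gamma_f}k\cdot x$ and $\tau(k)=\{x\in\Gamma_f: k\cdot x=m(k)\}$, and let $\tilde\sigma(\tau)=\{k\in\mathbb N^d:\tau(k)=\tau\}$. The polynomial $f$ is non-degenerate if for every compact face $\tau$ of $\Gamma_f$ the polynomials $f_\tau,\partial f_\tau/\partial x_1,\dots,\partial f_\tau/\partial x_d$ have no common zero in $(\mathbb R^*)^d$. **Theorem.**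 Let $f\in\mathbb R[x_1,\dots,x_d]$ be non-degenerate with $f(0)=0$. Then $\Gamma_f$ has finitely many compact faces. For each compact face $\tau$ and each $k\in\tilde\sigma(\tau)$ one has $m(k)\ge1$, and the class in $K_0$ of $f_\tau:(\mathbb R^*)^d\setminus f_\tau^{-1}(0)\to\mathbb R^*$ with the action $\lambda\cdot x=(\lambda^{k_i}x_i)_i$, an object of $\mathrm{Var}^{m(k)}_{\mathrm{mon}}$, does not depend on $k\in\tilde\sigma(\tau)$; denote it by $[(\mathbb R^*)^d\setminus f_\tau^{-1}(0)]$. The series $\sum_{k\in\tilde\sigma(\tau)}\mathbb L^{-\sum_i k_i}T^{m(k)}$ converges in $\widehat{\mathcal M}[[T]]$ (coefficientwise), and in $\widehat{\mathcal M}[[T]]$ $$Z_f(T)=\sum_{\tau\text{ compact face of }\Gamma_f}\left(\big[(\mathbb R^*)^d\setminus f_\tau^{-1}(0)\big]+\big[f_\tau^{-1}(0)\cap(\mathbb R^*)^d\big]\frac{\mathbb L^{-1}T}{\mathbb 1-\mathbb L^{-1}T}\right)\sum_{k\in\tilde\sigma(\tau)}\mathbb L^{-\sum_i k_i}T^{m(k)},$$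 where $[f_\tau^{-1}(0)\cap(\mathbb R^*)^d]$ is a class of $K_0(\mathcal{AS})$, acting through the algebra structure. -/

import Mathlib

namespace ArcSym

open Filter Topology

/-! ### Arc-symmetric semialgebraic sets -/

/-- Semialgebraic subsets of `ℝ^ι`: finite Boolean combinations of sets `{p > 0}`. -/
def IsSemialgebraic {ι : Type} (A : Set (ι → ℝ)) : Prop :=
  A ∈ BooleanSubalgebra.closure
    {B : Set (ι → ℝ) | ∃ p : MvPolynomial ι ℝ, B = {x | 0 < MvPolynomial.eval x p}}

/-- The homogeneous coordinates of the points of `A`, where `ℝ^ι` is viewed as the standard chart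
`x ↦ [1 : x]` of the real projective space with homogeneous coordinates indexed by `Option ι`. -/
def homogCoords {ι : Type} (A : Set (ι → ℝ)) : Set (Option ι → ℝ) :=
  {v | v none ≠ 0 ∧ (fun i => v (some i) / v none) ∈ A}

/-- `A ⊆ ℝ^ι ⊆ ℙ^ι(ℝ)` is an `AS`-set: it is semialgebraic, and every real analytic arc
`(-1,1) → ℙ^ι(ℝ)` which is in `A` for negative times is in `A` for small positive times.
Arcs in projective space are given by analytic, nowhere vanishing homogeneous coordinates.
(Real projective spaces are affine: `ℙⁿ(ℝ)` is identified, by an algebraic embedding, with a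
compact algebraic subset of an affine space, so subsets of affine spaces suffice.) -/
def IsAS {ι : Type} (A : Set (ι → ℝ)) : Prop :=
  IsSemialgebraic A ∧
    ∀ γ : ℝ → Option ι → ℝ,
      (∀ i, AnalyticOnNhd ℝ (fun t => γ t i) (Set.Ioo (-1) 1)) →
      (∀ t ∈ Set.Ioo (-1 : ℝ) 1, γ t ≠ 0) →
      (∀ t ∈ Set.Ioo (-1 : ℝ) 0, γ t ∈ homogCoords A) →
      ∃ ε > 0, ∀ t ∈ Set.Ioo (0 : ℝ) ε, γ t ∈ homogCoords A

/-- Polynomial maps between real affine spaces. -/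
def IsPolyMap {ι κ : Type} (g : (ι → ℝ) → (κ → ℝ)) : Prop :=
  ∀ j, ∃ p : MvPolynomial ι ℝ, ∀ x, g x j = MvPolynomial.eval x p

lemma meromorphicAt_eval {ι : Type} (p : MvPolynomial ι ℝ) {γ : ℝ → ι → ℝ}
    (hγ : ∀ i, MeromorphicAt (fun t => γ t i) 0) :
    MeromorphicAt (fun t => MvPolynomial.eval (γ t) p) 0 := by
  induction p using MvPolynomial.induction_on with
  | C a => simp
  | add p q hp hq => simp only [map_add]; exact hp.add hq
  | mul_X p i hp => simp only [map_mul, MvPolynomial.eval_X]; exact hp.mul (hγ i)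

/-- A meromorphic arc germ in affine space is an analytic arc in projective space. -/
lemma exists_homog_lift {ι : Type} [Finite ι] {γ : ℝ → ι → ℝ}
    (hγ : ∀ i, MeromorphicAt (fun t => γ t i) 0) :
    ∃ δ : ℝ, 0 < δ ∧ ∃ g : ℝ → Option ι → ℝ,
      (∀ i, AnalyticOnNhd ℝ (fun t => g t i) (Set.Ioo (-δ) δ)) ∧
      (∀ t ∈ Set.Ioo (-δ) δ, g t ≠ 0) ∧
      ∀ t ∈ Set.Ioo (-δ) δ, t ≠ 0 →
        g t none ≠ 0 ∧ (fun i => g t (some i) / g t none) = γ t := by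
  classical
  have hex : ∃ N : ℕ, ∃ h : ι → ℝ → ℝ, ∀ i, AnalyticAt ℝ (h i) 0 ∧
      ∀ᶠ t in 𝓝[≠] (0 : ℝ), h i t = t ^ N * γ t i := by
    cases nonempty_fintype ι
    choose n hn using hγ
    refine ⟨∑ i, n i, fun i t => t ^ ((∑ j, n j) - n i) * (t ^ n i * γ t i), fun i => ⟨?_, ?_⟩⟩
    · have := hn i
      simp only [sub_zero, smul_eq_mul] at this
      exact (analyticAt_id.pow _).mul this
    · refine Eventually.of_forall fun t => ?_
      beta_reduce
      rw [← mul_assoc, ← pow_add, Nat.sub_add_cancel]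
      exact Finset.single_le_sum (f := n) (fun _ _ => Nat.zero_le _) (Finset.mem_univ i)
  obtain ⟨h, hh⟩ := Nat.find_spec hex
  set N := Nat.find hex with hN
  have hnz : N = 0 ∨ ∃ i, h i 0 ≠ 0 := by
    by_contra hcon
    push Not at hcon
    obtain ⟨hN0, hz⟩ := hcon
    refine Nat.find_min hex (m := N - 1) (by omega) ⟨fun i => dslope (h i) 0, fun i => ⟨?_, ?_⟩⟩
    · obtain ⟨p, hp⟩ := (hh i).1
      exact ⟨_, hp.has_fpower_series_dslope_fslope⟩
    · filter_upwards [(hh i).2, self_mem_nhdsWithin] with t ht ht0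
      have ht0 : t ≠ 0 := ht0
      rw [dslope_of_ne _ ht0, slope_def_field, hz i, ht, sub_zero, sub_zero]
      obtain ⟨M, hM⟩ : ∃ M, N = M + 1 := ⟨N - 1, by omega⟩
      rw [hM, Nat.add_sub_cancel]
      field_simp
      ring
  have hev : ∀ᶠ t in 𝓝 (0 : ℝ), ∀ i, AnalyticAt ℝ (h i) t ∧ (t ≠ 0 → h i t = t ^ N * γ t i) := by
    rw [eventually_all]
    intro i
    exact (hh i).1.eventually_analyticAt.and (eventually_nhdsWithin_iff.1 (hh i).2)
  obtain ⟨δ, hδ, hball⟩ := Metric.eventually_nhds_iff.1 hev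
  have hball' : ∀ t ∈ Set.Ioo (-δ) δ, ∀ i,
      AnalyticAt ℝ (h i) t ∧ (t ≠ 0 → h i t = t ^ N * γ t i) := fun t ht =>
    hball (by rw [Real.dist_eq, sub_zero, abs_lt]; exact ht)
  refine ⟨δ, hδ, fun t i => Option.elim i (t ^ N) (fun i => h i t), ?_, ?_, ?_⟩
  · rintro (_ | i) t ht
    · exact analyticAt_id.pow N
    · exact (hball' t ht i).1
  · intro t ht h0
    by_cases ht0 : t = 0
    · subst ht0
      rcases hnz with hz | ⟨i, hi⟩
      · have := congrFun h0 none
        simp [hz] at this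
      · exact hi (congrFun h0 (some i))
    · have := congrFun h0 none
      exact pow_ne_zero N ht0 this
  · intro t ht ht0
    refine ⟨pow_ne_zero N ht0, funext fun i => ?_⟩
    have := (hball' t ht i).2 ht0
    simp only [Option.elim]
    rw [this]
    field_simp

/-- In affine coordinates, the arcs in the definition of `AS`-sets are the meromorphic ones. -/
theorem isAS_iff {ι : Type} [Finite ι] {A : Set (ι → ℝ)} :
    IsAS A ↔ IsSemialgebraic A ∧ ∀ γ : ℝ → ι → ℝ, (∀ i, MeromorphicAt (fun t => γ t i) 0) →
      (∀ᶠ t in 𝓝[<] (0 : ℝ), γ t ∈ A) → ∀ᶠ t in 𝓝[>] (0 : ℝ), γ t ∈ A := by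
  refine and_congr_right fun _ => ⟨fun H γ hγ hl => ?_, fun H γ hγ hne hl => ?_⟩
  · obtain ⟨δ, hδ, g, hg, hg0, hgγ⟩ := exists_homog_lift hγ
    obtain ⟨η, hη, hlη⟩ := Metric.eventually_nhds_iff.1 (eventually_nhdsWithin_iff.1 hl)
    set ρ := min δ η with hρ
    have hρ0 : 0 < ρ := lt_min hδ hη
    have hmap : ∀ t ∈ Set.Ioo (-1 : ℝ) 1, ρ * t ∈ Set.Ioo (-δ) δ := by
      intro t ht
      have h1 : ρ ≤ δ := min_le_left _ _
      constructor <;> nlinarith [ht.1, ht.2]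
    obtain ⟨ε, hε, hr⟩ := H (fun t => g (ρ * t))
      (fun i t ht => (hg i (ρ * t) (hmap t ht)).comp_of_eq
        (f := fun t => ρ * t) (analyticAt_const.mul analyticAt_id) rfl)
      (fun t ht => hg0 _ (hmap t ht))
      (fun t ht => by
        have hneg : ρ * t < 0 := mul_neg_of_pos_of_neg hρ0 ht.2
        obtain ⟨h1, h2⟩ := hgγ (ρ * t) (hmap t ⟨ht.1, by linarith [ht.2]⟩) hneg.ne
        refine ⟨h1, ?_⟩
        rw [h2]
        refine hlη ?_ hneg
        rw [Real.dist_eq, sub_zero, abs_lt]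
        have h1 : ρ ≤ η := min_le_right _ _
        constructor <;> nlinarith [ht.1, ht.2])
    have : Set.Ioo (0 : ℝ) (ρ * min ε 1) ∈ 𝓝[>] (0 : ℝ) :=
      Ioo_mem_nhdsGT (mul_pos hρ0 (lt_min hε one_pos))
    filter_upwards [this] with t ht
    have h1 : t / ρ < min ε 1 := by
      rw [div_lt_iff₀ hρ0, mul_comm]; exact ht.2
    have h0 : 0 < t / ρ := div_pos ht.1 hρ0
    have h3 : ρ * (t / ρ) = t := by field_simp
    have h2 := hr (t / ρ) ⟨h0, h1.trans_le (min_le_left _ _)⟩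
    simp only [h3] at h2
    have h4 := hmap (t / ρ) ⟨by linarith, h1.trans_le (min_le_right _ _)⟩
    rw [h3] at h4
    have h5 := h2.2
    rwa [(hgγ t h4 ht.1.ne').2] at h5
  · have han : ∀ i, MeromorphicAt (fun t => γ t i) 0 := fun i =>
      (hγ i 0 (by norm_num)).meromorphicAt
    have hI : Set.Ioo (-1 : ℝ) 0 ∈ 𝓝[<] (0 : ℝ) := Ioo_mem_nhdsLT (by norm_num)
    have hr := H (fun t i => γ t (some i) / γ t none) (fun i => (han (some i)).div (han none))
      (by filter_upwards [hI] with t ht using (hl t ht).2)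
    have h0 : ∀ᶠ t in 𝓝[>] (0 : ℝ), γ t none ≠ 0 := by
      rcases (han none).eventually_eq_zero_or_eventually_ne_zero with h | h
      · exfalso
        have h' : ∀ᶠ t in 𝓝[<] (0 : ℝ), γ t none = 0 :=
          h.filter_mono (nhdsWithin_mono _ fun t (ht : t < 0) => ht.ne)
        obtain ⟨t, ht, ht'⟩ := (h'.and hI).exists
        exact (hl t ht').1 ht
      · exact h.filter_mono (nhdsWithin_mono _ fun t (ht : 0 < t) => ht.ne')
    obtain ⟨ε, hε, hsub⟩ := mem_nhdsGT_iff_exists_Ioo_subset.1 (h0.and hr)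
    exact ⟨ε, hε, fun t ht => hsub ht⟩

lemma IsSemialgebraic.compl {ι : Type} {A : Set (ι → ℝ)} (h : IsSemialgebraic A) :
    IsSemialgebraic Aᶜ := BooleanSubalgebra.compl_mem h

lemma IsSemialgebraic.inter {ι : Type} {A B : Set (ι → ℝ)} (h : IsSemialgebraic A)
    (h' : IsSemialgebraic B) : IsSemialgebraic (A ∩ B) := BooleanSubalgebra.infClosed _ h h'

lemma IsSemialgebraic.pos {ι : Type} (p : MvPolynomial ι ℝ) :
    IsSemialgebraic {x | 0 < MvPolynomial.eval x p} :=
  BooleanSubalgebra.subset_closure ⟨p, rfl⟩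

lemma IsSemialgebraic.preimage {ι κ : Type} {A : Set (κ → ℝ)} (h : IsSemialgebraic A)
    {g : (ι → ℝ) → (κ → ℝ)} (hg : IsPolyMap g) : IsSemialgebraic (g ⁻¹' A) := by
  unfold IsSemialgebraic at h
  induction h using BooleanSubalgebra.closure_bot_sup_induction with
  | mem A hA =>
    obtain ⟨p, rfl⟩ := hA
    choose q hq using hg
    have : g ⁻¹' {x | 0 < MvPolynomial.eval x p} =
        {x | 0 < MvPolynomial.eval x (MvPolynomial.bind₁ q p)} := by
      ext x
      have : (fun j => MvPolynomial.eval x (q j)) = g x := funext fun j => (hq j x).symm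
      simp only [Set.mem_preimage, Set.mem_ofPred_eq]
      have key : MvPolynomial.eval x (MvPolynomial.bind₁ q p) =
          MvPolynomial.eval (fun j => MvPolynomial.eval x (q j)) p :=
        MvPolynomial.eval₂Hom_bind₁ (RingHom.id ℝ) x q p
      rw [key, this]
    rw [this]
    exact IsSemialgebraic.pos _
  | bot => exact BooleanSubalgebra.bot_mem
  | sup A _ B _ hA hB => exact BooleanSubalgebra.supClosed _ hA hB
  | compl A _ hA => exact hA.compl

lemma IsSemialgebraic.eventually_or {ι : Type} {A : Set (ι → ℝ)} (h : IsSemialgebraic A)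
    {γ : ℝ → ι → ℝ} (hγ : ∀ i, MeromorphicAt (fun t => γ t i) 0) :
    (∀ᶠ t in 𝓝[>] (0 : ℝ), γ t ∈ A) ∨ ∀ᶠ t in 𝓝[>] (0 : ℝ), γ t ∉ A := by
  unfold IsSemialgebraic at h
  induction h using BooleanSubalgebra.closure_bot_sup_induction with
  | mem A hA =>
    obtain ⟨p, rfl⟩ := hA
    obtain ⟨n, g, hg⟩ := meromorphicAt_eval p hγ
    have hmono : (𝓝[>] (0 : ℝ)) ≤ 𝓝[≠] 0 := nhdsWithin_mono _ fun t (ht : 0 < t) => ht.ne'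
    have hcont := (meromorphicAt_eval p hγ).eventually_continuousAt.filter_mono hmono
    rcases (meromorphicAt_eval p hγ).eventually_eq_zero_or_eventually_ne_zero with hz | hz
    · right
      filter_upwards [hz.filter_mono hmono] with t ht
      simp [ht]
    · obtain ⟨ε, hε, hsub⟩ :=
        mem_nhdsGT_iff_exists_Ioo_subset.1 (hcont.and (hz.filter_mono hmono))
      have hε : 0 < ε := hε
      have hI : Set.Ioo (0 : ℝ) ε ∈ 𝓝[>] (0 : ℝ) := Ioo_mem_nhdsGT hε
      by_cases hpos : ∃ s ∈ Set.Ioo (0 : ℝ) ε, 0 < MvPolynomial.eval (γ s) p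
      · left
        obtain ⟨s, hs, hs0⟩ := hpos
        filter_upwards [hI] with t ht
        by_contra hneg
        have hcon : ContinuousOn (fun t => MvPolynomial.eval (γ t) p) (Set.Ioo 0 ε) :=
          fun u hu => (hsub hu).1.continuousWithinAt
        obtain ⟨u, hu, hu0⟩ := isPreconnected_Ioo.intermediate_value ht hs hcon
          ⟨not_lt.1 hneg, hs0.le⟩
        exact (hsub hu).2 hu0
      · right
        push Not at hpos
        filter_upwards [hI] with t ht
        exact not_lt.2 (hpos t ht)
  | bot => right; exact Eventually.of_forall fun _ h => h
  | sup A _ B _ hA hB =>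
    rcases hA with hA | hA
    · left; filter_upwards [hA] with t ht using Or.inl ht
    · rcases hB with hB | hB
      · left; filter_upwards [hB] with t ht using Or.inr ht
      · right; filter_upwards [hA, hB] with t h1 h2 h3
        exact h3.elim h1 h2
  | compl A _ hA =>
    rcases hA with hA | hA
    · right; filter_upwards [hA] with t ht h using h ht
    · left; exact hA

lemma tendsto_neg_left : Tendsto (fun t : ℝ => -t) (𝓝[<] 0) (𝓝[>] 0) := by
  refine tendsto_nhdsWithin_iff.2 ⟨?_, ?_⟩
  · have : Tendsto (fun t : ℝ => -t) (𝓝 0) (𝓝 (-0)) := (continuous_neg.tendsto 0)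
    rw [neg_zero] at this
    exact this.mono_left nhdsWithin_le_nhds
  · filter_upwards [self_mem_nhdsWithin] with t ht
    exact neg_pos.2 (show t < 0 from ht)

lemma tendsto_neg_right : Tendsto (fun t : ℝ => -t) (𝓝[>] 0) (𝓝[<] 0) := by
  refine tendsto_nhdsWithin_iff.2 ⟨?_, ?_⟩
  · have : Tendsto (fun t : ℝ => -t) (𝓝 0) (𝓝 (-0)) := (continuous_neg.tendsto 0)
    rw [neg_zero] at this
    exact this.mono_left nhdsWithin_le_nhds
  · filter_upwards [self_mem_nhdsWithin] with t ht
    exact neg_lt_zero.2 (show 0 < t from ht)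

lemma IsAS.compl {ι : Type} [Finite ι] {A : Set (ι → ℝ)} (h : IsAS A) : IsAS Aᶜ := by
  rw [isAS_iff] at h ⊢
  refine ⟨h.1.compl, fun γ hγ hl => ?_⟩
  rcases h.1.eventually_or hγ with hr | hr
  · exfalso
    have hγ' : ∀ i, MeromorphicAt (fun t => γ (-t) i) 0 := fun i =>
      MeromorphicAt.comp_analyticAt (f := fun t => γ t i) (g := fun t : ℝ => -t)
        (by simpa using hγ i) analyticAt_id.neg
    have h1 := h.2 (fun t => γ (-t)) hγ' (tendsto_neg_left.eventually hr)
    have h2 := tendsto_neg_left.eventually h1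
    simp only [neg_neg] at h2
    obtain ⟨t, h3, h4⟩ := (h2.and hl).exists
    exact h4 h3
  · exact hr

lemma IsAS.inter {ι : Type} [Finite ι] {A B : Set (ι → ℝ)} (h : IsAS A) (h' : IsAS B) : IsAS (A ∩ B) := by
  rw [isAS_iff] at h h' ⊢
  refine ⟨h.1.inter h'.1, fun γ hγ hl => ?_⟩
  filter_upwards [h.2 γ hγ (hl.mono fun _ h => h.1), h'.2 γ hγ (hl.mono fun _ h => h.2)]
    with t h1 h2 using ⟨h1, h2⟩

lemma IsAS.preimage {ι κ : Type} [Finite ι] [Finite κ] {A : Set (κ → ℝ)} (h : IsAS A) {g : (ι → ℝ) → (κ → ℝ)} (hg : IsPolyMap g) :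
    IsAS (g ⁻¹' A) := by
  rw [isAS_iff] at h ⊢
  refine ⟨h.1.preimage hg, fun γ hγ hl => h.2 (fun t => g (γ t)) (fun j => ?_) hl⟩
  obtain ⟨p, hp⟩ := hg j
  simp only [hp]
  exact meromorphicAt_eval p hγ

lemma isAS_eq_zero {ι : Type} [Finite ι] (p : MvPolynomial ι ℝ) : IsAS {x | MvPolynomial.eval x p = 0} := by
  rw [isAS_iff]
  refine ⟨?_, fun γ hγ hl => ?_⟩
  · have : {x | MvPolynomial.eval x p = 0} = {x | 0 < MvPolynomial.eval x p}ᶜ ∩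
        {x | 0 < MvPolynomial.eval x (-p)}ᶜ := by
      ext x
      simp only [Set.mem_ofPred_eq, Set.mem_inter_iff, Set.mem_compl_iff, map_neg, not_lt]
      constructor
      · intro h; simp [h]
      · rintro ⟨h1, h2⟩; linarith
    rw [this]
    exact (IsSemialgebraic.pos p).compl.inter (IsSemialgebraic.pos (-p)).compl
  · rcases (meromorphicAt_eval p hγ).eventually_eq_zero_or_eventually_ne_zero with h | h
    · exact h.filter_mono (nhdsWithin_mono _ fun t (ht : 0 < t) => ht.ne')
    · exfalso
      have h' := h.filter_mono
        (nhdsWithin_mono (0 : ℝ) (show Set.Iio (0 : ℝ) ⊆ {0}ᶜ from fun t (ht : t < 0) => ht.ne))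
      obtain ⟨t, h1, h2⟩ := (h'.and hl).exists
      exact h1 h2

lemma isAS_ne_zero {ι : Type} [Finite ι] (p : MvPolynomial ι ℝ) : IsAS {x | MvPolynomial.eval x p ≠ 0} :=
  (isAS_eq_zero p).compl

lemma isAS_univ {ι : Type} [Finite ι] : IsAS (Set.univ : Set (ι → ℝ)) := by
  simpa using isAS_eq_zero (0 : MvPolynomial ι ℝ)

lemma isPolyMap_comp {ι κ : Type} (e : κ → ι) : IsPolyMap (fun x : ι → ℝ => x ∘ e) :=
  fun j => ⟨MvPolynomial.X (e j), fun x => by simp⟩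

lemma IsAS.comap {ι κ : Type} [Finite ι] [Finite κ] {A : Set (κ → ℝ)} (h : IsAS A) (e : κ → ι) : IsAS {x : ι → ℝ | x ∘ e ∈ A} :=
  h.preimage (isPolyMap_comp e)

lemma IsAS.iInter {ι κ : Type} [Finite ι] [Finite κ] {A : κ → Set (ι → ℝ)}
    (h : ∀ j, IsAS (A j)) : IsAS (⋂ j, A j) := by
  classical
  cases nonempty_fintype κ
  have : ∀ s : Finset κ, IsAS (⋂ j ∈ s, A j) := by
    intro s
    induction s using Finset.induction_on with
    | empty => simpa using isAS_univ
    | insert j s _ ih =>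
      rw [Finset.set_biInter_insert]
      exact (h j).inter ih
  simpa using this Finset.univ

lemma isAS_forall_eval_eq {ι κ : Type} [Finite ι] [Finite κ] (p q : κ → MvPolynomial ι ℝ) :
    IsAS {z | ∀ j, MvPolynomial.eval z (p j) = MvPolynomial.eval z (q j)} := by
  convert IsAS.iInter fun j => isAS_eq_zero (p j - q j) using 1
  ext z
  simp [sub_eq_zero]

lemma isAS_comp_eq {ι κ : Type} [Finite ι] [Finite κ] (e e' : κ → ι) :
    IsAS {z : ι → ℝ | z ∘ e = z ∘ e'} := by
  convert isAS_forall_eval_eq (fun j => (MvPolynomial.X (e j) : MvPolynomial ι ℝ))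
    (fun j => MvPolynomial.X (e' j)) using 1
  ext z
  simp [funext_iff]

/-- An `AS`-set: a set `T` identified by the injective map `emb` with an `AS`-subset of `ℝ^ι`. -/
structure ASSet : Type 1 where
  T : Type
  ι : Type
  [fin : Finite ι]
  emb : T → ι → ℝ
  inj : Function.Injective emb
  isAS : IsAS (Set.range emb)

attribute [instance] ASSet.fin

namespace ASSet

/-- The graph of a map between `AS`-sets. -/
def graph (X Y : ASSet) (f : X.T → Y.T) : Set (X.ι ⊕ Y.ι → ℝ) :=
  Set.range fun x => Sum.elim (X.emb x) (Y.emb (f x))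

/-- `AS`-maps: the maps whose graph is an `AS`-set. -/
def IsMap (X Y : ASSet) (f : X.T → Y.T) : Prop := IsAS (graph X Y f)

lemma mem_graph {X Y : ASSet} {f : X.T → Y.T} {z : X.ι ⊕ Y.ι → ℝ} :
    z ∈ graph X Y f ↔ ∃ x, z ∘ Sum.inl = X.emb x ∧ z ∘ Sum.inr = Y.emb (f x) := by
  constructor
  · rintro ⟨x, rfl⟩
    exact ⟨x, rfl, rfl⟩
  · rintro ⟨x, h1, h2⟩
    exact ⟨x, by simp only [← h1, ← h2]; exact Sum.elim_comp_inl_inr z⟩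

/-- An `AS`-subset of an `AS`-set. -/
abbrev sub (X : ASSet) (S : Set X.T) (hS : IsAS (X.emb '' S)) : ASSet where
  T := S
  ι := X.ι
  emb x := X.emb x.1
  inj := X.inj.comp Subtype.val_injective
  isAS := by
    convert hS using 1
    ext z
    simp

lemma isAS_compl (X : ASSet) {S : Set X.T} (hS : IsAS (X.emb '' S)) : IsAS (X.emb '' Sᶜ) := by
  have : X.emb '' Sᶜ = Set.range X.emb ∩ (X.emb '' S)ᶜ := by
    rw [Set.image_compl_eq_range_sdiff_image X.inj, Set.sdiff_eq]
  rw [this]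
  exact X.isAS.inter hS.compl

/-- Closed subsets of `X`, for the topology of `ℝ^ι`. -/
def IsClosedIn (X : ASSet) (S : Set X.T) : Prop := ∃ C, IsClosed C ∧ S = X.emb ⁻¹' C

/-- The cartesian product. -/
abbrev prod (X Y : ASSet) : ASSet where
  T := X.T × Y.T
  ι := X.ι ⊕ Y.ι
  emb p := Sum.elim (X.emb p.1) (Y.emb p.2)
  inj := by
    rintro ⟨x, y⟩ ⟨x', y'⟩ h
    have h1 : X.emb x = X.emb x' := funext fun i => congrFun h (Sum.inl i)
    have h2 : Y.emb y = Y.emb y' := funext fun i => congrFun h (Sum.inr i)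
    rw [X.inj h1, Y.inj h2]
  isAS := by
    convert (X.isAS.comap (Sum.inl : X.ι → X.ι ⊕ Y.ι)).inter
      (Y.isAS.comap (Sum.inr : Y.ι → X.ι ⊕ Y.ι)) using 1
    ext z
    constructor
    · rintro ⟨p, rfl⟩
      exact ⟨⟨p.1, rfl⟩, ⟨p.2, rfl⟩⟩
    · rintro ⟨⟨x, hx⟩, ⟨y, hy⟩⟩
      exact ⟨(x, y), by simp only [hx, hy]; exact Sum.elim_comp_inl_inr z⟩

/-- The affine space `ℝ^m`. -/
abbrev affine (m : ℕ) : ASSet where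
  T := Fin m → ℝ
  ι := Fin m
  emb := id
  inj := Function.injective_id
  isAS := by simpa using isAS_univ

/-- The multiplicative group `ℝ^*`. -/
abbrev Gm : ASSet where
  T := ℝˣ
  ι := Unit
  emb r _ := r
  inj r s h := Units.ext (congrFun h ())
  isAS := by
    convert isAS_ne_zero (MvPolynomial.X () : MvPolynomial Unit ℝ) using 1
    ext z
    simp only [MvPolynomial.eval_X]
    exact ⟨by rintro ⟨r, rfl⟩; exact r.ne_zero, fun h => ⟨Units.mk0 _ h, rfl⟩⟩

/-- `AS`-isomorphism: a bijection whose graph is an `AS`-set. -/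
def Iso (X Y : ASSet) : Prop := ∃ e : X.T ≃ Y.T, IsMap X Y e

lemma isMap_of_graph_eq {X Y : ASSet} {f : X.T → Y.T} {A : Set (X.ι ⊕ Y.ι → ℝ)} (h : IsAS A)
    (e : graph X Y f = A) : IsMap X Y f := by
  rw [IsMap, e]
  exact h

lemma isMap_of_reindex {X Y : ASSet} {f : X.T → Y.T} (r : Y.ι → X.ι)
    (h : ∀ x, Y.emb (f x) = X.emb x ∘ r) : IsMap X Y f := by
  have : graph X Y f = {z | z ∘ Sum.inl ∈ Set.range X.emb} ∩
      {z | z ∘ (Sum.inl ∘ r : Y.ι → X.ι ⊕ Y.ι) = z ∘ Sum.inr} := by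
    ext z
    rw [mem_graph]
    constructor
    · rintro ⟨x, h1, h2⟩
      refine ⟨⟨x, h1.symm⟩, ?_⟩
      show (z ∘ Sum.inl) ∘ r = _
      rw [h1, h2, h]
    · rintro ⟨⟨x, h1⟩, h2⟩
      exact ⟨x, h1.symm, by rw [h, h1]; exact h2.symm⟩
  rw [IsMap, this]
  exact (X.isAS.comap _).inter (isAS_comp_eq _ _)

lemma isMap_of_poly {X Y : ASSet} {f : X.T → Y.T} (p : Y.ι → MvPolynomial X.ι ℝ)
    (h : ∀ x j, Y.emb (f x) j = MvPolynomial.eval (X.emb x) (p j)) : IsMap X Y f := by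
  have hA := (X.isAS.comap (Sum.inl : X.ι → X.ι ⊕ Y.ι)).inter
    (isAS_forall_eval_eq (fun j => MvPolynomial.rename Sum.inl (p j))
      (fun j => (MvPolynomial.X (Sum.inr j) : MvPolynomial (X.ι ⊕ Y.ι) ℝ)))
  refine isMap_of_graph_eq hA (Set.ext fun z => ⟨fun hz => ?_, ?_⟩)
  · obtain ⟨x, h1, h2⟩ := mem_graph.1 hz
    refine ⟨⟨x, h1.symm⟩, fun j => ?_⟩
    rw [MvPolynomial.eval_rename, MvPolynomial.eval_X, h1, ← h]
    exact (congrFun h2 j).symm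
  · rintro ⟨⟨x, h1⟩, h2⟩
    refine mem_graph.2 ⟨x, h1.symm, funext fun j => ?_⟩
    have := h2 j
    rw [MvPolynomial.eval_rename, MvPolynomial.eval_X, ← h1, ← h] at this
    exact this.symm

end ASSet

/-- The objects of `Var_mon^n`: an `AS`-set with an `AS`-action of `ℝ^*` and an `AS`-map `φ` to
`ℝ^*` such that `φ (l • x) = l ^ n * φ x`. -/
structure MonVar (n : ℕ) extends ASSet where
  act : ℝˣ → T → T
  one_act : ∀ x, act 1 x = x
  mul_act : ∀ l l' x, act (l * l') x = act l (act l' x)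
  act_isMap : (ASSet.Gm.prod toASSet).IsMap toASSet fun p => act p.1 p.2
  φ : T → ℝˣ
  φ_isMap : toASSet.IsMap ASSet.Gm φ
  φ_act : ∀ l x, φ (act l x) = l ^ n * φ x

namespace MonVar

open ASSet

/-- Isomorphism in `Var_mon^n`: an equivariant bijection over `ℝ^*` whose graph is `AS`. -/
def Iso {n : ℕ} (X Y : MonVar n) : Prop :=
  ∃ e : X.T ≃ Y.T, X.toASSet.IsMap Y.toASSet e ∧
    (∀ l x, e (X.act l x) = Y.act l (e x)) ∧ ∀ x, Y.φ (e x) = X.φ x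

/-- An invariant `AS`-subset, with the restricted structure. -/
def sub {n : ℕ} (X : MonVar n) (S : Set X.T) (hS : IsAS (X.emb '' S))
    (hinv : ∀ l, ∀ x ∈ S, X.act l x ∈ S) : MonVar n where
  toASSet := X.toASSet.sub S hS
  act l x := ⟨X.act l x.1, hinv l x.1 x.2⟩
  one_act x := Subtype.ext (X.one_act x.1)
  mul_act l l' x := Subtype.ext (X.mul_act l l' x.1)
  act_isMap := by
    have h := X.act_isMap.inter (hS.comap fun i => Sum.inl (Sum.inr i))
    refine isMap_of_graph_eq h (Set.ext fun z => ⟨?_, ?_⟩)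
    · intro hz
      obtain ⟨p, h1, h2⟩ := mem_graph.1 hz
      exact ⟨mem_graph.2 ⟨(p.1, p.2.1), h1, h2⟩, p.2.1, p.2.2,
        (congrArg (fun w => w ∘ Sum.inr) h1).symm⟩
    · rintro ⟨hz, x, hx, h3⟩
      obtain ⟨p, h1, h2⟩ := mem_graph.1 hz
      have : x = p.2 := X.inj (h3.trans (congrArg (fun w => w ∘ Sum.inr) h1))
      subst this
      exact mem_graph.2 ⟨(p.1, ⟨p.2, hx⟩), h1, h2⟩
  φ x := X.φ x.1
  φ_isMap := by
    have h := X.φ_isMap.inter (hS.comap fun i => Sum.inl i)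
    refine isMap_of_graph_eq h (Set.ext fun z => ⟨?_, ?_⟩)
    · intro hz
      obtain ⟨x, h1, h2⟩ := mem_graph.1 hz
      exact ⟨mem_graph.2 ⟨x.1, h1, h2⟩, x.1, x.2, h1.symm⟩
    · rintro ⟨hz, y, hy, h3⟩
      obtain ⟨x, h1, h2⟩ := mem_graph.1 hz
      have : y = x := X.inj (h3.trans h1)
      subst this
      exact mem_graph.2 ⟨⟨y, hy⟩, h1, h2⟩
  φ_act l x := X.φ_act l x.1

lemma compl_inv {n : ℕ} (X : MonVar n) {S : Set X.T} (hinv : ∀ l, ∀ x ∈ S, X.act l x ∈ S) :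
    ∀ l, ∀ x ∈ Sᶜ, X.act l x ∈ Sᶜ := by
  intro l x hx h
  have := hinv l⁻¹ _ h
  rw [← X.mul_act, inv_mul_cancel, X.one_act] at this
  exact hx this

/-- The unit `ℝ^* → ℝ^*`, with the action `l • a = l ^ n * a`. -/
def one (n : ℕ) : MonVar n where
  toASSet := Gm
  act l (a : ℝˣ) := (l ^ n * a : ℝˣ)
  one_act (a : ℝˣ) := by simp
  mul_act l l' (a : ℝˣ) := by rw [mul_pow, mul_assoc]
  act_isMap := by
    refine isMap_of_poly (fun _ => MvPolynomial.X (Sum.inl ()) ^ n * MvPolynomial.X (Sum.inr ()))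
      fun p u => ?_
    show ((p.1 ^ n * p.2 : ℝˣ) : ℝ) = _
    simp
  φ := id
  φ_isMap := isMap_of_reindex id fun _ => rfl
  φ_act _ _ := rfl

lemma isAS_fiberProd {n : ℕ} (X Y : MonVar n) :
    IsAS (Set.range fun p : {p : X.T × Y.T // X.φ p.1 = Y.φ p.2} =>
      (Sum.elim (Sum.elim (X.emb p.1.1) (Y.emb p.1.2)) fun _ => (X.φ p.1.1 : ℝ) :
        (X.ι ⊕ Y.ι) ⊕ Unit → ℝ)) := by
  convert (X.φ_isMap.comap (Sum.map Sum.inl id : X.ι ⊕ Unit → (X.ι ⊕ Y.ι) ⊕ Unit)).inter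
    (Y.φ_isMap.comap (Sum.map Sum.inr id : Y.ι ⊕ Unit → (X.ι ⊕ Y.ι) ⊕ Unit)) using 1
  ext z
  constructor
  · rintro ⟨⟨⟨x, y⟩, h⟩, rfl⟩
    refine ⟨mem_graph.2 ⟨x, rfl, rfl⟩, mem_graph.2 ⟨y, rfl, ?_⟩⟩
    exact funext fun _ => congrArg Units.val h
  · rintro ⟨h1, h2⟩
    obtain ⟨x, hx1, hx2⟩ := mem_graph.1 h1
    obtain ⟨y, hy1, hy2⟩ := mem_graph.1 h2
    have hxy : X.φ x = Y.φ y := Gm.inj (hx2.symm.trans hy2)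
    refine ⟨⟨(x, y), hxy⟩, funext ?_⟩
    rintro ((i | i) | u)
    · exact (congrFun hx1 i).symm
    · exact (congrFun hy1 i).symm
    · exact (congrFun hx2 u).symm

/-- The fibre product over `ℝ^*` with the diagonal action. It is embedded by the coordinates of
the two factors and the common value in `ℝ^*`. -/
def fiberProd {n : ℕ} (X Y : MonVar n) : MonVar n where
  T := {p : X.T × Y.T // X.φ p.1 = Y.φ p.2}
  ι := (X.ι ⊕ Y.ι) ⊕ Unit
  emb p := Sum.elim (Sum.elim (X.emb p.1.1) (Y.emb p.1.2)) fun _ => (X.φ p.1.1 : ℝ)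
  inj := by
    rintro ⟨⟨x, y⟩, h⟩ ⟨⟨x', y'⟩, h'⟩ hh
    have h1 : X.emb x = X.emb x' := funext fun i => congrFun hh (Sum.inl (Sum.inl i))
    have h2 : Y.emb y = Y.emb y' := funext fun i => congrFun hh (Sum.inl (Sum.inr i))
    have h1 := X.inj h1
    have h2 := Y.inj h2
    subst h1 h2
    rfl
  isAS := isAS_fiberProd X Y
  act l p := ⟨(X.act l p.1.1, Y.act l p.1.2), by rw [X.φ_act, Y.φ_act, p.2]⟩
  one_act p := Subtype.ext (Prod.ext (X.one_act _) (Y.one_act _))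
  mul_act l l' p := Subtype.ext (Prod.ext (X.mul_act _ _ _) (Y.mul_act _ _ _))
  act_isMap := by
    have hE : IsAS (Set.range fun p : {p : X.T × Y.T // X.φ p.1 = Y.φ p.2} =>
      (Sum.elim (Sum.elim (X.emb p.1.1) (Y.emb p.1.2)) fun _ => (X.φ p.1.1 : ℝ) :
        (X.ι ⊕ Y.ι) ⊕ Unit → ℝ)) := isAS_fiberProd X Y
    have h := ((hE.comap fun i => (Sum.inl (Sum.inr i) :
        (Unit ⊕ ((X.ι ⊕ Y.ι) ⊕ Unit)) ⊕ ((X.ι ⊕ Y.ι) ⊕ Unit))).inter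
      (hE.comap fun i => Sum.inr i)).inter
      ((X.act_isMap.comap (Sum.map (Sum.map id fun i => Sum.inl (Sum.inl i))
        fun i => Sum.inl (Sum.inl i))).inter
       (Y.act_isMap.comap (Sum.map (Sum.map id fun i => Sum.inl (Sum.inr i))
        fun i => Sum.inl (Sum.inr i))))
    refine isMap_of_graph_eq h (Set.ext fun z => ⟨?_, ?_⟩)
    · intro hz
      obtain ⟨⟨l, p⟩, h1, h2⟩ := mem_graph.1 hz
      refine ⟨⟨⟨p, funext fun i => (congrFun h1 (Sum.inr i)).symm⟩, ⟨_, h2.symm⟩⟩,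
        mem_graph.2 ⟨(l, p.1.1), funext ?_, funext fun i => congrFun h2 (Sum.inl (Sum.inl i))⟩,
        mem_graph.2 ⟨(l, p.1.2), funext ?_, funext fun i => congrFun h2 (Sum.inl (Sum.inr i))⟩⟩
      · rintro (u | i)
        · exact congrFun h1 (Sum.inl u)
        · exact congrFun h1 (Sum.inr (Sum.inl (Sum.inl i)))
      · rintro (u | i)
        · exact congrFun h1 (Sum.inl u)
        · exact congrFun h1 (Sum.inr (Sum.inl (Sum.inr i)))
    · rintro ⟨⟨⟨p, hp⟩, ⟨q, hq⟩⟩, hx, hy⟩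
      obtain ⟨⟨l, x⟩, hx1, hx2⟩ := mem_graph.1 hx
      obtain ⟨⟨l', y⟩, hy1, hy2⟩ := mem_graph.1 hy
      have ex : x = p.1.1 := X.inj <| funext fun i =>
        (congrFun hx1 (Sum.inr i)).symm.trans (congrFun hp (Sum.inl (Sum.inl i))).symm
      have ey : y = p.1.2 := Y.inj <| funext fun i =>
        (congrFun hy1 (Sum.inr i)).symm.trans (congrFun hp (Sum.inl (Sum.inr i))).symm
      have el : l = l' := Gm.inj <| funext fun i =>
        (congrFun hx1 (Sum.inl i)).symm.trans (congrFun hy1 (Sum.inl i))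
      have ex' : q.1.1 = X.act l p.1.1 := X.inj <| funext fun i => by
        rw [← ex]
        exact (congrFun hq (Sum.inl (Sum.inl i))).trans (congrFun hx2 i)
      have ey' : q.1.2 = Y.act l p.1.2 := Y.inj <| funext fun i => by
        rw [← ey, el]
        exact (congrFun hq (Sum.inl (Sum.inr i))).trans (congrFun hy2 i)
      refine mem_graph.2 ⟨(l, p), funext ?_, ?_⟩
      · rintro (u | i)
        · exact congrFun hx1 (Sum.inl u)
        · exact (congrFun hp i).symm
      · have : q = ⟨(X.act l p.1.1, Y.act l p.1.2), by rw [X.φ_act, Y.φ_act, p.2]⟩ :=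
          Subtype.ext (Prod.ext ex' ey')
        rw [← this]
        exact hq.symm
  φ p := X.φ p.1.1
  φ_isMap := isMap_of_reindex Sum.inr fun _ => rfl
  φ_act l p := X.φ_act l _

end MonVar

namespace MonVar
open ASSet

/-- `ℝ^*` acting on `Y × ℝ^m` by a lifting `σ` of the action on `Y`, over `φ ∘ pr_Y`. -/
def affineLift {n : ℕ} (Y : MonVar n) (m : ℕ)
    (σ : ℝˣ → (Y.prod (affine m)).T → (Y.prod (affine m)).T)
    (one_act : ∀ p, σ 1 p = p) (mul_act : ∀ l l' p, σ (l * l') p = σ l (σ l' p))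
    (isMap : (Gm.prod (Y.prod (affine m))).IsMap (Y.prod (affine m)) fun p => σ p.1 p.2)
    (lifts : ∀ l p, (σ l p).1 = Y.act l p.1) : MonVar n where
  toASSet := Y.prod (affine m)
  act := σ
  one_act := one_act
  mul_act := mul_act
  act_isMap := isMap
  φ p := Y.φ p.1
  φ_isMap := by
    have h := ((Y.prod (affine m)).isAS.comap
        (Sum.inl : _ → (Y.ι ⊕ Fin m) ⊕ Unit)).inter
      (Y.φ_isMap.comap (Sum.map Sum.inl id : Y.ι ⊕ Unit → (Y.ι ⊕ Fin m) ⊕ Unit))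
    refine isMap_of_graph_eq h (Set.ext fun z => ⟨?_, ?_⟩)
    · intro hz
      obtain ⟨p, h1, h2⟩ := mem_graph.1 hz
      exact ⟨⟨p, h1.symm⟩, mem_graph.2 ⟨p.1, funext fun i => congrFun h1 (Sum.inl i), h2⟩⟩
    · rintro ⟨⟨p, h1⟩, h2⟩
      obtain ⟨y, h3, h4⟩ := mem_graph.1 h2
      have : y = p.1 := Y.inj (h3.symm.trans (funext fun i => (congrFun h1 (Sum.inl i)).symm))
      subst this
      exact mem_graph.2 ⟨p, h1.symm, h4⟩
  φ_act l p := by rw [lifts, Y.φ_act]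

/-- The functor `θ : Var_mon^m → Var_mon^n` for `n = k * m`: the action of `l` is replaced by that
of `l ^ k`. -/
def theta {m n : ℕ} (h : m ∣ n) (X : MonVar m) : MonVar n where
  toASSet := X.toASSet
  act l x := X.act (l ^ (n / m)) x
  one_act x := by rw [one_pow, X.one_act]
  mul_act l l' x := by rw [mul_pow, X.mul_act]
  act_isMap := by
    let g : ((Unit ⊕ X.ι) ⊕ X.ι → ℝ) → ((Unit ⊕ X.ι) ⊕ X.ι → ℝ) := fun z =>
      Sum.elim (Sum.elim (fun u => z (Sum.inl (Sum.inl u)) ^ (n / m))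
        fun i => z (Sum.inl (Sum.inr i))) fun i => z (Sum.inr i)
    have hg : IsPolyMap g := by
      rintro ((u | i) | i)
      · exact ⟨MvPolynomial.X (Sum.inl (Sum.inl u)) ^ (n / m), fun z => by simp [g]⟩
      · exact ⟨MvPolynomial.X (Sum.inl (Sum.inr i)), fun z => by simp [g]⟩
      · exact ⟨MvPolynomial.X (Sum.inr i), fun z => by simp [g]⟩
    have h := ((Gm.prod X.toASSet).isAS.comap (Sum.inl : _ → (Unit ⊕ X.ι) ⊕ X.ι)).inter
      (X.act_isMap.preimage hg)
    refine isMap_of_graph_eq h (Set.ext fun z => ⟨?_, ?_⟩)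
    · intro hz
      obtain ⟨⟨l, x⟩, h1, h2⟩ := mem_graph.1 hz
      refine ⟨⟨(l, x), h1.symm⟩, mem_graph.2 ⟨((l ^ (n / m) : ℝˣ), x), funext ?_, h2⟩⟩
      rintro (u | i)
      · have : z (Sum.inl (Sum.inl u)) = (l : ℝˣ) := congrFun h1 (Sum.inl u)
        show z (Sum.inl (Sum.inl u)) ^ (n / m) = ((l ^ (n / m) : ℝˣ) : ℝ)
        rw [this, Units.val_pow_eq_pow_val]
      · exact congrFun h1 (Sum.inr i)
    · rintro ⟨⟨⟨l, x⟩, h1⟩, h2⟩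
      obtain ⟨⟨l', x'⟩, h3, h4⟩ := mem_graph.1 h2
      have hx : x' = x := X.inj <| funext fun i =>
        (congrFun h3 (Sum.inr i)).symm.trans (congrFun h1 (Sum.inr i)).symm
      have hl : l' = (l ^ (n / m) : ℝˣ) := by
        refine Units.ext ?_
        have e1 : z (Sum.inl (Sum.inl ())) ^ (n / m) = (l' : ℝˣ) := congrFun h3 (Sum.inl ())
        have e2 : ((l : ℝˣ) : ℝ) = z (Sum.inl (Sum.inl ())) := congrFun h1 (Sum.inl ())
        rw [Units.val_pow_eq_pow_val, e2, e1]
      subst hx hl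
      exact mem_graph.2 ⟨(l, x'), h1.symm, h4⟩
  φ := X.φ
  φ_isMap := X.φ_isMap
  φ_act l x := by rw [X.φ_act, ← pow_mul, Nat.div_mul_cancel h]

/-- `A × ℝ^* → ℝ^*`, with the trivial action on the `AS`-set `A`. -/
def timesGm (n : ℕ) (A : ASSet) : MonVar n where
  toASSet := A.prod Gm
  act l p := (p.1, (one n).act l p.2)
  one_act p := Prod.ext rfl ((one n).one_act p.2)
  mul_act l l' p := Prod.ext rfl ((one n).mul_act l l' p.2)
  act_isMap := by
    have h := (((Gm.prod (A.prod Gm)).isAS.comap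
        (Sum.inl : _ → (Unit ⊕ (A.ι ⊕ Unit)) ⊕ (A.ι ⊕ Unit))).inter
      ((one n).act_isMap.comap (Sum.map (Sum.map id Sum.inr) Sum.inr :
        (Unit ⊕ Unit) ⊕ Unit → (Unit ⊕ (A.ι ⊕ Unit)) ⊕ (A.ι ⊕ Unit)))).inter
      (isAS_comp_eq (fun i : A.ι => (Sum.inl (Sum.inr (Sum.inl i)) :
        (Unit ⊕ (A.ι ⊕ Unit)) ⊕ (A.ι ⊕ Unit))) fun i => Sum.inr (Sum.inl i))
    refine isMap_of_graph_eq h (Set.ext fun z => ⟨?_, ?_⟩)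
    · intro hz
      obtain ⟨⟨l, a, r⟩, h1, h2⟩ := mem_graph.1 hz
      refine ⟨⟨⟨_, h1.symm⟩, mem_graph.2 ⟨(l, r), funext ?_, funext fun u =>
        congrFun h2 (Sum.inr u)⟩⟩, funext fun i => ?_⟩
      · rintro (u | u)
        · exact congrFun h1 (Sum.inl u)
        · exact congrFun h1 (Sum.inr (Sum.inr u))
      · exact (congrFun h1 (Sum.inr (Sum.inl i))).trans (congrFun h2 (Sum.inl i)).symm
    · rintro ⟨⟨⟨⟨l, a, r⟩, h1⟩, h2⟩, h3⟩
      obtain ⟨⟨l', r'⟩, h4, h5⟩ := mem_graph.1 h2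
      have hl : l' = l := Gm.inj <| funext fun u =>
        (congrFun h4 (Sum.inl u)).symm.trans (congrFun h1 (Sum.inl u)).symm
      have hr : r' = r := Gm.inj <| funext fun u =>
        (congrFun h4 (Sum.inr u)).symm.trans (congrFun h1 (Sum.inr (Sum.inr u))).symm
      subst hl hr
      refine mem_graph.2 ⟨(l', a, r'), h1.symm, funext ?_⟩
      rintro (i | u)
      · exact (congrFun h3 i).symm.trans (congrFun h1 (Sum.inr (Sum.inl i))).symm
      · exact congrFun h5 u
  φ p := p.2
  φ_isMap := isMap_of_reindex Sum.inr fun _ => rfl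
  φ_act _ _ := rfl

end MonVar

/-! ### Grothendieck rings -/

/-- The relations of `K₀(AS)`. -/
inductive K0AS.Rel : FreeCommRing ASSet → FreeCommRing ASSet → Prop
  | iso (X Y : ASSet) (h : X.Iso Y) : K0AS.Rel (.of X) (.of Y)
  | closed (X : ASSet) (S : Set X.T) (hS : IsAS (X.emb '' S)) (hc : X.IsClosedIn S) :
      K0AS.Rel (.of X) (.of (X.sub Sᶜ (X.isAS_compl hS)) + .of (X.sub S hS))
  | prod (X Y : ASSet) : K0AS.Rel (.of X * .of Y) (.of (X.prod Y))
  | one : K0AS.Rel (.of (ASSet.affine 0)) 1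

/-- The Grothendieck ring `K₀(AS)` of `AS`-sets. -/
abbrev K0AS : Type 1 := RingQuot K0AS.Rel

/-- The class of an `AS`-set. -/
noncomputable def K0AS.cls (X : ASSet) : K0AS := RingQuot.mkRingHom K0AS.Rel (.of X)

/-- The relations of `K₀ⁿ`. The first three are those of the group: equivariant `AS`-bijections
over `ℝ^*`, closed invariant `AS`-subsets, and independence of the lifting of an action from `Y` to
`Y × ℝ^m`. They are stable under fibre products with any object, so that the ring presented below
has this group as its additive group; the last two relations say that its product is the fibre
product over `ℝ^*`, with unit the class of `id : ℝ^* → ℝ^*`. -/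
inductive K0n.Rel (n : ℕ) : FreeCommRing (MonVar n) → FreeCommRing (MonVar n) → Prop
  | iso (X Y : MonVar n) (h : X.Iso Y) : K0n.Rel n (.of X) (.of Y)
  | closed (X : MonVar n) (S : Set X.T) (hS : IsAS (X.emb '' S)) (hc : X.IsClosedIn S)
      (hinv : ∀ l, ∀ x ∈ S, X.act l x ∈ S) :
      K0n.Rel n (.of X)
        (.of (X.sub Sᶜ (X.isAS_compl hS) (X.compl_inv hinv)) + .of (X.sub S hS hinv))
  | lift (Y : MonVar n) (m : ℕ) (σ σ' : ℝˣ → (Y.prod (.affine m)).T → (Y.prod (.affine m)).T)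
      (h1 h2 h3 h4 h1' h2' h3' h4') :
      K0n.Rel n (.of (Y.affineLift m σ h1 h2 h3 h4)) (.of (Y.affineLift m σ' h1' h2' h3' h4'))
  | prod (X Y : MonVar n) : K0n.Rel n (.of X * .of Y) (.of (X.fiberProd Y))
  | one : K0n.Rel n (.of (MonVar.one n)) 1

/-- The Grothendieck ring `K₀ⁿ` of `Var_mon^n`. -/
abbrev K0n (n : ℕ) : Type 1 := RingQuot (K0n.Rel n)

namespace K0n

/-- The class of an object of `Var_mon^n`. -/
noncomputable def cls {n : ℕ} (X : MonVar n) : K0n n := RingQuot.mkRingHom (Rel n) (.of X)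

lemma cls_iso {n : ℕ} {X Y : MonVar n} (h : X.Iso Y) : cls X = cls Y :=
  RingQuot.mkRingHom_rel (.iso X Y h)

lemma cls_mul {n : ℕ} (X Y : MonVar n) : cls X * cls Y = cls (X.fiberProd Y) := by
  have := RingQuot.mkRingHom_rel (Rel.prod X Y)
  rwa [map_mul] at this

lemma cls_one (n : ℕ) : cls (MonVar.one n) = 1 := by
  have := RingQuot.mkRingHom_rel (Rel.one (n := n))
  rwa [map_one] at this

lemma cls_closed {n : ℕ} (X : MonVar n) (S : Set X.T) (hS : IsAS (X.emb '' S))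
    (hc : X.IsClosedIn S) (hinv : ∀ l, ∀ x ∈ S, X.act l x ∈ S) :
    cls X = cls (X.sub Sᶜ (X.isAS_compl hS) (X.compl_inv hinv)) + cls (X.sub S hS hinv) := by
  have := RingQuot.mkRingHom_rel (Rel.closed X S hS hc hinv)
  rwa [map_add] at this

lemma theta_lift {m n : ℕ} (h : m ∣ n) (Y : MonVar m) (k : ℕ)
    (σ σ' : ℝˣ → (Y.prod (.affine k)).T → (Y.prod (.affine k)).T)
    (h1 h2 h3 h4 h1' h2' h3' h4') :
    cls ((Y.affineLift k σ h1 h2 h3 h4).theta h) =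
      cls ((Y.affineLift k σ' h1' h2' h3' h4').theta h) :=
  RingQuot.mkRingHom_rel (.lift (Y.theta h) k
    ((Y.affineLift k σ h1 h2 h3 h4).theta h).act ((Y.affineLift k σ' h1' h2' h3' h4').theta h).act
    ((Y.affineLift k σ h1 h2 h3 h4).theta h).one_act
    ((Y.affineLift k σ h1 h2 h3 h4).theta h).mul_act
    ((Y.affineLift k σ h1 h2 h3 h4).theta h).act_isMap
    (fun _ p => h4 _ p)
    ((Y.affineLift k σ' h1' h2' h3' h4').theta h).one_act
    ((Y.affineLift k σ' h1' h2' h3' h4').theta h).mul_act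
    ((Y.affineLift k σ' h1' h2' h3' h4').theta h).act_isMap
    (fun _ p => h4' _ p))

lemma theta_one_iso {m n : ℕ} (h : m ∣ n) : ((MonVar.one m).theta h).Iso (MonVar.one n) := by
  refine ⟨Equiv.refl _, ASSet.isMap_of_reindex id fun _ => rfl, fun l (a : ℝˣ) => ?_, fun _ => rfl⟩
  show ((l ^ (n / m)) ^ m * a : ℝˣ) = l ^ n * a
  rw [← pow_mul, Nat.div_mul_cancel h]

lemma theta_rel {m n : ℕ} (h : m ∣ n) ⦃a b : FreeCommRing (MonVar m)⦄ (hab : Rel m a b) :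
    FreeCommRing.lift (fun X => cls (MonVar.theta h X)) a =
      FreeCommRing.lift (fun X => cls (MonVar.theta h X)) b := by
  induction hab with
  | iso X Y e =>
    rw [FreeCommRing.lift_of, FreeCommRing.lift_of]
    obtain ⟨e, h1, h2, h3⟩ := e
    exact cls_iso ⟨e, h1, fun l x => h2 _ x, h3⟩
  | closed X S hS hc hinv =>
    rw [map_add, FreeCommRing.lift_of, FreeCommRing.lift_of, FreeCommRing.lift_of]
    exact cls_closed (X.theta h) S hS hc fun l x hx => hinv _ x hx
  | lift Y k σ σ' h1 h2 h3 h4 h1' h2' h3' h4' =>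
    rw [FreeCommRing.lift_of, FreeCommRing.lift_of]
    exact theta_lift h Y k σ σ' h1 h2 h3 h4 h1' h2' h3' h4'
  | prod X Y =>
    rw [map_mul, FreeCommRing.lift_of, FreeCommRing.lift_of, FreeCommRing.lift_of, cls_mul]
    rfl
  | one =>
    rw [map_one, FreeCommRing.lift_of, cls_iso (theta_one_iso h), cls_one]

/-- The transition morphisms `K₀ᵐ → K₀ⁿ` for `m ∣ n`. -/
noncomputable def theta {m n : ℕ} (h : m ∣ n) : K0n m →+* K0n n :=
  RingQuot.lift ⟨FreeCommRing.lift fun X => cls (X.theta h), theta_rel h⟩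

lemma theta_cls {m n : ℕ} (h : m ∣ n) (X : MonVar m) : theta h (cls X) = cls (X.theta h) := by
  rw [theta, cls, RingQuot.lift_mkRingHom_apply _ (theta_rel h), FreeCommRing.lift_of]

end K0n

/-- The structure morphism `K₀(AS) → K₀ⁿ`, `[A] ↦ [A × ℝ^* → ℝ^*]`. -/
noncomputable def K0AS.toK0n (n : ℕ) : K0AS →+* K0n n :=
  RingQuot.lift ⟨FreeCommRing.lift fun A => K0n.cls (MonVar.timesGm n A), by
    intro a b hab
    induction hab with
    | iso X Y e =>
      rw [FreeCommRing.lift_of, FreeCommRing.lift_of]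
      obtain ⟨e, he⟩ := e
      refine K0n.cls_iso ⟨e.prodCongr (Equiv.refl _), ?_, fun _ _ => rfl, fun _ => rfl⟩
      have h := ((X.prod ASSet.Gm).isAS.comap
          (Sum.inl : _ → (X.ι ⊕ Unit) ⊕ (Y.ι ⊕ Unit))).inter
        ((he.comap (Sum.map Sum.inl Sum.inl : X.ι ⊕ Y.ι → (X.ι ⊕ Unit) ⊕ (Y.ι ⊕ Unit))).inter
        (isAS_comp_eq (fun u : Unit => (Sum.inl (Sum.inr u) : (X.ι ⊕ Unit) ⊕ (Y.ι ⊕ Unit)))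
          fun u => Sum.inr (Sum.inr u)))
      refine ASSet.isMap_of_graph_eq h (Set.ext fun z => ⟨?_, ?_⟩)
      · intro hz
        obtain ⟨⟨x, r⟩, h1, h2⟩ := ASSet.mem_graph.1 hz
        exact ⟨⟨_, h1.symm⟩, ASSet.mem_graph.2 ⟨x, funext fun i => congrFun h1 (Sum.inl i),
          funext fun i => congrFun h2 (Sum.inl i)⟩,
          funext fun u => (congrFun h1 (Sum.inr u)).trans (congrFun h2 (Sum.inr u)).symm⟩
      · rintro ⟨⟨⟨x, r⟩, h1⟩, h2, h3⟩
        obtain ⟨x', h4, h5⟩ := ASSet.mem_graph.1 h2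
        have : x' = x := X.inj <| funext fun i =>
          (congrFun h4 i).symm.trans (congrFun h1 (Sum.inl i)).symm
        subst this
        refine ASSet.mem_graph.2 ⟨(x', r), h1.symm, funext ?_⟩
        rintro (i | u)
        · exact congrFun h5 i
        · exact (congrFun h3 u).symm.trans (congrFun h1 (Sum.inr u)).symm
    | closed X S hS hc =>
      rw [map_add, FreeCommRing.lift_of, FreeCommRing.lift_of, FreeCommRing.lift_of]
      have hS' : IsAS ((X.prod ASSet.Gm).emb '' {p | p.1 ∈ S}) := by
        have h := (X.prod ASSet.Gm).isAS.inter (hS.comap (Sum.inl : X.ι → X.ι ⊕ Unit))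
        convert h using 1
        ext z
        constructor
        · rintro ⟨p, hp, rfl⟩
          exact ⟨⟨p, rfl⟩, p.1, hp, rfl⟩
        · rintro ⟨⟨p, rfl⟩, x, hx, h1⟩
          refine ⟨p, ?_, rfl⟩
          have : x = p.1 := X.inj h1
          subst this
          exact hx
      have hc' : (X.prod ASSet.Gm).IsClosedIn {p | p.1 ∈ S} := by
        obtain ⟨C, hC, rfl⟩ := hc
        exact ⟨{z | z ∘ Sum.inl ∈ C}, hC.preimage (by fun_prop), rfl⟩
      rw [K0n.cls_closed (MonVar.timesGm n X) {p | p.1 ∈ S} hS' hc' fun l p hp => hp]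
      congr 1
      · refine K0n.cls_iso ⟨⟨fun p => (⟨p.1.1, p.2⟩, p.1.2), fun p => ⟨(p.1.1, p.2), p.1.2⟩,
          fun _ => rfl, fun _ => rfl⟩, ASSet.isMap_of_reindex id fun _ => rfl,
          fun _ _ => rfl, fun _ => rfl⟩
      · refine K0n.cls_iso ⟨⟨fun p => (⟨p.1.1, p.2⟩, p.1.2), fun p => ⟨(p.1.1, p.2), p.1.2⟩,
          fun _ => rfl, fun _ => rfl⟩, ASSet.isMap_of_reindex id fun _ => rfl,
          fun _ _ => rfl, fun _ => rfl⟩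
    | prod X Y =>
      rw [map_mul, FreeCommRing.lift_of, FreeCommRing.lift_of, FreeCommRing.lift_of, K0n.cls_mul]
      symm
      refine K0n.cls_iso ⟨⟨fun p => ⟨((p.1.1, p.2), (p.1.2, p.2)), rfl⟩,
        fun p => ((p.1.1.1, p.1.2.1), p.1.1.2), fun _ => rfl, ?_⟩,
        ASSet.isMap_of_reindex (Sum.elim (Sum.elim
          (Sum.map Sum.inl id) (Sum.map Sum.inr id)) Sum.inr) ?_,
        fun _ _ => rfl, fun _ => rfl⟩
      · rintro ⟨⟨⟨x, r⟩, ⟨y, s⟩⟩, h⟩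
        have h : r = s := h
        subst h
        rfl
      · intro p
        funext i
        rcases i with ((i | i) | (i | i)) | i <;> rfl
    | one =>
      rw [map_one, FreeCommRing.lift_of, ← K0n.cls_one]
      refine K0n.cls_iso ⟨⟨fun p => p.2, fun r => (Fin.elim0, r), fun p => ?_, fun _ => rfl⟩,
        ASSet.isMap_of_reindex Sum.inr fun _ => rfl, fun _ _ => rfl, fun _ => rfl⟩
      exact Prod.ext (Subsingleton.elim _ _) rfl⟩

/-- The positive integers, ordered by divisibility. -/
structure Level : Type where
  val : ℕ
  pos : 0 < val

instance : Preorder Level where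
  le m n := m.val ∣ n.val
  le_refl _ := dvd_rfl
  le_trans _ _ _ := dvd_trans

instance : Nonempty Level := ⟨⟨1, one_pos⟩⟩

instance : IsDirectedOrder Level where
  directed m n := ⟨⟨m.val * n.val, Nat.mul_pos m.pos n.pos⟩, Dvd.intro _ rfl, Dvd.intro_left _ rfl⟩

/-- `K₀ = colim K₀ⁿ`, over the positive integers ordered by divisibility. -/
abbrev K0 : Type 1 :=
  Ring.DirectLimit (fun n : Level => K0n n.val) fun _ _ h => ⇑(K0n.theta h)

namespace K0

/-- The canonical morphism `K₀ⁿ → K₀`, for `n ≥ 1`. -/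
noncomputable def of (n : ℕ) (h : 0 < n) : K0n n →+* K0 :=
  Ring.DirectLimit.of (fun n : Level => K0n n.val) (fun _ _ h => ⇑(K0n.theta h)) ⟨n, h⟩

/-- The class in `K₀` of an object of `Var_mon^n`, for `n ≥ 1`. -/
noncomputable def cls {n : ℕ} (h : 0 < n) (X : MonVar n) : K0 := of n h (K0n.cls X)

lemma of_theta {m n : ℕ} (hm : 0 < m) (hn : 0 < n) (h : m ∣ n) (x : K0n m) :
    of n hn (K0n.theta h x) = of m hm x :=
  Ring.DirectLimit.of_f (G := fun n : Level => K0n n.val)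
    (f := fun _ _ h => ⇑(K0n.theta h)) (i := ⟨m, hm⟩) (j := ⟨n, hn⟩) h x

end K0

/-- The structure morphism `K₀(AS) → K₀`, `[A] ↦ [A] · 1`. -/
noncomputable def K0AS.toK0 : K0AS →+* K0 := (K0.of 1 one_pos).comp (K0AS.toK0n 1)

/-- `𝕃 = [ℝ × ℝ^* → ℝ^*]`, the image of the class of the affine line. -/
noncomputable def lefschetz : K0 := K0AS.toK0 (K0AS.cls (ASSet.affine 1))

/-- The dimension of an `AS`-set: the largest number of coordinates such that the projection to
these coordinates has non-empty interior. (This is the usual dimension of semialgebraic sets. The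
empty set gets the value `0`, which is harmless since its class is zero.) -/
noncomputable def ASSet.dim (X : ASSet) : ℕ :=
  sSup {e | ∃ J : Finset X.ι, J.card = e ∧
    (interior (Set.range fun (x : X.T) (i : J) => X.emb x i)).Nonempty}

lemma ASSet.card_le_dim {X : ASSet} (J : Finset X.ι)
    (h : (interior (Set.range fun (x : X.T) (i : J) => X.emb x i)).Nonempty) :
    J.card ≤ X.dim := by
  cases nonempty_fintype X.ι
  refine le_csSup ⟨Fintype.card X.ι, ?_⟩ ⟨J, rfl, h⟩
  rintro e ⟨J, rfl, _⟩
  exact Finset.card_le_univ J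

lemma interior_range_of_comp {T T' ι κ : Type} [Finite ι] [Finite κ] {f : T → ι → ℝ}
    {g : T' → κ → ℝ} (e : κ → ι) (he : Function.Injective e) (p : T → T')
    (h : ∀ x, g (p x) = f x ∘ e) (hf : (interior (Set.range f)).Nonempty) :
    (interior (Set.range g)).Nonempty := by
  have hop : IsOpenMap (LinearMap.funLeft ℝ ℝ e) :=
    LinearMap.isOpenMap_of_finiteDimensional _ (LinearMap.funLeft_surjective_of_injective ℝ ℝ e he)
  obtain ⟨w, hw⟩ := hf
  refine ⟨LinearMap.funLeft ℝ ℝ e w, mem_interior.2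
    ⟨_, ?_, hop _ isOpen_interior, Set.mem_image_of_mem _ hw⟩⟩
  rintro _ ⟨v, hv, rfl⟩
  obtain ⟨x, rfl⟩ := interior_subset hv
  exact ⟨p x, h x⟩

lemma MonVar.dim_fiberProd {n : ℕ} (X Y : MonVar n) :
    (X.fiberProd Y).dim ≤ X.dim + Y.dim + 1 := by
  classical
  refine csSup_le' ?_
  rintro e ⟨J, rfl, hJ⟩
  let a : X.ι → (X.ι ⊕ Y.ι) ⊕ Unit := fun i => Sum.inl (Sum.inl i)
  let b : Y.ι → (X.ι ⊕ Y.ι) ⊕ Unit := fun i => Sum.inl (Sum.inr i)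
  have ha : Function.Injective a := fun i j h => Sum.inl_injective (Sum.inl_injective h)
  have hb : Function.Injective b := fun i j h => Sum.inr_injective (Sum.inl_injective h)
  let J' : Finset ((X.ι ⊕ Y.ι) ⊕ Unit) := J
  have hXc : (J'.preimage a ha.injOn).card ≤ X.dim := by
    refine ASSet.card_le_dim _ ?_
    refine interior_range_of_comp
      (fun i : (J'.preimage a ha.injOn) => (⟨a i.1, Finset.mem_preimage.1 i.2⟩ : J')) ?_
      (fun p : (X.fiberProd Y).T => p.1.1) (fun p => rfl) hJ
    intro i j h
    exact Subtype.ext (ha (congrArg Subtype.val h))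
  have hYc : (J'.preimage b hb.injOn).card ≤ Y.dim := by
    refine ASSet.card_le_dim _ ?_
    refine interior_range_of_comp
      (fun i : (J'.preimage b hb.injOn) => (⟨b i.1, Finset.mem_preimage.1 i.2⟩ : J')) ?_
      (fun p : (X.fiberProd Y).T => p.1.2) (fun p => rfl) hJ
    intro i j h
    exact Subtype.ext (hb (congrArg Subtype.val h))
  have hsub : J' ⊆ ((J'.preimage a ha.injOn).image a ∪ (J'.preimage b hb.injOn).image b) ∪
      {Sum.inr ()} := by
    intro i hi
    rcases i with (i | i) | u
    · refine Finset.mem_union_left _ (Finset.mem_union_left _ ?_)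
      exact Finset.mem_image.2 ⟨i, Finset.mem_preimage.2 hi, rfl⟩
    · refine Finset.mem_union_left _ (Finset.mem_union_right _ ?_)
      exact Finset.mem_image.2 ⟨i, Finset.mem_preimage.2 hi, rfl⟩
    · exact Finset.mem_union_right _ (Finset.mem_singleton.2 rfl)
  have h1 := Finset.card_le_card hsub
  have h2 := Finset.card_union_le
    ((J'.preimage a ha.injOn).image a ∪ (J'.preimage b hb.injOn).image b) {Sum.inr ()}
  have h3 := Finset.card_union_le
    ((J'.preimage a ha.injOn).image a) ((J'.preimage b hb.injOn).image b)
  have h4 := Finset.card_image_le (s := J'.preimage a ha.injOn) (f := a)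
  have h5 := Finset.card_image_le (s := J'.preimage b hb.injOn) (f := b)
  rw [Finset.card_singleton] at h2
  show J'.card ≤ _
  omega

/-- `𝓜 = K₀[𝕃⁻¹]`; it is also the colimit of the rings `K₀ⁿ[𝕃⁻¹]`. -/
def M : Type 1 := Localization.Away lefschetz

noncomputable instance : CommRing M := inferInstanceAs (CommRing (Localization.Away lefschetz))

noncomputable instance : Algebra K0 M :=
  inferInstanceAs (Algebra K0 (Localization.Away lefschetz))

instance : IsLocalization.Away lefschetz M :=
  inferInstanceAs (IsLocalization.Away lefschetz (Localization.Away lefschetz))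

namespace M

/-- The class `𝕃`, as a unit of `𝓜`. -/
noncomputable def L : Mˣ := (IsLocalization.Away.algebraMap_isUnit (S := M) lefschetz).unit

/-- The filtration of `𝓜`: `F^m` is the subgroup spanned by the `[S] 𝕃^{-i}` with
`i - dim S ≥ m`. -/
noncomputable def filtration (m : ℤ) : AddSubgroup M :=
  AddSubgroup.closure {x | ∃ (n : ℕ) (hn : 0 < n) (S : MonVar n) (i : ℤ),
    m ≤ i - S.dim ∧ x = algebraMap K0 M (K0.cls hn S) * ((L ^ (-i) : Mˣ) : M)}

lemma filtration_anti {m m' : ℤ} (h : m ≤ m') : filtration m' ≤ filtration m := by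
  refine AddSubgroup.closure_mono ?_
  rintro x ⟨n, hn, S, i, h1, h2⟩
  exact ⟨n, hn, S, i, h.trans h1, h2⟩

lemma cls_mul_cls {n m : ℕ} (hn : 0 < n) (hm : 0 < m) (X : MonVar n) (Y : MonVar m) :
    ∃ Z : MonVar (n * m), K0.cls hn X * K0.cls hm Y = K0.cls (Nat.mul_pos hn hm) Z ∧
      Z.dim ≤ X.dim + Y.dim + 1 := by
  refine ⟨(X.theta (Dvd.intro _ rfl)).fiberProd (Y.theta (Dvd.intro_left _ rfl)), ?_,
    MonVar.dim_fiberProd _ _⟩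
  rw [K0.cls, K0.cls, ← K0.of_theta hn (Nat.mul_pos hn hm) (Dvd.intro _ rfl),
    ← K0.of_theta hm (Nat.mul_pos hn hm) (Dvd.intro_left _ rfl), ← map_mul, K0n.theta_cls,
    K0n.theta_cls, K0n.cls_mul]
  rfl

lemma filtration_mul {m m' : ℤ} {x y : M} (hx : x ∈ filtration m) (hy : y ∈ filtration m') :
    x * y ∈ filtration (m + m' - 1) := by
  induction hx using AddSubgroup.closure_induction with
  | mem x hx =>
    obtain ⟨n, hn, S, i, h1, rfl⟩ := hx
    induction hy using AddSubgroup.closure_induction with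
    | mem y hy =>
      obtain ⟨n', hn', S', i', h1', rfl⟩ := hy
      obtain ⟨Z, hZ, hd⟩ := cls_mul_cls hn hn' S S'
      refine AddSubgroup.subset_closure ⟨_, Nat.mul_pos hn hn', Z, i + i', ?_, ?_⟩
      · have : (Z.dim : ℤ) ≤ S.dim + S'.dim + 1 := by exact_mod_cast hd
        omega
      · rw [← hZ, map_mul, neg_add, zpow_add, Units.val_mul]
        ring
    | zero => rw [mul_zero]; exact zero_mem _
    | add y y' _ _ h h' => rw [mul_add]; exact add_mem h h'
    | neg y _ h => rw [mul_neg]; exact neg_mem h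
  | zero => rw [zero_mul]; exact zero_mem _
  | add x x' _ _ h h' => rw [add_mul]; exact add_mem h h'
  | neg x _ h => rw [neg_mul]; exact neg_mem h

lemma K0n_span (n : ℕ) (x : K0n n) :
    x ∈ AddSubgroup.closure (Set.range (K0n.cls : MonVar n → K0n n)) := by
  obtain ⟨x, rfl⟩ := RingQuot.mkRingHom_surjective _ x
  induction x using FreeCommRing.induction_on with
  | neg_one =>
    rw [map_neg, map_one, ← K0n.cls_one]
    exact neg_mem (AddSubgroup.subset_closure ⟨_, rfl⟩)
  | of X => exact AddSubgroup.subset_closure ⟨X, rfl⟩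
  | add x y hx hy => rw [map_add]; exact add_mem hx hy
  | mul x y hx hy =>
    rw [map_mul]
    generalize RingQuot.mkRingHom (K0n.Rel n) x = x at hx
    generalize RingQuot.mkRingHom (K0n.Rel n) y = y at hy
    induction hx using AddSubgroup.closure_induction with
    | mem x hx =>
      obtain ⟨X, rfl⟩ := hx
      induction hy using AddSubgroup.closure_induction with
      | mem y hy =>
        obtain ⟨Y, rfl⟩ := hy
        rw [K0n.cls_mul]
        exact AddSubgroup.subset_closure ⟨_, rfl⟩
      | zero => rw [mul_zero]; exact zero_mem _
      | add y y' _ _ h h' => rw [mul_add]; exact add_mem h h'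
      | neg y _ h => rw [mul_neg]; exact neg_mem h
    | zero => rw [zero_mul]; exact zero_mem _
    | add x x' _ _ h h' => rw [add_mul]; exact add_mem h h'
    | neg x _ h => rw [neg_mul]; exact neg_mem h

lemma exists_mem_filtration_K0 (x : K0) (i : ℤ) :
    ∃ m, algebraMap K0 M x * ((L ^ (-i) : Mˣ) : M) ∈ filtration m := by
  obtain ⟨⟨n, hn⟩, x, rfl⟩ := Ring.DirectLimit.exists_of x
  have hx := K0n_span n x
  change ∃ m, algebraMap K0 M (K0.of n hn x) * ((L ^ (-i) : Mˣ) : M) ∈ filtration m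
  induction hx using AddSubgroup.closure_induction with
  | mem x hx =>
    obtain ⟨X, rfl⟩ := hx
    exact ⟨i - X.dim, AddSubgroup.subset_closure ⟨n, hn, X, i, le_rfl, rfl⟩⟩
  | zero => exact ⟨0, by rw [map_zero, map_zero, zero_mul]; exact zero_mem _⟩
  | add x y _ _ hx hy =>
    obtain ⟨m, hm⟩ := hx
    obtain ⟨m', hm'⟩ := hy
    refine ⟨min m m', ?_⟩
    rw [map_add, map_add, add_mul]
    exact add_mem (filtration_anti (min_le_left _ _) hm) (filtration_anti (min_le_right _ _) hm')
  | neg x _ hx =>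
    obtain ⟨m, hm⟩ := hx
    exact ⟨m, by rw [map_neg, map_neg, neg_mul]; exact neg_mem hm⟩

lemma exists_mem_filtration (x : M) : ∃ m, x ∈ filtration m := by
  obtain ⟨n, a, h⟩ := IsLocalization.Away.surj lefschetz x
  obtain ⟨m, hm⟩ := exists_mem_filtration_K0 a n
  refine ⟨m, ?_⟩
  have hL : ((L : Mˣ) : M) = algebraMap K0 M lefschetz := rfl
  rw [← h, ← hL, zpow_neg, zpow_natCast, ← Units.val_pow_eq_pow_val, mul_assoc,
    ← Units.val_mul, mul_inv_cancel, Units.val_one, mul_one] at hm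
  exact hm

theorem filtration_basis : RingSubgroupsBasis filtration :=
  RingSubgroupsBasis.of_comm _
    (fun i j => ⟨max i j, le_inf (filtration_anti (le_max_left _ _))
      (filtration_anti (le_max_right _ _))⟩)
    (fun i => ⟨|i| + 1, by
      rintro _ ⟨x, hx, y, hy, rfl⟩
      refine filtration_anti ?_ (filtration_mul hx hy)
      have := le_abs_self i
      have := abs_nonneg i
      omega⟩)
    (fun x i => by
      obtain ⟨m, hm⟩ := exists_mem_filtration x
      refine ⟨i - m + 1, fun y hy => ?_⟩
      have := filtration_mul hm hy
      rwa [show m + (i - m + 1) - 1 = i by ring] at this)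

/-- The uniform structure on `𝓜` for which the subgroups `F^m` are the basic neighbourhoods
of `0`. -/
noncomputable instance : UniformSpace M :=
  letI := filtration_basis.topology
  haveI : IsTopologicalRing M := filtration_basis.toRingFilterBasis.isTopologicalRing
  IsTopologicalAddGroup.rightUniformSpace M

instance : IsTopologicalRing M := filtration_basis.toRingFilterBasis.isTopologicalRing

instance : IsUniformAddGroup M :=
  letI := filtration_basis.topology
  haveI : IsTopologicalRing M := filtration_basis.toRingFilterBasis.isTopologicalRing
  isUniformAddGroup_of_addCommGroup

end M

/-- The completion of `𝓜` with respect to the filtration (the Hausdorff completion, that is, the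
limit of the quotients `𝓜 / F^m`), as a topological ring. -/
abbrev MHat : Type 1 := UniformSpace.Completion M

/-- The canonical morphism `𝓜 → 𝓜^`. -/
noncomputable def M.toHat : M →+* MHat := UniformSpace.Completion.coeRingHom

/-- The canonical morphism `K₀ → 𝓜^`. -/
noncomputable def K0.toHat : K0 →+* MHat := M.toHat.comp (algebraMap K0 M)

/-! ### The motivic local zeta function -/

/-- A point `a` of `𝓛ₙ(ℝ^d)`, given by the coefficients of a Taylor polynomial of order `n`,
viewed as a tuple of polynomials in `t`. -/
noncomputable def jetArc {d n : ℕ} (a : Fin d × Fin (n + 1) → ℝ) (i : Fin d) : Polynomial ℝ :=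
  ∑ j : Fin (n + 1), Polynomial.C (a (i, j)) * Polynomial.X ^ (j : ℕ)

/-- The polynomial `f(γ(t))`. -/
noncomputable def evalJet {d n : ℕ} (f : MvPolynomial (Fin d) ℝ) (a : Fin d × Fin (n + 1) → ℝ) :
    Polynomial ℝ :=
  MvPolynomial.aeval (jetArc a) f

/-- The coefficients of `f(γ(t))` are polynomials in those of `γ`. -/
noncomputable def jetCoeff {d : ℕ} (n : ℕ) (f : MvPolynomial (Fin d) ℝ) (m : ℕ) :
    MvPolynomial (Fin d × Fin (n + 1)) ℝ :=
  (MvPolynomial.eval₂ (algebraMap ℝ (Polynomial (MvPolynomial (Fin d × Fin (n + 1)) ℝ)))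
    (fun i => ∑ j : Fin (n + 1), Polynomial.C (MvPolynomial.X (i, j)) * Polynomial.X ^ (j : ℕ))
    f).coeff m

lemma eval_jetCoeff {d n : ℕ} (f : MvPolynomial (Fin d) ℝ) (m : ℕ)
    (a : Fin d × Fin (n + 1) → ℝ) :
    MvPolynomial.eval a (jetCoeff n f m) = (evalJet f a).coeff m := by
  rw [jetCoeff, ← Polynomial.coeff_map, evalJet, MvPolynomial.aeval_def]
  congr 1
  rw [← Polynomial.coe_mapRingHom, MvPolynomial.eval₂_comp_left]
  congr 1
  · ext r
    simp [Polynomial.algebraMap_eq, IsScalarTower.algebraMap_apply ℝ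
      (MvPolynomial (Fin d × Fin (n + 1)) ℝ) (Polynomial (MvPolynomial (Fin d × Fin (n + 1)) ℝ))]
  · funext i
    simp [jetArc, Polynomial.map_sum]

/-- The arc `γ(l t)`. -/
def scaleJet {d n : ℕ} (l : ℝ) (a : Fin d × Fin (n + 1) → ℝ) : Fin d × Fin (n + 1) → ℝ :=
  fun p => l ^ (p.2 : ℕ) * a p

lemma evalJet_scaleJet {d n : ℕ} (f : MvPolynomial (Fin d) ℝ) (l : ℝ)
    (a : Fin d × Fin (n + 1) → ℝ) :
    evalJet f (scaleJet l a) = (evalJet f a).comp (Polynomial.C l * Polynomial.X) := by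
  rw [evalJet, evalJet, MvPolynomial.aeval_def, MvPolynomial.aeval_def,
    ← Polynomial.coe_compRingHom_apply, MvPolynomial.eval₂_comp_left]
  congr 1
  · ext r
    simp
  · funext i
    simp only [jetArc, scaleJet, Function.comp, map_sum, Polynomial.coe_compRingHom_apply,
      Polynomial.mul_comp, Polynomial.C_comp, Polynomial.pow_comp, Polynomial.X_comp]
    refine Finset.sum_congr rfl fun j _ => ?_
    rw [Polynomial.C_mul, Polynomial.C_pow, mul_pow]
    ring

/-- `𝔛ₙ(f)`: the arcs `γ ∈ 𝓛ₙ(ℝ^d)` with `γ(0) = 0` and `f(γ(t)) ≡ c t^n mod t^{n+1}`, `c ≠ 0`. -/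
def jetSet {d : ℕ} (f : MvPolynomial (Fin d) ℝ) (n : ℕ) : Set (Fin d × Fin (n + 1) → ℝ) :=
  {a | (∀ i, a (i, 0) = 0) ∧ (∀ j < n, (evalJet f a).coeff j = 0) ∧ (evalJet f a).coeff n ≠ 0}

lemma isAS_jetSet {d : ℕ} (f : MvPolynomial (Fin d) ℝ) (n : ℕ) : IsAS (jetSet f n) := by
  have h := (isAS_forall_eval_eq
      (fun i : Fin d => (MvPolynomial.X (i, 0) : MvPolynomial (Fin d × Fin (n + 1)) ℝ))
      fun _ => 0).inter
    ((isAS_forall_eval_eq (fun j : Fin n => jetCoeff n f j) fun _ => 0).inter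
      (isAS_ne_zero (jetCoeff n f n)))
  convert h using 1
  ext a
  simp only [jetSet, Set.mem_ofPred_eq, Set.mem_inter_iff, MvPolynomial.eval_X, map_zero,
    eval_jetCoeff]
  refine and_congr_right fun _ => and_congr_left fun _ => ?_
  exact ⟨fun h j => h j j.2, fun h j hj => h ⟨j, hj⟩⟩

/-- `𝔛ₙ(f)` as an object of `Var_mon^n`: the morphism to `ℝ^*` is the angular component
`γ ↦ c` of `f(γ(t))` and the action is `(l • γ)(t) = γ(l t)`. -/
noncomputable def jets {d : ℕ} (f : MvPolynomial (Fin d) ℝ) (n : ℕ) : MonVar n where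
  T := jetSet f n
  ι := Fin d × Fin (n + 1)
  emb := Subtype.val
  inj := Subtype.val_injective
  isAS := by
    rw [Subtype.range_val]
    exact isAS_jetSet f n
  act l a := ⟨scaleJet l a.1, by
    obtain ⟨a, h0, h1, h2⟩ := a
    refine ⟨fun i => by simp [scaleJet, h0 i], fun j hj => ?_, ?_⟩
    · rw [evalJet_scaleJet, Polynomial.comp_C_mul_X_coeff, h1 j hj, zero_mul]
    · rw [evalJet_scaleJet, Polynomial.comp_C_mul_X_coeff]
      exact mul_ne_zero h2 (pow_ne_zero _ l.ne_zero)⟩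
  one_act a := Subtype.ext (funext fun p => by simp [scaleJet])
  mul_act l l' a := Subtype.ext (funext fun p => by simp [scaleJet, mul_pow, mul_assoc])
  act_isMap := by
    refine ASSet.isMap_of_poly (fun p => MvPolynomial.X (Sum.inl ()) ^ (p.2 : ℕ) *
      MvPolynomial.X (Sum.inr p)) fun x p => ?_
    simp only [map_mul, map_pow, MvPolynomial.eval_X]
    rfl
  φ a := Units.mk0 ((evalJet f a.1).coeff n) a.2.2.2
  φ_isMap := by
    refine ASSet.isMap_of_poly (fun _ => jetCoeff n f n) fun x _ => ?_
    rw [eval_jetCoeff]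
    rfl
  φ_act l a := by
    refine Units.ext ?_
    simp only [Units.val_mk0, Units.val_mul, Units.val_pow_eq_pow_val]
    rw [evalJet_scaleJet, Polynomial.comp_C_mul_X_coeff, mul_comm]

/-- The motivic local zeta function `Z_f(T) = ∑_{n ≥ 1} [𝔛ₙ(f)] 𝕃^{-nd} T^n`. -/
noncomputable def zeta {d : ℕ} (f : MvPolynomial (Fin d) ℝ) : PowerSeries M :=
  PowerSeries.mk fun n => if h : 0 < n then
    algebraMap K0 M (K0.cls h (jets f n)) * ((M.L ^ (-(n * d : ℤ)) : Mˣ) : M) else 0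

/-! ### Newton polyhedra -/

/-- The Newton polyhedron: the convex hull of the union of the `ν + (ℝ_{≥0})^d`, for `ν` in the
support of `f`. -/
def newtonPolyhedron {d : ℕ} (f : MvPolynomial (Fin d) ℝ) : Set (Fin d → ℝ) :=
  convexHull ℝ {x | ∃ ν ∈ f.support, ∀ i, (ν i : ℝ) ≤ x i}

/-- The compact faces of the Newton polyhedron (a face is a non-empty subset on which some linear
form attains its maximum over the polyhedron; the zero form gives the polyhedron itself). -/
def CompactFace {d : ℕ} (f : MvPolynomial (Fin d) ℝ) : Type :=
  {τ : Set (Fin d → ℝ) // τ.Nonempty ∧ IsExposed ℝ (newtonPolyhedron f) τ ∧ IsCompact τ}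

open Classical in
/-- `f_τ`, the sum of the monomials of `f` with exponent in `τ`. -/
noncomputable def facePoly {d : ℕ} (f : MvPolynomial (Fin d) ℝ) (τ : Set (Fin d → ℝ)) :
    MvPolynomial (Fin d) ℝ :=
  ∑ ν ∈ f.support with (fun i => (ν i : ℝ)) ∈ τ, MvPolynomial.monomial ν (f.coeff ν)

/-- `f` is non-degenerate: for every compact face `τ`, the polynomials `f_τ` and `∂f_τ/∂x_i` have
no common zero in `(ℝ^*)^d`. -/
def NonDegenerate {d : ℕ} (f : MvPolynomial (Fin d) ℝ) : Prop :=
  ∀ τ : CompactFace f, ¬ ∃ x : Fin d → ℝ, (∀ i, x i ≠ 0) ∧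
    MvPolynomial.eval x (facePoly f τ.1) = 0 ∧
    ∀ i, MvPolynomial.eval x (MvPolynomial.pderiv i (facePoly f τ.1)) = 0

/-- The supporting function `m(k) = inf_{x ∈ Γ_f} k · x`. -/
noncomputable def suppFun {d : ℕ} (f : MvPolynomial (Fin d) ℝ) (k : Fin d → ℝ) : ℝ :=
  sInf ((fun x : Fin d → ℝ => ∑ i, k i * x i) '' newtonPolyhedron f)

/-- The trace `τ(k) = {x ∈ Γ_f | k · x = m(k)}`. -/
def trace {d : ℕ} (f : MvPolynomial (Fin d) ℝ) (k : Fin d → ℝ) : Set (Fin d → ℝ) :=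
  {x ∈ newtonPolyhedron f | ∑ i, k i * x i = suppFun f k}

/-- The cone `σ(τ) = {k ∈ (ℝ_{≥0})^d | τ(k) = τ}`. -/
def cone {d : ℕ} (f : MvPolynomial (Fin d) ℝ) (τ : Set (Fin d → ℝ)) : Set (Fin d → ℝ) :=
  {k | (∀ i, 0 ≤ k i) ∧ trace f k = τ}

/-- `σ(τ) ∩ ℕ^d`. -/
def latticeCone {d : ℕ} (f : MvPolynomial (Fin d) ℝ) (τ : Set (Fin d → ℝ)) : Set (Fin d → ℕ) :=
  {k | (fun i => (k i : ℝ)) ∈ cone f τ}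

/-- The value `m(k)` for `k ∈ ℕ^d`, as a natural number (it is attained at an exponent of `f`). -/
noncomputable def suppNat {d : ℕ} (f : MvPolynomial (Fin d) ℝ) (k : Fin d → ℕ) : ℕ :=
  ⌊suppFun f fun i => (k i : ℝ)⌋₊

lemma suppFun_eq {d : ℕ} {f : MvPolynomial (Fin d) ℝ} (hf : f ≠ 0) (k : Fin d → ℕ) :
    ∃ ν ∈ f.support, suppFun f (fun i => (k i : ℝ)) = ((∑ i, k i * ν i : ℕ) : ℝ) := by
  have hne : f.support.Nonempty := by
    rw [Finset.nonempty_iff_ne_empty]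
    simpa using hf
  obtain ⟨ν, hν, hmin⟩ := f.support.exists_min_image (fun ν => ∑ i, k i * ν i) hne
  refine ⟨ν, hν, le_antisymm ?_ ?_⟩
  all_goals
    have hlb : ∀ x ∈ newtonPolyhedron f, ((∑ i, k i * ν i : ℕ) : ℝ) ≤ ∑ i, (k i : ℝ) * x i := by
      intro x hx
      have hsub : newtonPolyhedron f ⊆
          {x | ((∑ i, k i * ν i : ℕ) : ℝ) ≤ ∑ i, (k i : ℝ) * x i} := by
        refine convexHull_min ?_ ?_
        · rintro x ⟨μ, hμ, hx⟩
          have h1 : ((∑ i, k i * ν i : ℕ) : ℝ) ≤ ((∑ i, k i * μ i : ℕ) : ℝ) := by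
            exact_mod_cast hmin μ hμ
          refine h1.trans ?_
          push_cast
          exact Finset.sum_le_sum fun i _ => mul_le_mul_of_nonneg_left (hx i) (Nat.cast_nonneg _)
        · refine convex_halfSpace_ge (f := fun x : Fin d → ℝ => ∑ i, (k i : ℝ) * x i) ⟨?_, ?_⟩ _
          · intro x y; simp [mul_add, Finset.sum_add_distrib]
          · intro c x; simp [Finset.mul_sum, mul_left_comm]
      exact hsub hx
  · refine csInf_le ⟨((∑ i, k i * ν i : ℕ) : ℝ), ?_⟩ ⟨fun i => (ν i : ℝ), ?_, by push_cast; rfl⟩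
    · rintro _ ⟨x, hx, rfl⟩
      exact hlb x hx
    · exact subset_convexHull ℝ _ ⟨ν, hν, fun _ => le_rfl⟩
  · refine le_csInf ⟨_, fun i => (ν i : ℝ),
      subset_convexHull ℝ _ ⟨ν, hν, fun _ => le_rfl⟩, rfl⟩ ?_
    rintro _ ⟨x, hx, rfl⟩
    exact hlb x hx

lemma suppNat_cast {d : ℕ} {f : MvPolynomial (Fin d) ℝ} (hf : f ≠ 0) (k : Fin d → ℕ) :
    (suppNat f k : ℝ) = suppFun f fun i => (k i : ℝ) := by
  obtain ⟨ν, -, h⟩ := suppFun_eq hf k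
  rw [suppNat, h, Nat.floor_natCast]

lemma facePoly_homogeneous {d : ℕ} {f : MvPolynomial (Fin d) ℝ} {τ : Set (Fin d → ℝ)}
    {k : Fin d → ℕ} (hk : k ∈ latticeCone f τ) :
    MvPolynomial.IsWeightedHomogeneous k (facePoly f τ) (suppNat f k) := by
  classical
  refine MvPolynomial.IsWeightedHomogeneous.sum _ _ _ fun ν hν => ?_
  obtain ⟨hν, hτ⟩ := Finset.mem_filter.1 hν
  have hf : f ≠ 0 := by
    rintro rfl
    simp at hν
  refine MvPolynomial.isWeightedHomogeneous_monomial _ _ _ ?_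
  rw [← hk.2] at hτ
  have h2 := hτ.2
  rw [← suppNat_cast hf] at h2
  have h3 : ∑ i, k i * ν i = suppNat f k := by
    have h2 : ∑ i, (k i : ℝ) * (ν i : ℝ) = suppNat f k := h2.symm ▸ rfl
    exact_mod_cast h2
  rw [← h3, Finsupp.weight_apply, Finsupp.sum_fintype _ _ (by simp)]
  exact Finset.sum_congr rfl fun i _ => by rw [smul_eq_mul, mul_comm]

lemma eval_weighted {d : ℕ} {g : MvPolynomial (Fin d) ℝ} {k : Fin d → ℕ} {n : ℕ}
    (h : MvPolynomial.IsWeightedHomogeneous k g n) (l : ℝ) (x : Fin d → ℝ) :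
    MvPolynomial.eval (fun i => l ^ k i * x i) g = l ^ n * MvPolynomial.eval x g := by
  rw [MvPolynomial.eval_eq', MvPolynomial.eval_eq', Finset.mul_sum]
  refine Finset.sum_congr rfl fun ν hν => ?_
  have hw := h (MvPolynomial.mem_support_iff.1 hν)
  rw [Finsupp.weight_apply, Finsupp.sum_fintype _ _ (by simp)] at hw
  simp only [smul_eq_mul] at hw
  rw [← hw]
  simp only [mul_pow, Finset.prod_mul_distrib, ← pow_mul, Finset.prod_pow_eq_pow_sum]
  simp only [mul_comm (k _)]
  ring

lemma isAS_torus (d : ℕ) : IsAS {x : Fin d → ℝ | ∀ i, x i ≠ 0} := by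
  convert isAS_ne_zero (∏ i, MvPolynomial.X i : MvPolynomial (Fin d) ℝ) using 1
  ext x
  simp [Finset.prod_eq_zero_iff]

/-- For `g` weighted homogeneous of weights `k` and degree `n`: the object `(ℝ^*)^d ∖ g⁻¹(0)` of
`Var_mon^n`, with morphism `g` and action `l • x = (l ^ k_i * x_i)_i`. -/
noncomputable def torusCompl {d : ℕ} (g : MvPolynomial (Fin d) ℝ) (k : Fin d → ℕ) (n : ℕ)
    (h : MvPolynomial.IsWeightedHomogeneous k g n) : MonVar n where
  T := {x : Fin d → ℝ // (∀ i, x i ≠ 0) ∧ MvPolynomial.eval x g ≠ 0}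
  ι := Fin d
  emb := Subtype.val
  inj := Subtype.val_injective
  isAS := by
    convert (isAS_torus d).inter (isAS_ne_zero g) using 1
    exact Subtype.range_val
  act l x := ⟨fun i => (l : ℝ) ^ k i * x.1 i,
    fun i => mul_ne_zero (pow_ne_zero _ l.ne_zero) (x.2.1 i), by
      rw [eval_weighted h]
      exact mul_ne_zero (pow_ne_zero _ l.ne_zero) x.2.2⟩
  one_act x := Subtype.ext (funext fun i => by simp)
  mul_act l l' x := Subtype.ext (funext fun i => by simp [mul_pow, mul_assoc])
  act_isMap := by
    refine ASSet.isMap_of_poly (fun i => MvPolynomial.X (Sum.inl ()) ^ (k i) *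
      MvPolynomial.X (Sum.inr i)) fun x p => ?_
    simp only [map_mul, map_pow, MvPolynomial.eval_X]
    rfl
  φ x := Units.mk0 (MvPolynomial.eval x.1 g) x.2.2
  φ_isMap := ASSet.isMap_of_poly (fun _ => g) fun _ _ => rfl
  φ_act l x := Units.ext (by simpa using eval_weighted h l x.1)

/-- The `AS`-set `g⁻¹(0) ∩ (ℝ^*)^d`. -/
def torusZero {d : ℕ} (g : MvPolynomial (Fin d) ℝ) : ASSet where
  T := {x : Fin d → ℝ // (∀ i, x i ≠ 0) ∧ MvPolynomial.eval x g = 0}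
  ι := Fin d
  emb := Subtype.val
  inj := Subtype.val_injective
  isAS := by
    convert (isAS_torus d).inter (isAS_eq_zero g) using 1
    exact Subtype.range_val

/-- The rational fraction `𝕃⁻¹T / (1 - 𝕃⁻¹T)`, as a power series. -/
noncomputable def geomFrac : PowerSeries MHat :=
  PowerSeries.C (M.toHat (M.L⁻¹ : Mˣ)) * PowerSeries.X *
    PowerSeries.invOfUnit (1 - PowerSeries.C (M.toHat (M.L⁻¹ : Mˣ)) * PowerSeries.X) 1

lemma geomFrac_mul : geomFrac * (1 - PowerSeries.C (M.toHat (M.L⁻¹ : Mˣ)) * PowerSeries.X) =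
    PowerSeries.C (M.toHat (M.L⁻¹ : Mˣ)) * PowerSeries.X := by
  rw [geomFrac, mul_assoc, mul_comm (PowerSeries.invOfUnit _ _), PowerSeries.mul_invOfUnit,
    mul_one]
  simp

/-- The monomial `𝕃^{-∑ k_i} T^{m(k)}`. -/
noncomputable def coneTerm {d : ℕ} (f : MvPolynomial (Fin d) ℝ) (k : Fin d → ℕ) :
    PowerSeries MHat :=
  PowerSeries.monomial (suppNat f k) (M.toHat (M.L ^ (-(∑ i, k i : ℤ)) : Mˣ))

end ArcSym

open ArcSym
open scoped PowerSeries.WithPiTopology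

/-! Both sides are compared one coefficient at a time, by sorting arcs according to the orders of
their components. Fix `n ≥ 1` and `N ≥ n`. The coefficients of `f(γ)` up to order `n` only see `γ`
modulo `t^{n+1}`, so the jets of order `N` satisfying the condition of `𝔛ₙ(f)` have class `[𝔛ₙ(f)]
𝕃^{d(N-n)}` (`dcls_jetSetN`). They are stratified by `k = (ord γ_i)`. No entry of `k` is `0`,
because `γ(0) = 0`. The jets with a component that vanishes modulo `t^{N+1}` have dimension at most
`dN - N`; after multiplication by `𝕃^{-dN}` they lie in `F^N` and disappear as `N → ∞`.

For the other `k`, all entries are positive, so `τ = τ(k)` is a compact face. Writing `γ = t^k y`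
gives `f(γ) = t^{m(k)} (f_τ(y(0)) + O(t))`. If `m(k) > n` the stratum is empty. If `m(k) = n` it is
the product of the complement of `f_τ = 0` in the torus and the affine space of the non-leading
coefficients (`dcls_jetStratum_of_eq`). If `m(k) < n` the leading coefficients lie on `f_τ = 0`, and
by non-degeneracy some `∂f_τ/∂x_i` is non-zero there. The coefficients of `f(γ)` of orders `m(k)+1,
..., n` are then a triangular system in as many coefficients of `γ_i`, so the stratum is `f_τ⁻¹(0) ×
ℝ^*` times an affine space with `n - m(k)` fewer dimensions (`dcls_jetStratum_of_lt`). The powers of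
`𝕃` are those of the bracket multiplied by `𝕃^{-∑ k_i} T^{m(k)}` (`toM_jetStratum`).

The `ℝ^*`-actions obtained in this way are diagonal, with weights depending on `k`, and must be
shown not to matter. If `S` lies in a torus and `S`, `φ` are invariant under a one-parameter
subgroup with primitive weight `w`, choose `v` with `w · v = 1`; then `S` is the product of the
slice `x^v = 1` and `ℝ^*`. By the independence of liftings the weight on the factor `ℝ^*` is
irrelevant, so a multiple of `w` may be added to the weights of `S` (`dcls_twist`). This gives the
independence of `[(ℝ^*)^d ∖ f_τ⁻¹(0)]` from `k`, and makes the action on `f_τ⁻¹(0)` trivial.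

Finally the completion is non-archimedean and `𝕃^{-∑ k_i} → 0`, so the sums over the cones converge,
and may be computed along the boxes `[1, N]^d`. Compact faces are finite in number because each is
the convex hull of the exponents of `f` that it contains (`CompactFace.eq_convexHull`). -/

namespace ArcSym

open Filter Topology

/-! ### Diagonal actions -/

/-- The diagonal action of `l` with integral weights `e`. -/
noncomputable def dact {ι : Type} (e : ι → ℤ) (l : ℝˣ) (x : ι → ℝ) : ι → ℝ :=
  fun i => ((l ^ e i : ℝˣ) : ℝ) * x i

lemma dact_one {ι : Type} (e : ι → ℤ) (x : ι → ℝ) : dact e 1 x = x := by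
  funext i; simp [dact]

lemma dact_mul {ι : Type} (e : ι → ℤ) (l l' : ℝˣ) (x : ι → ℝ) :
    dact e (l * l') x = dact e l (dact e l' x) := by
  funext i; simp [dact, mul_zpow, mul_assoc]

lemma dact_add {ι : Type} (e e' : ι → ℤ) (l : ℝˣ) (x : ι → ℝ) :
    dact (e + e') l x = dact e l (dact e' l x) := by
  funext i
  simp only [dact, Pi.add_apply, zpow_add, Units.val_mul, mul_assoc]

lemma dact_smul {ι : Type} (c : ℤ) (e : ι → ℤ) (l : ℝˣ) (x : ι → ℝ) :
    dact (c • e) l x = dact e (l ^ c) x := by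
  funext i
  simp only [dact, Pi.smul_apply, smul_eq_mul, zpow_mul]

lemma units_zpow_mul_pow_toNat (l : ℝˣ) (a : ℤ) :
    ((l ^ a : ℝˣ) : ℝ) * (l : ℝ) ^ (-a).toNat = (l : ℝ) ^ a.toNat := by
  have h : l ^ a * l ^ (-a).toNat = l ^ a.toNat := by
    rw [← zpow_natCast l a.toNat, ← zpow_natCast l (-a).toNat, ← zpow_add]
    congr 1
    omega
  simpa using congrArg Units.val h

/-- A map given by fractions of polynomials whose denominators do not vanish. -/
def IsFracOn {ι κ : Type} (S : Set (ι → ℝ)) (g : (ι → ℝ) → κ → ℝ) : Prop :=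
  ∀ j, ∃ p q : MvPolynomial ι ℝ, ∀ x ∈ S, MvPolynomial.eval x q ≠ 0 ∧
    g x j * MvPolynomial.eval x q = MvPolynomial.eval x p

lemma IsPolyMap.isFracOn {ι κ : Type} {g : (ι → ℝ) → κ → ℝ} (h : IsPolyMap g)
    (S : Set (ι → ℝ)) : IsFracOn S g := fun j => by
  obtain ⟨p, hp⟩ := h j
  exact ⟨p, 1, fun x _ => by simp [hp]⟩

namespace ASSet

/-- Clearing denominators, the graph is cut out over `X` by the polynomial equations `p_j(x) = y_j
q_j(x)`. Fractions cannot be avoided: the weights of the actions below may be negative. -/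
lemma isMap_of_frac {X Y : ASSet} {f : X.T → Y.T} (p q : Y.ι → MvPolynomial X.ι ℝ)
    (hq : ∀ x j, MvPolynomial.eval (X.emb x) (q j) ≠ 0)
    (h : ∀ x j, Y.emb (f x) j * MvPolynomial.eval (X.emb x) (q j) =
      MvPolynomial.eval (X.emb x) (p j)) : IsMap X Y f := by
  have hA := (X.isAS.comap (Sum.inl : X.ι → X.ι ⊕ Y.ι)).inter
    (isAS_forall_eval_eq (fun j => MvPolynomial.rename Sum.inl (p j))
      (fun j => (MvPolynomial.X (Sum.inr j) * MvPolynomial.rename Sum.inl (q j) :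
        MvPolynomial (X.ι ⊕ Y.ι) ℝ)))
  refine isMap_of_graph_eq hA (Set.ext fun z => ⟨fun hz => ?_, ?_⟩)
  · obtain ⟨x, h1, h2⟩ := mem_graph.1 hz
    refine ⟨⟨x, h1.symm⟩, fun j => ?_⟩
    rw [map_mul, MvPolynomial.eval_rename, MvPolynomial.eval_rename, MvPolynomial.eval_X, h1, ← h]
    exact congrArg (· * _) (congrFun h2 j).symm
  · rintro ⟨⟨x, h1⟩, h2⟩
    refine mem_graph.2 ⟨x, h1.symm, funext fun j => ?_⟩
    have := h2 j
    rw [map_mul, MvPolynomial.eval_rename, MvPolynomial.eval_rename, MvPolynomial.eval_X, ← h1,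
      ← h] at this
    exact (mul_right_cancel₀ (hq x j) this).symm

/-- An `AS`-subset of an affine space. -/
abbrev ofSet {ι : Type} [Finite ι] (S : Set (ι → ℝ)) (hS : IsAS S) : ASSet where
  T := S
  ι := ι
  emb := Subtype.val
  inj := Subtype.val_injective
  isAS := by rwa [Subtype.range_val]

lemma isMap_of_isFracOn {ι : Type} [Finite ι] {S : Set (ι → ℝ)} {hS : IsAS S} {Y : ASSet}
    {g : (ι → ℝ) → Y.ι → ℝ} (hg : IsFracOn S g) {f : S → Y.T}
    (h : ∀ x, Y.emb (f x) = g x.1) : IsMap (ofSet S hS) Y f := by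
  choose p q hpq using hg
  exact isMap_of_frac p q (fun x j => (hpq j x.1 x.2).1) fun x j => by
    rw [h]; exact (hpq j x.1 x.2).2

end ASSet

/-! ### Objects with a diagonal action and their classes -/

/-- The data of an object of `Var_mon^n`: an `AS`-subset of an affine space, a diagonal action and
a polynomial without zeros. -/
structure DiagValid {ι : Type} (n : ℕ) (S : Set (ι → ℝ)) (e : ι → ℤ) (P : MvPolynomial ι ℝ) :
    Prop where
  isAS : IsAS S
  ne_zero : ∀ x ∈ S, MvPolynomial.eval x P ≠ 0
  inv : ∀ l, ∀ x ∈ S, dact e l x ∈ S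
  hom : ∀ l : ℝˣ, ∀ x ∈ S, MvPolynomial.eval (dact e l x) P = (l : ℝ) ^ n * MvPolynomial.eval x P

/-- The object of `Var_mon^n` with a diagonal action. -/
noncomputable def diag {ι : Type} [Finite ι] {n : ℕ} {S : Set (ι → ℝ)} {e : ι → ℤ}
    {P : MvPolynomial ι ℝ} (h : DiagValid n S e P) : MonVar n where
  toASSet := ASSet.ofSet S h.isAS
  act l x := ⟨dact e l x.1, h.inv l x.1 x.2⟩
  one_act x := Subtype.ext (dact_one _ _)
  mul_act l l' x := Subtype.ext (dact_mul _ _ _ _)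
  act_isMap := by
    refine ASSet.isMap_of_frac
      (fun i => MvPolynomial.X (Sum.inl ()) ^ (e i).toNat * MvPolynomial.X (Sum.inr i))
      (fun i => MvPolynomial.X (Sum.inl ()) ^ (-e i).toNat) (fun x i => ?_) fun x i => ?_
    · simp only [map_pow, MvPolynomial.eval_X]
      exact pow_ne_zero _ x.1.ne_zero
    · simp only [map_mul, map_pow, MvPolynomial.eval_X]
      show ((x.1 ^ e i : ℝˣ) : ℝ) * x.2.1 i * (x.1 : ℝ) ^ (-e i).toNat =
        (x.1 : ℝ) ^ (e i).toNat * x.2.1 i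
      rw [← units_zpow_mul_pow_toNat x.1 (e i)]
      ring
  φ x := Units.mk0 (MvPolynomial.eval x.1 P) (h.ne_zero x.1 x.2)
  φ_isMap := ASSet.isMap_of_poly (fun _ => P) fun _ _ => rfl
  φ_act l x := Units.ext (by simpa using h.hom l x.1 x.2)

open Classical in
/-- The class of an object with diagonal action. -/
noncomputable def dcls {ι : Type} [Finite ι] (n : ℕ) (S : Set (ι → ℝ)) (e : ι → ℤ)
    (P : MvPolynomial ι ℝ) : K0n n :=
  -- The default value makes the class a function of `S`, `e` and `P` alone, so it can be rewritten
  -- along equalities of sets or weights without transporting the proof of validity.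
  if h : DiagValid n S e P then K0n.cls (diag h) else 0

lemma dcls_of_valid {ι : Type} [Finite ι] {n : ℕ} {S : Set (ι → ℝ)} {e : ι → ℤ}
    {P : MvPolynomial ι ℝ} (h : DiagValid n S e P) : dcls n S e P = K0n.cls (diag h) :=
  dif_pos h

/-- A diagonal object is isomorphic to an object to which it maps bijectively and equivariantly by
a fractional map. -/
lemma cls_eq_dcls {ι : Type} [Finite ι] {n : ℕ} {S : Set (ι → ℝ)} {e : ι → ℤ}
    {P : MvPolynomial ι ℝ} (h : DiagValid n S e P) (Y : MonVar n) (g : (ι → ℝ) → Y.ι → ℝ)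
    (hg : IsFracOn S g) (F : S → Y.T) (hF : Function.Bijective F)
    (hFg : ∀ x : S, Y.emb (F x) = g x.1)
    (hact : ∀ l (x : S), F ⟨dact e l x.1, h.inv l x.1 x.2⟩ = Y.act l (F x))
    (hφ : ∀ x : S, (Y.φ (F x) : ℝ) = MvPolynomial.eval x.1 P) :
    K0n.cls Y = dcls n S e P := by
  rw [dcls_of_valid h]
  symm
  exact K0n.cls_iso ⟨Equiv.ofBijective F hF, ASSet.isMap_of_isFracOn (hS := h.isAS) hg hFg, hact,
    fun x => Units.ext (hφ x)⟩

lemma dcls_bij {ι κ : Type} [Finite ι] [Finite κ] {n : ℕ} {S : Set (ι → ℝ)} {e : ι → ℤ}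
    {P : MvPolynomial ι ℝ} {S' : Set (κ → ℝ)} {e' : κ → ℤ} {P' : MvPolynomial κ ℝ}
    (h : DiagValid n S e P) (h' : DiagValid n S' e' P') (g : (ι → ℝ) → κ → ℝ) (hg : IsFracOn S g)
    (hb : Set.BijOn g S S') (hact : ∀ l, ∀ x ∈ S, g (dact e l x) = dact e' l (g x))
    (hP : ∀ x ∈ S, MvPolynomial.eval (g x) P' = MvPolynomial.eval x P) :
    dcls n S e P = dcls n S' e' P' := by
  rw [dcls_of_valid h']
  symm
  refine cls_eq_dcls h (diag h') g hg (fun x => ⟨g x.1, hb.mapsTo x.2⟩) ⟨?_, ?_⟩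
    (fun _ => rfl) (fun l x => Subtype.ext (hact l x.1 x.2)) fun x => hP x.1 x.2
  · intro x y hxy
    exact Subtype.ext (hb.injOn x.2 y.2 (congrArg Subtype.val hxy))
  · rintro ⟨y, hy⟩
    obtain ⟨x, hx, rfl⟩ := hb.surjOn hy
    exact ⟨⟨x, hx⟩, rfl⟩

lemma DiagValid.sub {ι : Type} {n : ℕ} {S : Set (ι → ℝ)} {e : ι → ℤ} {P : MvPolynomial ι ℝ}
    (h : DiagValid n S e P) {S' : Set (ι → ℝ)} (hS : S' ⊆ S) (hA : IsAS S')
    (hinv : ∀ l, ∀ x ∈ S', dact e l x ∈ S') : DiagValid n S' e P :=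
  ⟨hA, fun x hx => h.ne_zero x (hS hx), hinv, fun l x hx => h.hom l x (hS hx)⟩

lemma dact_inv_cancel {ι : Type} (e : ι → ℤ) (l : ℝˣ) (x : ι → ℝ) :
    dact e l⁻¹ (dact e l x) = x := by
  rw [← dact_mul, inv_mul_cancel, dact_one]

lemma dcls_closed {ι : Type} [Finite ι] {n : ℕ} {S : Set (ι → ℝ)} {e : ι → ℤ}
    {P : MvPolynomial ι ℝ} (h : DiagValid n S e P) {C : Set (ι → ℝ)} (hC : IsClosed C)
    (hA : IsAS C) (hinv : ∀ l, ∀ x ∈ S, x ∈ C → dact e l x ∈ C) :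
    dcls n S e P = dcls n (S \ C) e P + dcls n (S ∩ C) e P := by
  have h1 : DiagValid n (S ∩ C) e P := h.sub Set.inter_subset_left (h.isAS.inter hA)
    fun l x hx => ⟨h.inv l x hx.1, hinv l x hx.1 hx.2⟩
  -- Invariance of the complement follows by applying the action of `l⁻¹`.
  have h2 : DiagValid n (S \ C) e P := h.sub Set.sdiff_subset (h.isAS.inter hA.compl)
    fun l x hx => ⟨h.inv l x hx.1, fun hc => hx.2 (by
      have := hinv l⁻¹ _ (h.inv l x hx.1) hc
      rwa [dact_inv_cancel] at this)⟩
  have hS : IsAS ((diag h).emb '' {x : S | x.1 ∈ C}) := by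
    have : ((Subtype.val : S → ι → ℝ) '' {x : S | x.1 ∈ C}) = S ∩ C := by
      ext x
      constructor
      · rintro ⟨y, hy, rfl⟩
        exact ⟨y.2, hy⟩
      · rintro ⟨hx, hc⟩
        exact ⟨⟨x, hx⟩, hc, rfl⟩
    show IsAS ((Subtype.val : S → ι → ℝ) '' {x : S | x.1 ∈ C})
    rw [this]
    exact h.isAS.inter hA
  rw [dcls_of_valid h, K0n.cls_closed (diag h) {x : S | x.1 ∈ C} hS ⟨C, hC, rfl⟩
    fun l x hx => hinv l x.1 x.2 hx]
  congr 1
  · refine cls_eq_dcls h2 _ id (IsPolyMap.isFracOn (fun j => ⟨MvPolynomial.X j, by simp⟩) _)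
      (fun x => ⟨⟨x.1, x.2.1⟩, x.2.2⟩) ⟨?_, ?_⟩ (fun _ => rfl) (fun _ _ => rfl) fun _ => rfl
    · intro x y hxy
      exact Subtype.ext (congrArg (fun z => z.1.1) hxy)
    · rintro ⟨⟨x, hx⟩, hc⟩
      exact ⟨⟨x, hx, hc⟩, rfl⟩
  · refine cls_eq_dcls h1 _ id (IsPolyMap.isFracOn (fun j => ⟨MvPolynomial.X j, by simp⟩) _)
      (fun x => ⟨⟨x.1, x.2.1⟩, x.2.2⟩) ⟨?_, ?_⟩ (fun _ => rfl) (fun _ _ => rfl) fun _ => rfl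
    · intro x y hxy
      exact Subtype.ext (congrArg (fun z => z.1.1) hxy)
    · rintro ⟨⟨x, hx⟩, hc⟩
      exact ⟨⟨x, hx, hc⟩, rfl⟩

/-! ### Additivity over stratifications -/

lemma isAS_empty {ι : Type} [Finite ι] : IsAS (∅ : Set (ι → ℝ)) := by
  simpa using (isAS_univ (ι := ι)).compl

lemma IsAS.union {ι : Type} [Finite ι] {A B : Set (ι → ℝ)} (h : IsAS A) (h' : IsAS B) :
    IsAS (A ∪ B) := by
  have := (h.compl.inter h'.compl).compl
  rwa [Set.compl_inter, compl_compl, compl_compl] at this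

/-- Cutting the empty set along itself gives `[∅] = [∅] + [∅]`. -/
lemma dcls_empty {ι : Type} [Finite ι] (n : ℕ) (e : ι → ℤ) (P : MvPolynomial ι ℝ) :
    dcls n ∅ e P = 0 := by
  have h : DiagValid n ∅ e P := ⟨isAS_empty, by simp, by simp, by simp⟩
  have := dcls_closed h isClosed_empty isAS_empty (by simp)
  simpa using this

/-- Additivity for a stratification indexed by a finite partial order. -/
lemma dcls_strata {ι P : Type} [Finite ι] [Fintype P] [PartialOrder P] {n : ℕ}
    {S : Set (ι → ℝ)} {e : ι → ℤ} {p : MvPolynomial ι ℝ} (h : DiagValid n S e p)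
    (ord : (ι → ℝ) → P) (C : P → Set (ι → ℝ)) (hC : ∀ a, IsClosed (C a)) (hA : ∀ a, IsAS (C a))
    (hord : ∀ a x, a ≤ ord x ↔ x ∈ C a) (hinv : ∀ l x, ord (dact e l x) = ord x) :
    dcls n S e p = ∑ a, dcls n (S ∩ ord ⁻¹' {a}) e p := by
  classical
  -- Upper sets of `P` have closed preimages. Removing a minimal element `a` from an upper set
  -- leaves an upper set, and the stratum `ord = a` is the complement of its closed preimage.
  have key : ∀ (N : ℕ) (U : Finset P), U.card = N → IsUpperSet (U : Set P) →
      DiagValid n (S ∩ ord ⁻¹' U) e p ∧ IsClosed (ord ⁻¹' (U : Set P)) ∧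
        IsAS (ord ⁻¹' (U : Set P)) ∧
        dcls n (S ∩ ord ⁻¹' U) e p = ∑ a ∈ U, dcls n (S ∩ ord ⁻¹' {a}) e p := by
    intro N
    induction N with
    | zero =>
      intro U hU _
      rw [Finset.card_eq_zero] at hU
      subst hU
      simp only [Finset.coe_empty, Set.preimage_empty, Set.inter_empty, Finset.sum_empty]
      exact ⟨⟨isAS_empty, by simp, by simp, by simp⟩, isClosed_empty, isAS_empty,
        dcls_empty _ _ _⟩
    | succ N ih =>
      intro U hU hup
      have hne : U.Nonempty := Finset.card_pos.1 (by omega)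
      obtain ⟨a, haU, hmin⟩ := U.exists_minimal hne
      obtain ⟨h1, h2, h3, h4⟩ := ih (U.erase a) (by rw [Finset.card_erase_of_mem haU, hU]; rfl)
        (by
          intro b c hbc hb
          rw [Finset.coe_erase] at hb ⊢
          refine ⟨hup hbc hb.1, fun hc => hb.2 ?_⟩
          have hc : c = a := hc
          subst hc
          exact le_antisymm hbc (hmin hb.1 hbc))
      -- Since `U` is an upper set, `a ≤ ord x` already implies `ord x ∈ U`; so the preimage of `U`
      -- is a finite union of sets `C b`, hence closed and `AS`.
      have hUeq : ord ⁻¹' (U : Set P) = C a ∪ ord ⁻¹' ((U.erase a : Finset P) : Set P) := by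
        ext x
        simp only [Set.mem_preimage, Set.mem_union, Finset.mem_coe, Finset.mem_erase, ← hord]
        constructor
        · intro hx
          by_cases hxa : ord x = a
          · exact Or.inl hxa.ge
          · exact Or.inr ⟨hxa, hx⟩
        · rintro (hx | hx)
          · exact hup hx haU
          · exact hx.2
      have h3' : IsAS (ord ⁻¹' (U : Set P)) := by
        rw [hUeq]; exact (hA a).union h3
      have hv : DiagValid n (S ∩ ord ⁻¹' U) e p :=
        h.sub Set.inter_subset_left (h.isAS.inter h3') fun l x hx =>
          ⟨h.inv l x hx.1, by rw [Set.mem_preimage, hinv]; exact hx.2⟩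
      refine ⟨hv, ?_, h3', ?_⟩
      · rw [hUeq]; exact (hC a).union h2
      · rw [dcls_closed hv h2 h3 fun l x _ hx => by rw [Set.mem_preimage, hinv]; exact hx,
          ← Finset.add_sum_erase U _ haU, ← h4]
        congr 2
        · ext x
          simp only [Set.mem_sdiff, Set.mem_inter_iff, Set.mem_preimage, Finset.mem_coe,
            Finset.mem_erase, Set.mem_singleton_iff]
          constructor
          · rintro ⟨⟨hx, hxU⟩, hn⟩
            exact ⟨hx, by_contra fun hne => hn ⟨hne, hxU⟩⟩
          · rintro ⟨hx, rfl⟩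
            exact ⟨⟨hx, haU⟩, fun hn => hn.1 rfl⟩
        · ext x
          simp only [Set.mem_inter_iff, Set.mem_preimage, Finset.mem_coe, Finset.mem_erase]
          tauto
  have := (key _ Finset.univ rfl (by simpa using isUpperSet_univ)).2.2.2
  simpa using this

/-! ### Change of level, products with affine spaces -/

lemma theta_dcls {ι : Type} [Finite ι] {m n : ℕ} (hmn : m ∣ n) {S : Set (ι → ℝ)} {e : ι → ℤ}
    {P : MvPolynomial ι ℝ} (h : DiagValid m S e P) :
    DiagValid n S (((n / m : ℕ) : ℤ) • e) P ∧
      K0n.theta hmn (dcls m S e P) = dcls n S (((n / m : ℕ) : ℤ) • e) P := by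
  have hv : DiagValid n S (((n / m : ℕ) : ℤ) • e) P := by
    refine ⟨h.isAS, h.ne_zero, fun l x hx => ?_, fun l x hx => ?_⟩
    · rw [dact_smul]; exact h.inv _ x hx
    · rw [dact_smul, h.hom _ x hx, zpow_natCast, Units.val_pow_eq_pow_val, ← pow_mul,
        Nat.div_mul_cancel hmn]
  refine ⟨hv, ?_⟩
  rw [dcls_of_valid h, K0n.theta_cls]
  refine cls_eq_dcls hv _ id (IsPolyMap.isFracOn (fun j => ⟨MvPolynomial.X j, by simp⟩) _) id
    Function.bijective_id (fun _ => rfl) (fun l x => Subtype.ext ?_) fun _ => rfl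
  show dact (((n / m : ℕ) : ℤ) • e) l x.1 = dact e (l ^ (n / m)) x.1
  rw [dact_smul, zpow_natCast]

lemma K0AS.toK0n_cls (n : ℕ) (A : ASSet) :
    K0AS.toK0n n (K0AS.cls A) = K0n.cls (MonVar.timesGm n A) := by
  rw [K0AS.toK0n, K0AS.cls, RingQuot.lift_mkRingHom_apply, FreeCommRing.lift_of]

/-- `K0AS.toK0` is defined at level `1`. Replacing `l` by `l ^ n` turns the action on `A × ℝ^*` of
level `1` into that of level `n`, so every level gives the same structure morphism. -/
lemma K0AS.of_toK0n {n : ℕ} (hn : 0 < n) (x : K0AS) :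
    K0.of n hn (K0AS.toK0n n x) = K0AS.toK0 x := by
  have key : ((K0n.theta (one_dvd n)).comp (K0AS.toK0n 1)) = K0AS.toK0n n := by
    refine RingQuot.ringQuot_ext _ _ (FreeCommRing.hom_ext fun A => ?_)
    show K0n.theta _ (K0AS.toK0n 1 (K0AS.cls A)) = K0AS.toK0n n (K0AS.cls A)
    rw [K0AS.toK0n_cls, K0AS.toK0n_cls, K0n.theta_cls]
    refine K0n.cls_iso ⟨Equiv.refl _, ASSet.isMap_of_reindex id fun _ => rfl, fun l p => ?_,
      fun _ => rfl⟩
    refine Prod.ext rfl ?_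
    show (l ^ (n / 1)) ^ 1 * (p.2 : ℝˣ) = l ^ n * p.2
    rw [pow_one, Nat.div_one]
  rw [← key, K0AS.toK0, RingHom.comp_apply, RingHom.comp_apply, K0.of_theta one_pos hn]

lemma K0AS.cls_affine (m : ℕ) :
    K0AS.cls (ASSet.affine m) = K0AS.cls (ASSet.affine 1) ^ m := by
  induction m with
  | zero =>
    rw [pow_zero]
    have := RingQuot.mkRingHom_rel K0AS.Rel.one
    rwa [map_one] at this
  | succ m ih =>
    rw [pow_succ, ← ih]
    have h1 := RingQuot.mkRingHom_rel (K0AS.Rel.prod (ASSet.affine m) (ASSet.affine 1))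
    rw [map_mul] at h1
    refine Eq.trans ?_ h1.symm
    refine RingQuot.mkRingHom_rel (K0AS.Rel.iso _ _ ?_)
    refine ⟨(Fin.appendEquiv m 1).symm, ?_⟩
    refine ASSet.isMap_of_reindex finSumFinEquiv fun x => ?_
    funext i
    rcases i with i | i <;> rfl

/-- The class of the affine line in `K₀ⁿ`. -/
noncomputable def affLine (n : ℕ) : K0n n := K0AS.toK0n n (K0AS.cls (ASSet.affine 1))

lemma of_affLine {n : ℕ} (hn : 0 < n) : K0.of n hn (affLine n) = lefschetz :=
  K0AS.of_toK0n hn _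

lemma dact_comp_inl {ι κ : Type} (e : ι → ℤ) (e' : κ → ℤ) (l : ℝˣ) (z : ι ⊕ κ → ℝ) :
    dact (Sum.elim e e') l z ∘ Sum.inl = dact e l (z ∘ Sum.inl) := rfl

lemma DiagValid.lift {ι κ : Type} [Finite ι] [Finite κ] {n : ℕ} {S : Set (ι → ℝ)} {e : ι → ℤ}
    {P : MvPolynomial ι ℝ} (h : DiagValid n S e P) (e' : κ → ℤ) :
    DiagValid n {z : ι ⊕ κ → ℝ | z ∘ Sum.inl ∈ S} (Sum.elim e e')
      (MvPolynomial.rename Sum.inl P) where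
  isAS := h.isAS.comap _
  ne_zero z hz := by rw [MvPolynomial.eval_rename]; exact h.ne_zero _ hz
  inv l z hz := h.inv l _ hz
  hom l z hz := by
    rw [MvPolynomial.eval_rename, MvPolynomial.eval_rename]
    exact h.hom l _ hz

namespace MonVar

/-- The action on `Y × ℝ^m` which is diagonal on `ℝ^m`. -/
noncomputable def prodAct {ι : Type} [Finite ι] {n : ℕ} {S : Set (ι → ℝ)} {e : ι → ℤ}
    {P : MvPolynomial ι ℝ} (h : DiagValid n S e P) {m : ℕ} (w : Fin m → ℤ) :
    MonVar n :=
  (diag h).affineLift m (fun l p => ((diag h).act l p.1, dact w l p.2))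
    (fun p => Prod.ext ((diag h).one_act _) (dact_one _ _))
    (fun l l' p => Prod.ext ((diag h).mul_act _ _ _) (dact_mul _ _ _ _))
    (by
      refine ASSet.isMap_of_frac
        (fun i => MvPolynomial.X (Sum.inl ()) ^ (Sum.elim e w i).toNat *
          MvPolynomial.X (Sum.inr i))
        (fun i => MvPolynomial.X (Sum.inl ()) ^ (-Sum.elim e w i).toNat) (fun x i => ?_)
        fun x i => ?_
      · simp only [map_pow, MvPolynomial.eval_X]
        exact pow_ne_zero _ x.1.ne_zero
      · simp only [map_mul, map_pow, MvPolynomial.eval_X]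
        rcases i with i | i
        · show ((x.1 ^ e i : ℝˣ) : ℝ) * x.2.1.1 i * (x.1 : ℝ) ^ (-e i).toNat =
            (x.1 : ℝ) ^ (e i).toNat * x.2.1.1 i
          rw [← units_zpow_mul_pow_toNat x.1 (e i)]
          ring
        · show ((x.1 ^ w i : ℝˣ) : ℝ) * x.2.2 i * (x.1 : ℝ) ^ (-w i).toNat =
            (x.1 : ℝ) ^ (w i).toNat * x.2.2 i
          rw [← units_zpow_mul_pow_toNat x.1 (w i)]
          ring)
    fun _ _ => rfl

/-- Relation (3) of `K₀ⁿ` enters the argument here: both actions lift the one on `S`. -/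
lemma cls_prodAct_congr {ι : Type} [Finite ι] {n : ℕ} {S : Set (ι → ℝ)} {e : ι → ℤ}
    {P : MvPolynomial ι ℝ} (h : DiagValid n S e P) {m : ℕ} (w w' : Fin m → ℤ) :
    K0n.cls (prodAct h w) = K0n.cls (prodAct h w') :=
  RingQuot.mkRingHom_rel (K0n.Rel.lift (diag h) m _ _ _ _ _ _ _ _ _ _)

lemma cls_prodAct {ι κ : Type} [Finite ι] [Finite κ] {n : ℕ} {S : Set (ι → ℝ)} {e : ι → ℤ}
    {P : MvPolynomial ι ℝ} (h : DiagValid n S e P) {m : ℕ} (b : κ ≃ Fin m) (e' : κ → ℤ) :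
    K0n.cls (prodAct h (e' ∘ b.symm)) = dcls n {z : ι ⊕ κ → ℝ | z ∘ Sum.inl ∈ S} (Sum.elim e e')
      (MvPolynomial.rename Sum.inl P) := by
  have hg : IsPolyMap fun z : ι ⊕ κ → ℝ =>
      (Sum.elim (z ∘ Sum.inl) (z ∘ Sum.inr ∘ b.symm) : ι ⊕ Fin m → ℝ) := by
    rintro (i | j)
    · exact ⟨MvPolynomial.X (Sum.inl i), fun x => by rw [MvPolynomial.eval_X]; rfl⟩
    · exact ⟨MvPolynomial.X (Sum.inr (b.symm j)), fun x => by rw [MvPolynomial.eval_X]; rfl⟩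
  refine cls_eq_dcls (h.lift e') (prodAct h (e' ∘ b.symm)) _ (hg.isFracOn _)
    (fun z => (⟨z.1 ∘ Sum.inl, z.2⟩, z.1 ∘ Sum.inr ∘ b.symm)) ⟨?_, ?_⟩ (fun _ => rfl)
    (fun l z => rfl) fun z => ?_
  · intro z z' hz
    have h1 : z.1 ∘ Sum.inl = z'.1 ∘ Sum.inl := congrArg (fun q => q.1.1) hz
    have h2 : z.1 ∘ Sum.inr ∘ b.symm = z'.1 ∘ Sum.inr ∘ b.symm := congrArg (fun q => q.2) hz
    refine Subtype.ext (funext ?_)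
    rintro (i | j)
    · exact congrFun h1 i
    · simpa using congrFun h2 (b j)
  · rintro ⟨⟨x, hx⟩, v⟩
    refine ⟨⟨Sum.elim x (v ∘ b), hx⟩, Prod.ext rfl ?_⟩
    funext j
    simp
  · rw [MvPolynomial.eval_rename]
    rfl

/-- A point of the fibre product is `(x, v, φ(x))`, whose last entry is redundant. This converts
multiplication by the class of an affine space into a cartesian product with trivial action on the
new factor. -/
lemma cls_fiberProd_timesGm_affine {ι : Type} [Finite ι] {n : ℕ} {S : Set (ι → ℝ)} {e : ι → ℤ}
    {P : MvPolynomial ι ℝ} (h : DiagValid n S e P) (m : ℕ) :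
    K0n.cls ((diag h).fiberProd (timesGm n (ASSet.affine m))) =
      dcls n {z : ι ⊕ Fin m → ℝ | z ∘ Sum.inl ∈ S} (Sum.elim e 0)
        (MvPolynomial.rename Sum.inl P) := by
  have hg : IsPolyMap fun z : ι ⊕ Fin m → ℝ => (Sum.elim (Sum.elim (z ∘ Sum.inl)
      (Sum.elim (z ∘ Sum.inr) fun _ => MvPolynomial.eval (z ∘ Sum.inl) P))
      fun _ => MvPolynomial.eval (z ∘ Sum.inl) P : (ι ⊕ (Fin m ⊕ Unit)) ⊕ Unit → ℝ) := by
    rintro ((i | j | _) | _)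
    · exact ⟨MvPolynomial.X (Sum.inl i), fun x => by rw [MvPolynomial.eval_X]; rfl⟩
    · exact ⟨MvPolynomial.X (Sum.inr j), fun x => by rw [MvPolynomial.eval_X]; rfl⟩
    · exact ⟨MvPolynomial.rename Sum.inl P, fun x => by rw [MvPolynomial.eval_rename]; rfl⟩
    · exact ⟨MvPolynomial.rename Sum.inl P, fun x => by rw [MvPolynomial.eval_rename]; rfl⟩
  refine cls_eq_dcls (h.lift 0) _ _ (hg.isFracOn _)
    (fun z => ⟨(⟨z.1 ∘ Sum.inl, z.2⟩, (z.1 ∘ Sum.inr,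
      (diag h).φ ⟨z.1 ∘ Sum.inl, z.2⟩)), rfl⟩) ⟨?_, ?_⟩ ?_ (fun l z => ?_) fun z => ?_
  · intro z z' hz
    have h1 : z.1 ∘ Sum.inl = z'.1 ∘ Sum.inl := congrArg (fun q => q.1.1.1) hz
    have h2 : z.1 ∘ Sum.inr = z'.1 ∘ Sum.inr := congrArg (fun q => q.1.2.1) hz
    refine Subtype.ext (funext ?_)
    rintro (i | j)
    · exact congrFun h1 i
    · exact congrFun h2 j
  · rintro ⟨⟨⟨x, hx⟩, v, r⟩, hr⟩
    have hr : (diag h).φ ⟨x, hx⟩ = r := hr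
    subst hr
    exact ⟨⟨Sum.elim x v, hx⟩, rfl⟩
  · intro z
    funext i
    rcases i with (i | i | i) | i <;> rfl
  · refine Subtype.ext (Prod.ext rfl (Prod.ext ?_ ((diag h).φ_act l ⟨z.1 ∘ Sum.inl, z.2⟩)))
    show dact 0 l (z.1 ∘ Sum.inr) = z.1 ∘ Sum.inr
    funext i
    simp [dact]
  · rw [MvPolynomial.eval_rename]
    rfl

end MonVar

/-- By independence of the lifting the weights `e'` may be replaced by `0`; the object is then a
fibre product with `ℝ^m × ℝ^*`. -/
lemma dcls_lift {ι κ : Type} [Finite ι] [Finite κ] {n : ℕ} {S : Set (ι → ℝ)} {e : ι → ℤ}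
    {P : MvPolynomial ι ℝ} (h : DiagValid n S e P) (e' : κ → ℤ) :
    dcls n {z : ι ⊕ κ → ℝ | z ∘ Sum.inl ∈ S} (Sum.elim e e') (MvPolynomial.rename Sum.inl P) =
      dcls n S e P * affLine n ^ Nat.card κ := by
  rw [affLine, ← map_pow, ← K0AS.cls_affine, K0AS.toK0n_cls]
  rw [← MonVar.cls_prodAct h (Finite.equivFin κ), MonVar.cls_prodAct_congr h _ 0]
  refine (MonVar.cls_prodAct h (Equiv.refl _) 0).trans ?_
  rw [← MonVar.cls_fiberProd_timesGm_affine h, dcls_of_valid h, K0n.cls_mul]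

lemma diagValid_prod_units {ι : Type} [Finite ι] (n : ℕ) {Z : Set (ι → ℝ)} (hZ : IsAS Z)
    {e : ι → ℤ} (he : ∀ l, ∀ x ∈ Z, dact e l x ∈ Z) :
    DiagValid n {z : ι ⊕ Unit → ℝ | z ∘ Sum.inl ∈ Z ∧ z (Sum.inr ()) ≠ 0}
      (Sum.elim e fun _ => n) (MvPolynomial.X (Sum.inr ())) where
  isAS := by
    have := isAS_ne_zero (MvPolynomial.X (Sum.inr ()) : MvPolynomial (ι ⊕ Unit) ℝ)
    simp only [MvPolynomial.eval_X] at this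
    exact (hZ.comap _).inter this
  ne_zero z hz := by simpa using hz.2
  inv l z hz := ⟨he l _ hz.1, mul_ne_zero (Units.ne_zero _) hz.2⟩
  hom l z hz := by simp [dact]

lemma dcls_prod_units {ι : Type} [Finite ι] (n : ℕ) {Z : Set (ι → ℝ)} (hZ : IsAS Z) :
    dcls n {z : ι ⊕ Unit → ℝ | z ∘ Sum.inl ∈ Z ∧ z (Sum.inr ()) ≠ 0}
      (Sum.elim 0 fun _ => n) (MvPolynomial.X (Sum.inr ())) =
      K0AS.toK0n n (K0AS.cls (ASSet.ofSet Z hZ)) := by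
  have h0 : ∀ (l : ℝˣ) (x : ι → ℝ), dact 0 l x = x := fun l x => by funext i; simp [dact]
  have hv := diagValid_prod_units n hZ (e := 0) fun l x hx => by rwa [h0]
  rw [K0AS.toK0n_cls]
  symm
  refine cls_eq_dcls hv _ id (IsPolyMap.isFracOn (fun j => ⟨MvPolynomial.X j, by simp⟩) _)
    (fun z => (⟨z.1 ∘ Sum.inl, z.2.1⟩, Units.mk0 (z.1 (Sum.inr ())) z.2.2)) ⟨?_, ?_⟩ ?_ ?_ ?_
  · intro z z' hz
    have h1 : z.1 ∘ Sum.inl = z'.1 ∘ Sum.inl := congrArg (fun q => q.1.1) hz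
    have h2 : z.1 (Sum.inr ()) = z'.1 (Sum.inr ()) := congrArg (fun q => (q.2 : ℝˣ).val) hz
    refine Subtype.ext (funext ?_)
    rintro (i | j)
    · exact congrFun h1 i
    · exact h2
  · rintro ⟨⟨x, hx⟩, r⟩
    refine ⟨⟨Sum.elim x fun _ => ((r : ℝˣ) : ℝ), hx, (r : ℝˣ).ne_zero⟩, Prod.ext rfl ?_⟩
    exact Units.ext rfl
  · intro z
    funext i
    rcases i with i | i <;> rfl
  · intro l z
    refine Prod.ext (Subtype.ext (h0 l _)) (Units.ext ?_)
    show ((l ^ (n : ℤ) : ℝˣ) : ℝ) * z.1 (Sum.inr ()) = ((l ^ n * Units.mk0 _ z.2.2 : ℝˣ) : ℝ)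
    simp
  · intro z
    simp [MonVar.timesGm]

/-! ### Independence of the weights of a diagonal action on a subset of a torus -/

lemma DiagValid.inter_units {ι : Type} [Finite ι] {n : ℕ} {S : Set (ι → ℝ)} {e : ι → ℤ}
    {P : MvPolynomial ι ℝ} (h : DiagValid n S e P) (a : ℤ) :
    DiagValid n {z : ι ⊕ Unit → ℝ | z ∘ Sum.inl ∈ S ∧ z (Sum.inr ()) ≠ 0}
      (Sum.elim e fun _ => a) (MvPolynomial.rename Sum.inl P) := by
  refine (h.lift (κ := Unit) fun _ => a).sub (fun z hz => hz.1) ?_ fun l z hz =>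
    ⟨h.inv l _ hz.1, mul_ne_zero (Units.ne_zero _) hz.2⟩
  have := isAS_ne_zero (MvPolynomial.X (Sum.inr ()) : MvPolynomial (ι ⊕ Unit) ℝ)
  simp only [MvPolynomial.eval_X] at this
  exact (h.isAS.comap _).inter this

/-- The class of `S × ℝ^*` does not depend on the weight on the second factor. -/
lemma dcls_mul_units {ι : Type} [Finite ι] {n : ℕ} {S : Set (ι → ℝ)} {e : ι → ℤ}
    {P : MvPolynomial ι ℝ} (h : DiagValid n S e P) (a : ℤ) :
    dcls n {z : ι ⊕ Unit → ℝ | z ∘ Sum.inl ∈ S ∧ z (Sum.inr ()) ≠ 0}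
      (Sum.elim e fun _ => a) (MvPolynomial.rename Sum.inl P) =
      dcls n S e P * affLine n - dcls n S e P := by
  have hl := h.lift (κ := Unit) fun _ => a
  have h0 := isAS_eq_zero (MvPolynomial.X (Sum.inr ()) : MvPolynomial (ι ⊕ Unit) ℝ)
  simp only [MvPolynomial.eval_X] at h0
  -- `S × ℝ` is cut along its zero section, which is invariant whatever the weight `a`. The class of
  -- `S × ℝ` does not involve `a` by `dcls_lift`, and the zero section is a copy of `S`.
  have hc := dcls_closed hl (C := {z | z (Sum.inr ()) = 0})
    (isClosed_eq (continuous_apply _) continuous_const) h0 fun l z _ hz => by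
      show _ * z (Sum.inr ()) = 0
      rw [show z (Sum.inr ()) = 0 from hz, mul_zero]
  rw [dcls_lift h, Nat.card_unique, pow_one] at hc
  rw [hc, eq_sub_iff_add_eq]
  congr 1
  have hv : DiagValid n ({z : ι ⊕ Unit → ℝ | z ∘ Sum.inl ∈ S} ∩ {z | z (Sum.inr ()) = 0})
      (Sum.elim e fun _ => a) (MvPolynomial.rename Sum.inl P) :=
    hl.sub Set.inter_subset_left (hl.isAS.inter h0) fun l z hz => ⟨h.inv l _ hz.1, by
      show _ * z (Sum.inr ()) = 0
      rw [show z (Sum.inr ()) = 0 from hz.2, mul_zero]⟩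
  refine (dcls_bij hv h (fun z => z ∘ Sum.inl) ((isPolyMap_comp _).isFracOn _) ⟨?_, ?_, ?_⟩
    (fun l z _ => rfl) fun z _ => ?_).symm
  · exact fun z hz => hz.1
  · intro z hz z' hz' hzz
    funext i
    rcases i with i | i
    · exact congrFun hzz i
    · exact (show z (Sum.inr ()) = 0 from hz.2).trans (show z' (Sum.inr ()) = 0 from hz'.2).symm
  · exact fun x hx => ⟨Sum.elim x fun _ => 0, ⟨hx, rfl⟩, rfl⟩
  · rw [MvPolynomial.eval_rename]

/-- Laurent monomials. -/
noncomputable def laurentMonomial {ι : Type} [Fintype ι] (v : ι → ℤ) (x : ι → ℝ) : ℝ :=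
  ∏ i, x i ^ v i

lemma laurentMonomial_ne_zero {ι : Type} [Fintype ι] (v : ι → ℤ) {x : ι → ℝ}
    (hx : ∀ i, x i ≠ 0) : laurentMonomial v x ≠ 0 :=
  Finset.prod_ne_zero_iff.2 fun i _ => zpow_ne_zero _ (hx i)

lemma laurentMonomial_dact {ι : Type} [Fintype ι] (v e : ι → ℤ) (l : ℝˣ) (x : ι → ℝ) :
    laurentMonomial v (dact e l x) = (l : ℝ) ^ (∑ i, e i * v i) * laurentMonomial v x := by
  have h : (l : ℝ) ^ (∑ i, e i * v i) = ∏ i, (l : ℝ) ^ (e i * v i) := by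
    have : ∀ s : Finset ι, (l : ℝ) ^ (∑ i ∈ s, e i * v i) = ∏ i ∈ s, (l : ℝ) ^ (e i * v i) := by
      classical
      intro s
      induction s using Finset.induction_on with
      | empty => simp
      | insert i s hi ih =>
        rw [Finset.sum_insert hi, Finset.prod_insert hi, zpow_add₀ l.ne_zero, ih]
    exact this _
  rw [laurentMonomial, laurentMonomial, h, ← Finset.prod_mul_distrib]
  refine Finset.prod_congr rfl fun i _ => ?_
  rw [dact, mul_zpow, Units.val_zpow_eq_zpow_val, zpow_mul]

lemma zpow_mul_pow_toNat {r : ℝ} (hr : r ≠ 0) (a : ℤ) :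
    r ^ a * r ^ (-a).toNat = r ^ a.toNat := by
  have := units_zpow_mul_pow_toNat (Units.mk0 r hr) a
  rwa [Units.val_zpow_eq_zpow_val, Units.val_mk0] at this

/-- Separating positive and negative exponents makes the slice `x^v = 1` of the torus a polynomial
condition, hence `AS`. -/
lemma laurentMonomial_eq_one_iff {ι : Type} [Fintype ι] (v : ι → ℤ) {x : ι → ℝ}
    (hx : ∀ i, x i ≠ 0) : laurentMonomial v x = 1 ↔
      MvPolynomial.eval x (∏ i, MvPolynomial.X i ^ (v i).toNat) =
        MvPolynomial.eval x (∏ i, MvPolynomial.X i ^ (-v i).toNat) := by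
  have h : laurentMonomial v x * MvPolynomial.eval x (∏ i, MvPolynomial.X i ^ (-v i).toNat) =
      MvPolynomial.eval x (∏ i, MvPolynomial.X i ^ (v i).toNat) := by
    simp only [laurentMonomial, map_prod, map_pow, MvPolynomial.eval_X]
    rw [← Finset.prod_mul_distrib]
    exact Finset.prod_congr rfl fun i _ => zpow_mul_pow_toNat (hx i) _
  have h0 : MvPolynomial.eval x (∏ i, MvPolynomial.X i ^ (-v i).toNat) ≠ 0 := by
    simp only [map_prod, map_pow, MvPolynomial.eval_X]
    exact Finset.prod_ne_zero_iff.2 fun i _ => pow_ne_zero _ (hx i)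
  rw [← h, mul_eq_right₀ h0]

/-- The class of a subset of a torus, stable under the one-parameter subgroup `w`, is that of the
product of a slice and `ℝ^*`. -/
lemma dcls_eq_slice {ι : Type} [Fintype ι] {n : ℕ} {S : Set (ι → ℝ)} {e : ι → ℤ}
    {P : MvPolynomial ι ℝ} (h : DiagValid n S e P) (hS : ∀ x ∈ S, ∀ i, x i ≠ 0)
    {w v : ι → ℤ} (hwv : ∑ i, w i * v i = 1) (hw : ∀ l, ∀ x ∈ S, dact w l x ∈ S)
    (hP : ∀ l, ∀ x ∈ S, MvPolynomial.eval (dact w l x) P = MvPolynomial.eval x P) :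
    dcls n S e P = dcls n (S ∩ {x | laurentMonomial v x = 1}) (e - (∑ i, e i * v i) • w) P *
      affLine n - dcls n (S ∩ {x | laurentMonomial v x = 1}) (e - (∑ i, e i * v i) • w) P := by
  have hA : IsAS (S ∩ {x | laurentMonomial v x = 1}) := by
    have := h.isAS.inter (isAS_forall_eval_eq
      (fun _ : Unit => (∏ i, MvPolynomial.X i ^ (v i).toNat : MvPolynomial ι ℝ))
      fun _ => ∏ i, MvPolynomial.X i ^ (-v i).toNat)
    convert this using 1
    ext x
    exact and_congr_right fun hx => by
      rw [Set.mem_ofPred_eq, Set.mem_ofPred_eq, laurentMonomial_eq_one_iff v (hS x hx)]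
      simp
  -- The action of weight `e` multiplies `x^v` by `l^{e · v}`. Subtracting `(e · v) w` compensates
  -- this, because `w · v = 1`; the corrected weights preserve the slice.
  have hd : ∀ l x, dact (e - (∑ i, e i * v i) • w) l x =
      dact w (l ^ (-∑ i, e i * v i)) (dact e l x) := by
    intro l x
    rw [← dact_smul, ← dact_add, neg_smul, neg_add_eq_sub]
  have hY : DiagValid n (S ∩ {x | laurentMonomial v x = 1}) (e - (∑ i, e i * v i) • w) P := by
    refine ⟨hA, fun x hx => h.ne_zero x hx.1, fun l x hx => ⟨?_, ?_⟩, fun l x hx => ?_⟩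
    · rw [hd]
      exact hw _ _ (h.inv l x hx.1)
    · show laurentMonomial v _ = 1
      rw [laurentMonomial_dact, show laurentMonomial v x = 1 from hx.2, mul_one]
      have : ∑ i, (e - (∑ i, e i * v i) • w) i * v i = 0 := by
        simp only [Pi.sub_apply, Pi.smul_apply, smul_eq_mul, sub_mul, Finset.sum_sub_distrib,
          mul_assoc, ← Finset.mul_sum, hwv, mul_one, sub_self]
      rw [this, zpow_zero]
    · rw [hd, hP _ _ (h.inv l x hx.1), h.hom l x hx.1]
  -- The isomorphism from the product is `(y, t) ↦ t^w y`. It is equivariant when the factor `ℝ^*`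
  -- has weight `e · v`, the part removed from the slice.
  rw [← dcls_mul_units hY (∑ i, e i * v i)]
  symm
  have hg : ∀ z : ι ⊕ Unit → ℝ, ∀ hz : z (Sum.inr ()) ≠ 0,
      (fun i => z (Sum.inr ()) ^ w i * z (Sum.inl i)) =
        dact w (Units.mk0 _ hz) (z ∘ Sum.inl) := by
    intro z hz
    funext i
    simp [dact]
  refine dcls_bij (hY.inter_units _) h
    (fun z i => z (Sum.inr ()) ^ w i * z (Sum.inl i)) ?_ ⟨?_, ?_, ?_⟩ ?_ ?_
  · intro i
    refine ⟨MvPolynomial.X (Sum.inr ()) ^ (w i).toNat * MvPolynomial.X (Sum.inl i),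
      MvPolynomial.X (Sum.inr ()) ^ (-w i).toNat, fun z hz => ⟨?_, ?_⟩⟩
    · simp only [map_pow, MvPolynomial.eval_X]
      exact pow_ne_zero _ hz.2
    · simp only [map_mul, map_pow, MvPolynomial.eval_X]
      rw [← zpow_mul_pow_toNat hz.2 (w i)]
      ring
  · intro z hz
    beta_reduce
    rw [hg z hz.2]
    exact hw _ _ hz.1.1
  · intro z hz z' hz' hzz
    beta_reduce at hzz
    rw [hg z hz.2, hg z' hz'.2] at hzz
    -- The monomial `x^v` recovers `t` from `t^w y`, and then `y` is recovered by acting with `t⁻¹`.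
    have h1 := congrArg (laurentMonomial v) hzz
    rw [laurentMonomial_dact, laurentMonomial_dact, hwv,
      show laurentMonomial v (z ∘ Sum.inl) = 1 from hz.1.2,
      show laurentMonomial v (z' ∘ Sum.inl) = 1 from hz'.1.2] at h1
    simp only [Units.val_mk0, zpow_one, mul_one] at h1
    have h2 : Units.mk0 _ hz.2 = Units.mk0 _ hz'.2 := Units.ext h1
    rw [h2] at hzz
    have h3 := congrArg (dact w (Units.mk0 _ hz'.2)⁻¹) hzz
    rw [dact_inv_cancel, dact_inv_cancel] at h3
    funext i
    rcases i with i | i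
    · exact congrFun h3 i
    · exact h1
  · intro x hx
    have hx0 := laurentMonomial_ne_zero v (hS x hx)
    refine ⟨Sum.elim (dact w (Units.mk0 _ hx0)⁻¹ x) fun _ => laurentMonomial v x,
      ⟨⟨hw _ _ hx, ?_⟩, hx0⟩, ?_⟩
    · show laurentMonomial v (dact w (Units.mk0 _ hx0)⁻¹ x) = 1
      rw [laurentMonomial_dact, hwv, zpow_one, Units.val_inv_eq_inv_val, Units.val_mk0,
        inv_mul_cancel₀ hx0]
    · beta_reduce
      rw [hg _ hx0]
      show dact w (Units.mk0 _ hx0) (dact w (Units.mk0 _ hx0)⁻¹ x) = x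
      rw [← dact_mul, mul_inv_cancel, dact_one]
  · intro l z hz
    have h1 : dact (Sum.elim (e - (∑ i, e i * v i) • w) fun _ => ∑ i, e i * v i) l z (Sum.inr ())
        ≠ 0 := mul_ne_zero (Units.ne_zero _) hz.2
    rw [hg _ h1, hg z hz.2, dact_comp_inl, hd]
    rw [← dact_mul]
    have h2 : Units.mk0 _ h1 * l ^ (-∑ i, e i * v i) = Units.mk0 _ hz.2 := by
      refine Units.ext ?_
      simp only [Units.val_mul, Units.val_mk0, dact, Sum.elim_inr]
      rw [mul_right_comm, ← Units.val_mul, ← zpow_add, add_neg_cancel, zpow_zero, Units.val_one,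
        one_mul]
    rw [h2]
    funext i
    simp only [dact]
    ring
  · intro z hz
    rw [hg z hz.2, hP _ _ hz.1.1, MvPolynomial.eval_rename]

/-- The class of a subset of a torus, stable under the one-parameter subgroup `w`, does not change
if a multiple of `w` is added to the weights. -/
lemma dcls_twist {ι : Type} [Fintype ι] {n : ℕ} {S : Set (ι → ℝ)} {e : ι → ℤ}
    {P : MvPolynomial ι ℝ} (h : DiagValid n S e P) (hS : ∀ x ∈ S, ∀ i, x i ≠ 0)
    {w v : ι → ℤ} (hwv : ∑ i, w i * v i = 1) (hw : ∀ l, ∀ x ∈ S, dact w l x ∈ S)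
    (hP : ∀ l, ∀ x ∈ S, MvPolynomial.eval (dact w l x) P = MvPolynomial.eval x P) (c : ℤ) :
    dcls n S e P = dcls n S (e + c • w) P := by
  have h' : DiagValid n S (e + c • w) P := by
    have hd : ∀ l x, dact (e + c • w) l x = dact w (l ^ c) (dact e l x) := by
      intro l x
      rw [add_comm, dact_add, dact_smul]
    refine ⟨h.isAS, h.ne_zero, fun l x hx => ?_, fun l x hx => ?_⟩
    · rw [hd]; exact hw _ _ (h.inv l x hx)
    · rw [hd, hP _ _ (h.inv l x hx), h.hom l x hx]
  rw [dcls_eq_slice h hS hwv hw hP, dcls_eq_slice h' hS hwv hw hP]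
  -- Both objects have the same slice with the same weights: `e - (e · v) w` is constant along the
  -- direction `w`.
  have : e + c • w - (∑ i, (e + c • w) i * v i) • w = e - (∑ i, e i * v i) • w := by
    simp only [Pi.add_apply, Pi.smul_apply, smul_eq_mul, add_mul, Finset.sum_add_distrib,
      mul_assoc, ← Finset.mul_sum, hwv, mul_one, add_smul]
    abel
  rw [this]

/-- A non-zero integral vector is a multiple of a primitive one. -/
lemma exists_primitive {ι : Type} [Fintype ι] {w : ι → ℤ} (hw : w ≠ 0) :
    ∃ (c : ℤ) (w₀ v : ι → ℤ), c ≠ 0 ∧ w = c • w₀ ∧ ∑ i, w₀ i * v i = 1 := by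
  -- `g` is a greatest common divisor of the entries of `w`, and `v` consists of Bézout
  -- coefficients.
  obtain ⟨g, hg⟩ := (IsPrincipalIdealRing.principal (Ideal.span (Set.range w))).principal
  have hg : Ideal.span (Set.range w) = Ideal.span {g} := hg
  have h1 : ∀ i, ∃ a, w i = g * a := fun i => by
    have : w i ∈ Ideal.span {g} := hg ▸ Ideal.subset_span ⟨i, rfl⟩
    exact Ideal.mem_span_singleton.1 this
  choose w₀ hw₀ using h1
  have hg0 : g ≠ 0 := by
    rintro rfl
    exact hw (funext fun i => by simp [hw₀])
  have h2 : g ∈ Ideal.span (Set.range w) := hg ▸ Ideal.mem_span_singleton_self g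
  obtain ⟨v, hv⟩ := Ideal.mem_span_range_iff_exists_fun.1 h2
  refine ⟨g, w₀, v, hg0, funext hw₀, ?_⟩
  have : g * ∑ i, w₀ i * v i = g * 1 := by
    rw [mul_one]
    conv_rhs => rw [← hv]
    rw [Finset.mul_sum]
    refine Finset.sum_congr rfl fun i _ => ?_
    rw [hw₀]
    ring
  exact mul_left_cancel₀ hg0 this

/-! ### Weighted homogeneous polynomials on the torus -/

/-- The complement of `g = 0` in the torus. -/
def torusComplSet {ι : Type} (g : MvPolynomial ι ℝ) : Set (ι → ℝ) :=
  {x | (∀ i, x i ≠ 0) ∧ MvPolynomial.eval x g ≠ 0}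

/-- The hypersurface `g = 0` of the torus. -/
def torusZeroSet {ι : Type} (g : MvPolynomial ι ℝ) : Set (ι → ℝ) :=
  {x | (∀ i, x i ≠ 0) ∧ MvPolynomial.eval x g = 0}

/-- The analogue of `eval_weighted` for integral weights: primitive vectors obtained from
differences of weights may have negative entries. -/
lemma eval_dact {ι : Type} [Fintype ι] {g : MvPolynomial ι ℝ} {w : ι → ℤ} {N : ℤ}
    (h : ∀ ν ∈ g.support, ∑ i, w i * (ν i : ℤ) = N) (l : ℝˣ) (x : ι → ℝ) :
    MvPolynomial.eval (dact w l x) g = (l : ℝ) ^ N * MvPolynomial.eval x g := by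
  rw [MvPolynomial.eval_eq', MvPolynomial.eval_eq', Finset.mul_sum]
  refine Finset.sum_congr rfl fun ν hν => ?_
  have h1 := laurentMonomial_dact (fun i => (ν i : ℤ)) w l x
  simp only [laurentMonomial, zpow_natCast] at h1
  rw [h1, h ν hν]
  ring

lemma weighted_sum_eq {d : ℕ} {g : MvPolynomial (Fin d) ℝ} {k : Fin d → ℕ} {n : ℕ}
    (h : MvPolynomial.IsWeightedHomogeneous k g n) {ν : Fin d →₀ ℕ} (hν : ν ∈ g.support) :
    ∑ i, k i * ν i = n := by
  have hw := h (MvPolynomial.mem_support_iff.1 hν)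
  rw [Finsupp.weight_apply, Finsupp.sum_fintype _ _ (by simp)] at hw
  rw [← hw]
  exact Finset.sum_congr rfl fun i _ => by rw [smul_eq_mul, mul_comm]

lemma weighted_sum_eq_int {d : ℕ} {g : MvPolynomial (Fin d) ℝ} {k : Fin d → ℕ} {n : ℕ}
    (h : MvPolynomial.IsWeightedHomogeneous k g n) {ν : Fin d →₀ ℕ} (hν : ν ∈ g.support) :
    ∑ i, (k i : ℤ) * (ν i : ℤ) = n := by
  exact_mod_cast weighted_sum_eq h hν

lemma dact_natCast {ι : Type} (k : ι → ℕ) (l : ℝˣ) (x : ι → ℝ) :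
    dact (fun i => (k i : ℤ)) l x = fun i => (l : ℝ) ^ k i * x i := by
  funext i
  simp [dact]

lemma dact_ne_zero {ι : Type} (e : ι → ℤ) (l : ℝˣ) {x : ι → ℝ} (hx : ∀ i, x i ≠ 0) (i : ι) :
    dact e l x i ≠ 0 :=
  mul_ne_zero (Units.ne_zero _) (hx i)

lemma diagValid_torusCompl {d : ℕ} {g : MvPolynomial (Fin d) ℝ} {k : Fin d → ℕ} {n : ℕ}
    (h : MvPolynomial.IsWeightedHomogeneous k g n) :
    DiagValid n (torusComplSet g) (fun i => (k i : ℤ)) g where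
  isAS := (isAS_torus d).inter (isAS_ne_zero g)
  ne_zero x hx := hx.2
  inv l x hx := ⟨dact_ne_zero _ l hx.1, by
    rw [dact_natCast, eval_weighted h]
    exact mul_ne_zero (pow_ne_zero _ l.ne_zero) hx.2⟩
  hom l x _ := by rw [dact_natCast, eval_weighted h]

lemma cls_torusCompl {d : ℕ} {g : MvPolynomial (Fin d) ℝ} {k : Fin d → ℕ} {n : ℕ}
    (h : MvPolynomial.IsWeightedHomogeneous k g n) :
    K0n.cls (torusCompl g k n h) = dcls n (torusComplSet g) (fun i => (k i : ℤ)) g := by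
  refine cls_eq_dcls (diagValid_torusCompl h) (torusCompl g k n h) id
    (IsPolyMap.isFracOn (fun j => ⟨MvPolynomial.X j, by simp⟩) _) (fun x => ⟨x.1, x.2⟩) ⟨?_, ?_⟩
    (fun _ => rfl) (fun l x => Subtype.ext (dact_natCast k l x.1)) fun _ => rfl
  · intro x y hxy
    exact Subtype.ext (congrArg Subtype.val hxy)
  · rintro ⟨x, hx⟩
    exact ⟨⟨x, hx⟩, rfl⟩

/-- The class of the complement of `g = 0` in the torus does not depend on the weights for which
`g` is homogeneous. -/
lemma cls_torusCompl_eq {d : ℕ} {g : MvPolynomial (Fin d) ℝ} {k k' : Fin d → ℕ} {n n' : ℕ}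
    (hn : 0 < n) (hn' : 0 < n') (h : MvPolynomial.IsWeightedHomogeneous k g n)
    (h' : MvPolynomial.IsWeightedHomogeneous k' g n') :
    K0.cls hn (torusCompl g k n h) = K0.cls hn' (torusCompl g k' n' h') := by
  have hnn := Nat.mul_pos hn hn'
  rw [K0.cls, K0.cls, ← K0.of_theta hn hnn (Dvd.intro _ rfl),
    ← K0.of_theta hn' hnn (Dvd.intro_left _ rfl), cls_torusCompl, cls_torusCompl]
  obtain ⟨h1, h2⟩ := theta_dcls (Dvd.intro _ rfl : n ∣ n * n') (diagValid_torusCompl h)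
  obtain ⟨h3, h4⟩ := theta_dcls (Dvd.intro_left _ rfl : n' ∣ n * n') (diagValid_torusCompl h')
  rw [h2, h4]
  clear h2 h4
  rw [Nat.mul_div_cancel_left _ hn] at h1 ⊢
  rw [Nat.mul_div_cancel _ hn'] at h3 ⊢
  congr 1
  -- At the common level `n * n'` the weights are `n' k` and `n k'`. Their difference pairs to `n n'
  -- - n' n = 0` with every exponent of `g`, so its primitive direction leaves `g` invariant and
  -- `dcls_twist` applies.
  by_cases hw : (n : ℤ) • (fun i => (k' i : ℤ)) - (n' : ℤ) • (fun i => (k i : ℤ)) = 0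
  · rw [sub_eq_zero.1 hw]
  · obtain ⟨c, w, v, hc, hcw, hwv⟩ := exists_primitive hw
    have hsupp : ∀ ν ∈ g.support, ∑ i, w i * (ν i : ℤ) = 0 := by
      intro ν hν
      have h5 : c * ∑ i, w i * (ν i : ℤ) = 0 := by
        rw [Finset.mul_sum]
        have : ∀ i, c * (w i * (ν i : ℤ)) = n * (k' i * ν i) - n' * (k i * ν i) := fun i => by
          have := congrFun hcw i
          simp only [Pi.sub_apply, Pi.smul_apply, smul_eq_mul] at this
          rw [← mul_assoc, ← this]
          ring
        simp only [this, Finset.sum_sub_distrib, ← Finset.mul_sum]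
        rw [weighted_sum_eq_int h hν, weighted_sum_eq_int h' hν]
        ring
      exact (mul_eq_zero.1 h5).resolve_left hc
    have heval : ∀ (l : ℝˣ) (x : Fin d → ℝ),
        MvPolynomial.eval (dact w l x) g = MvPolynomial.eval x g := fun l x => by
      rw [eval_dact hsupp, zpow_zero, one_mul]
    rw [dcls_twist h1 (fun x hx => hx.1) hwv
      (fun l x hx => ⟨dact_ne_zero _ l hx.1, by rw [heval]; exact hx.2⟩) (fun l x _ => heval l x) c,
      ← hcw, add_sub_cancel]

lemma isAS_torusZeroSet {d : ℕ} (g : MvPolynomial (Fin d) ℝ) : IsAS (torusZeroSet g) :=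
  (isAS_torus d).inter (isAS_eq_zero g)

lemma dact_mem_torusZeroSet {d : ℕ} {g : MvPolynomial (Fin d) ℝ} {k : Fin d → ℕ} {m : ℕ}
    (h : MvPolynomial.IsWeightedHomogeneous k g m) (l : ℝˣ) {x : Fin d → ℝ}
    (hx : x ∈ torusZeroSet g) : dact (fun i => (k i : ℤ)) l x ∈ torusZeroSet g :=
  ⟨dact_ne_zero _ l hx.1, by rw [dact_natCast, eval_weighted h, hx.2, mul_zero]⟩

lemma diagValid_torusZero {d : ℕ} {g : MvPolynomial (Fin d) ℝ} {k : Fin d → ℕ} {m : ℕ} (n : ℕ)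
    (h : MvPolynomial.IsWeightedHomogeneous k g m) :
    DiagValid n {z : Fin d ⊕ Unit → ℝ | z ∘ Sum.inl ∈ torusZeroSet g ∧ z (Sum.inr ()) ≠ 0}
      (Sum.elim (fun i => (k i : ℤ)) fun _ => n) (MvPolynomial.X (Sum.inr ())) :=
  diagValid_prod_units n (isAS_torusZeroSet g) fun l _ => dact_mem_torusZeroSet h l

/-- The class of `g⁻¹(0) × ℝ^*` does not depend on the weights of the action on `g⁻¹(0)`. -/
lemma dcls_torusZero {d : ℕ} {g : MvPolynomial (Fin d) ℝ} {k : Fin d → ℕ} {m : ℕ} (n : ℕ)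
    (h : MvPolynomial.IsWeightedHomogeneous k g m) :
    dcls n {z : Fin d ⊕ Unit → ℝ | z ∘ Sum.inl ∈ torusZeroSet g ∧ z (Sum.inr ()) ≠ 0}
      (Sum.elim (fun i => (k i : ℤ)) fun _ => n) (MvPolynomial.X (Sum.inr ())) =
      K0AS.toK0n n (K0AS.cls (torusZero g)) := by
  have hZ : dcls n {z : Fin d ⊕ Unit → ℝ | z ∘ Sum.inl ∈ torusZeroSet g ∧ z (Sum.inr ()) ≠ 0}
      (Sum.elim 0 fun _ => n) (MvPolynomial.X (Sum.inr ())) =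
      K0AS.toK0n n (K0AS.cls (torusZero g)) := dcls_prod_units n (isAS_torusZeroSet g)
  rw [← hZ]
  by_cases hk : (fun i => (k i : ℤ)) = 0
  · rw [hk]
  · obtain ⟨c, w, v, hc, hcw, hwv⟩ := exists_primitive hk
    have hmem : ∀ l : ℝˣ, ∀ x ∈ torusZeroSet g, dact w l x ∈ torusZeroSet g := by
      intro l x hx
      refine ⟨dact_ne_zero _ l hx.1, ?_⟩
      by_cases hne : g.support.Nonempty
      · obtain ⟨ν₀, hν₀⟩ := hne
        -- All products `c (w · ν)` equal `m` and `c ≠ 0`, so `g` is homogeneous for the primitive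
        -- vector `w` too, and its zero set is stable under `w`.
        have : ∀ ν ∈ g.support, ∑ i, w i * (ν i : ℤ) = ∑ i, w i * (ν₀ i : ℤ) := by
          intro ν hν
          have h5 : ∀ ν ∈ g.support, c * ∑ i, w i * (ν i : ℤ) = m := by
            intro ν hν
            rw [Finset.mul_sum, ← weighted_sum_eq_int h hν]
            refine Finset.sum_congr rfl fun i _ => ?_
            rw [← mul_assoc]
            congr 1
            exact (congrFun hcw i).symm
          exact mul_left_cancel₀ hc ((h5 ν hν).trans (h5 ν₀ hν₀).symm)
        rw [eval_dact this, hx.2, mul_zero]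
      · rw [Finset.not_nonempty_iff_eq_empty, MvPolynomial.support_eq_empty] at hne
        rw [hne, map_zero]
    have h0 : DiagValid n
        {z : Fin d ⊕ Unit → ℝ | z ∘ Sum.inl ∈ torusZeroSet g ∧ z (Sum.inr ()) ≠ 0}
        (Sum.elim 0 fun _ => n) (MvPolynomial.X (Sum.inr ())) :=
      diagValid_prod_units n (isAS_torusZeroSet g) fun l x hx => by
        rwa [show dact 0 l x = x from by funext i; simp [dact]]
    -- The twist has weight `0` on `ℝ^*`, so it leaves the map to `ℝ^*` alone; it leads from the
    -- trivial action on `g = 0` to the one of weights `k = c w`.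
    have ht := dcls_twist h0 (w := Sum.elim w 0) (v := Sum.elim v 0) ?_ ?_ ?_ ?_ c
    · rw [ht]
      congr 1
      funext i
      rcases i with i | i
      · simpa using congrFun hcw i
      · simp
    · rintro z hz (i | i)
      · exact hz.1.1 i
      · exact hz.2
    · simpa using hwv
    · intro l z hz
      refine ⟨hmem l _ hz.1, ?_⟩
      simpa [dact] using hz.2
    · intro l z hz
      simp [dact]

/-! ### The initial form of `f` along an arc -/

/-- Stated over any commutative ring in order to be used over `ℝ[t]`, with `t^l` as the increment.
-/
lemma exists_taylor {σ R : Type*} [Fintype σ] [CommRing R] (F : MvPolynomial σ R) (y z : σ → R)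
    (t : R) : ∃ r, MvPolynomial.eval (fun i => y i + t * z i) F = MvPolynomial.eval y F +
      t * ∑ i, MvPolynomial.eval y (MvPolynomial.pderiv i F) * z i + t ^ 2 * r := by
  classical
  induction F using MvPolynomial.induction_on with
  | C a => exact ⟨0, by simp⟩
  | add p q hp hq =>
    obtain ⟨r, hr⟩ := hp
    obtain ⟨s, hs⟩ := hq
    refine ⟨r + s, ?_⟩
    simp only [map_add, hr, hs, add_mul, Finset.sum_add_distrib]
    ring
  | mul_X p j hp =>
    obtain ⟨r, hr⟩ := hp
    refine ⟨r * (y j + t * z j) +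
      (∑ i, MvPolynomial.eval y (MvPolynomial.pderiv i p) * z i) * z j, ?_⟩
    have h1 : ∑ i, MvPolynomial.eval y (MvPolynomial.pderiv i (p * MvPolynomial.X j)) * z i =
        (∑ i, MvPolynomial.eval y (MvPolynomial.pderiv i p) * z i) * y j +
          MvPolynomial.eval y p * z j := by
      simp only [Derivation.leibniz, MvPolynomial.pderiv_X, smul_eq_mul, map_add, map_mul,
        MvPolynomial.eval_X, add_mul, Finset.sum_add_distrib, Finset.sum_mul]
      rw [add_comm]
      congr 1
      · exact Finset.sum_congr rfl fun i _ => by ring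
      · rw [Finset.sum_eq_single j]
        · simp
        · intro i _ hij
          simp [hij.symm]
        · simp
    rw [map_mul, map_mul, hr, h1, MvPolynomial.eval_X, MvPolynomial.eval_X]
    ring

/-- The sum of the monomials of `f` of weight `m`. -/
noncomputable def initialForm {d : ℕ} (f : MvPolynomial (Fin d) ℝ) (k : Fin d → ℕ) (m : ℕ) :
    MvPolynomial (Fin d) ℝ :=
  ∑ ν ∈ f.support with ∑ i, k i * ν i = m, MvPolynomial.monomial ν (f.coeff ν)

/-- The polynomial `t^{-m} f(t^k y)`, with coefficients in `ℝ[t]`. -/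
noncomputable def weightQuot {d : ℕ} (f : MvPolynomial (Fin d) ℝ) (k : Fin d → ℕ) (m : ℕ) :
    MvPolynomial (Fin d) (Polynomial ℝ) :=
  ∑ ν ∈ f.support, MvPolynomial.monomial ν
    -- The truncated subtraction is a true one when `m` is at most the weight of every monomial,
    -- which is assumed in the lemmas below.
    (Polynomial.C (f.coeff ν) * Polynomial.X ^ (∑ i, k i * ν i - m))

lemma aeval_weightQuot {d : ℕ} {f : MvPolynomial (Fin d) ℝ} {k : Fin d → ℕ} {m : ℕ}
    (hm : ∀ ν ∈ f.support, m ≤ ∑ i, k i * ν i) (y : Fin d → Polynomial ℝ) :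
    MvPolynomial.aeval (fun i => Polynomial.X ^ k i * y i) f =
      Polynomial.X ^ m * MvPolynomial.eval y (weightQuot f k m) := by
  rw [MvPolynomial.aeval_def, MvPolynomial.eval₂_eq', weightQuot, map_sum, Finset.mul_sum]
  refine Finset.sum_congr rfl fun ν hν => ?_
  rw [MvPolynomial.eval_monomial, Finsupp.prod_fintype _ _ fun i => pow_zero _]
  simp only [mul_pow, Finset.prod_mul_distrib, ← pow_mul, Finset.prod_pow_eq_pow_sum]
  rw [Polynomial.algebraMap_eq]
  conv_lhs => rw [← Nat.sub_add_cancel (hm ν hν), pow_add]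
  ring

/-- At `t = 0` only the monomials of weight exactly `m` survive. -/
lemma map_weightQuot {d : ℕ} {f : MvPolynomial (Fin d) ℝ} {k : Fin d → ℕ} {m : ℕ}
    (hm : ∀ ν ∈ f.support, m ≤ ∑ i, k i * ν i) :
    MvPolynomial.map Polynomial.constantCoeff (weightQuot f k m) = initialForm f k m := by
  rw [weightQuot, initialForm, map_sum, Finset.sum_filter]
  refine Finset.sum_congr rfl fun ν hν => ?_
  rw [MvPolynomial.map_monomial]
  split_ifs with h
  · simp [h]
  · have h1 := hm ν hν
    have h2 : ∑ i, k i * ν i - m ≠ 0 := by omega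
    simp [h2.symm]

lemma constantCoeff_eval {d : ℕ} (G : MvPolynomial (Fin d) (Polynomial ℝ))
    (y : Fin d → Polynomial ℝ) : (MvPolynomial.eval y G).coeff 0 =
      MvPolynomial.eval (fun i => (y i).coeff 0) (MvPolynomial.map Polynomial.constantCoeff G) := by
  induction G using MvPolynomial.induction_on with
  | C a => simp
  | add p q hp hq => simp [hp, hq]
  | mul_X p i hp => simp [hp, Polynomial.mul_coeff_zero]

lemma exists_eq_X_pow_mul {d : ℕ} {k : Fin d → ℕ} {γ : Fin d → Polynomial ℝ}
    (h : ∀ i, ∀ j < k i, (γ i).coeff j = 0) :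
    ∃ y : Fin d → Polynomial ℝ, γ = (fun i => Polynomial.X ^ k i * y i) ∧
      ∀ i j, (y i).coeff j = (γ i).coeff (k i + j) := by
  have h1 : ∀ i, ∃ y, γ i = Polynomial.X ^ k i * y := fun i =>
    Polynomial.X_pow_dvd_iff.2 (h i)
  choose y hy using h1
  refine ⟨y, funext hy, fun i j => ?_⟩
  rw [hy, add_comm, Polynomial.coeff_X_pow_mul]

section

variable {d : ℕ} {f : MvPolynomial (Fin d) ℝ} {k : Fin d → ℕ} {m : ℕ}

lemma coeff_aeval_lt (hm : ∀ ν ∈ f.support, m ≤ ∑ i, k i * ν i) {γ : Fin d → Polynomial ℝ}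
    (h : ∀ i, ∀ j < k i, (γ i).coeff j = 0) {j : ℕ} (hj : j < m) :
    (MvPolynomial.aeval γ f).coeff j = 0 := by
  obtain ⟨y, hy, -⟩ := exists_eq_X_pow_mul h
  rw [hy, aeval_weightQuot hm, Polynomial.coeff_X_pow_mul', if_neg (by omega)]

/-- With `γ = t^k y` and `F = weightQuot f k m` one has `f(γ) = t^m F(y)`. The coefficient is the
constant term of `F(y)`, that is, the initial form at `y(0)`. -/
lemma coeff_aeval_eq (hm : ∀ ν ∈ f.support, m ≤ ∑ i, k i * ν i) {γ : Fin d → Polynomial ℝ}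
    (h : ∀ i, ∀ j < k i, (γ i).coeff j = 0) :
    (MvPolynomial.aeval γ f).coeff m =
      MvPolynomial.eval (fun i => (γ i).coeff (k i)) (initialForm f k m) := by
  obtain ⟨y, hy, hc⟩ := exists_eq_X_pow_mul h
  conv_lhs => rw [hy]
  rw [aeval_weightQuot hm, Polynomial.coeff_X_pow_mul', if_pos le_rfl, Nat.sub_self,
    constantCoeff_eval, map_weightQuot hm]
  simp only [hc, add_zero]

/-- Write `γ = t^k y`, `γ' = t^k (y + t^l z)` and `F = weightQuot f k m`. By Taylor's formula `F(y +
t^l z) - F(y)` is `t^l ∑ (∂_i F)(y) z_i` up to a multiple of `t^{2l}`. As `l > 0`, the coefficient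
of order `l` is the constant term of the sum, given by the gradient of the initial form at the
leading coefficients. This linearity in the new coefficients is what makes the system of equations
triangular. -/
lemma coeff_aeval_sub (hm : ∀ ν ∈ f.support, m ≤ ∑ i, k i * ν i) {γ γ' : Fin d → Polynomial ℝ}
    (h : ∀ i, ∀ j < k i, (γ i).coeff j = 0) {l : ℕ} (hl : 0 < l)
    (hγ : ∀ i, ∀ j < k i + l, (γ i).coeff j = (γ' i).coeff j) :
    (MvPolynomial.aeval γ f).coeff (m + l) - (MvPolynomial.aeval γ' f).coeff (m + l) =
      ∑ i, MvPolynomial.eval (fun i => (γ i).coeff (k i))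
        (MvPolynomial.pderiv i (initialForm f k m)) *
          ((γ i).coeff (k i + l) - (γ' i).coeff (k i + l)) := by
  have h' : ∀ i, ∀ j < k i, (γ' i).coeff j = 0 := fun i j hj => by
    rw [← hγ i j (by omega), h i j hj]
  obtain ⟨y, hy, hc⟩ := exists_eq_X_pow_mul h
  obtain ⟨y', hy', hc'⟩ := exists_eq_X_pow_mul h'
  have h1 : ∀ i, ∃ z, y' i - y i = Polynomial.X ^ l * z := fun i =>
    Polynomial.X_pow_dvd_iff.2 fun j hj => by
      rw [Polynomial.coeff_sub, hc, hc', hγ i _ (by omega), sub_self]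
  choose z hz using h1
  have hyz : y' = fun i => y i + Polynomial.X ^ l * z i := funext fun i => by
    rw [← hz]; ring
  have hz0 : ∀ i, (z i).coeff 0 = (γ' i).coeff (k i + l) - (γ i).coeff (k i + l) := fun i => by
    have := congrArg (fun p => Polynomial.coeff p l) (hz i)
    simp only [Polynomial.coeff_sub, Polynomial.coeff_X_pow_mul', le_refl, if_true,
      Nat.sub_self] at this
    rw [← this, hc, hc']
  obtain ⟨r, hr⟩ := exists_taylor (weightQuot f k m) y z (Polynomial.X ^ l)
  rw [← hyz] at hr
  have e1 : (MvPolynomial.aeval γ f).coeff (m + l) =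
      (MvPolynomial.eval y (weightQuot f k m)).coeff l := by
    conv_lhs => rw [hy]
    rw [aeval_weightQuot hm, add_comm, Polynomial.coeff_X_pow_mul]
  have e2 : (MvPolynomial.aeval γ' f).coeff (m + l) =
      (MvPolynomial.eval y' (weightQuot f k m)).coeff l := by
    conv_lhs => rw [hy']
    rw [aeval_weightQuot hm, add_comm, Polynomial.coeff_X_pow_mul]
  rw [e1, e2, hr, ← pow_mul, Polynomial.coeff_add, Polynomial.coeff_add,
    Polynomial.coeff_X_pow_mul', Polynomial.coeff_X_pow_mul', if_pos le_rfl, Nat.sub_self,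
    if_neg (by omega), Polynomial.finsetSum_coeff]
  simp only [Polynomial.mul_coeff_zero, constantCoeff_eval, hz0, ← MvPolynomial.pderiv_map,
    map_weightQuot hm, hc, add_zero]
  rw [sub_add_cancel_left, ← Finset.sum_neg_distrib]
  exact Finset.sum_congr rfl fun i _ => by ring

end

lemma coeff_jetArc {d N : ℕ} (a : Fin d × Fin (N + 1) → ℝ) (i : Fin d) (j : ℕ) :
    (jetArc a i).coeff j = if h : j < N + 1 then a (i, ⟨j, h⟩) else 0 := by
  rw [jetArc, Polynomial.finsetSum_coeff]
  simp only [Polynomial.coeff_C_mul, Polynomial.coeff_X_pow]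
  split_ifs with h
  · rw [Finset.sum_eq_single ⟨j, h⟩]
    · simp
    · intro b _ hb
      rw [if_neg, mul_zero]
      rintro rfl
      exact hb rfl
    · simp
  · refine Finset.sum_eq_zero fun b _ => ?_
    rw [if_neg, mul_zero]
    rintro rfl
    exact h b.2

lemma coeff_jetArc_of_lt {d N : ℕ} (a : Fin d × Fin (N + 1) → ℝ) (i : Fin d)
    (j : Fin (N + 1)) : (jetArc a i).coeff j = a (i, j) := by
  rw [coeff_jetArc, dif_pos j.2]

/-- A triangular system of equations has a solution. -/
lemma exists_triangular_solution (E : (ℕ → ℝ) → ℕ → ℝ) {D : ℝ} (hD : D ≠ 0) (q : ℕ)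
    (h : ∀ l, l < q → ∀ u u', (∀ j < l, u j = u' j) → E u l - E u' l = D * (u l - u' l))
    (c : ℕ → ℝ) : ∃ u, ∀ l < q, E u l = c l := by
  induction q with
  | zero => exact ⟨0, by simp⟩
  | succ q ih =>
    obtain ⟨u, hu⟩ := ih fun l hl => h l (by omega)
    -- Changing the unknown of index `q` leaves the earlier equations intact: by `h`, `E u l`
    -- depends only on the `u j` with `j ≤ l`. The correction is one step of Newton's method, exact
    -- because the equation is affine of slope `D`.
    set u' := Function.update u q (u q + (c q - E u q) / D) with hu'
    have hag : ∀ j < q, u' j = u j := fun j hj => Function.update_of_ne (by omega) _ _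
    refine ⟨u', fun l hl => ?_⟩
    have h1 := h l hl u' u fun j hj => hag j (by omega)
    rcases Nat.lt_succ_iff_lt_or_eq.1 hl with hlt | rfl
    · rw [hag l hlt, sub_self, mul_zero, sub_eq_zero] at h1
      rw [h1, hu l hlt]
    · have : u' l = u l + (c l - E u l) / D := Function.update_self _ _ _
      rw [this] at h1
      field_simp at h1
      linarith

/-! ### Reindexing, dimension and first non-zero coordinates -/

lemma dcls_reindex {ι κ : Type} [Finite ι] [Finite κ] {n : ℕ} {S : Set (ι → ℝ)} {e : ι → ℤ}
    {P : MvPolynomial ι ℝ} {S' : Set (κ → ℝ)} {P' : MvPolynomial κ ℝ} (r : κ ≃ ι)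
    (h : DiagValid n S e P) (h' : DiagValid n S' (e ∘ r) P') (hS : ∀ x, x ∈ S ↔ x ∘ r ∈ S')
    (hP : ∀ x ∈ S, MvPolynomial.eval (x ∘ r) P' = MvPolynomial.eval x P) :
    dcls n S e P = dcls n S' (e ∘ r) P' := by
  refine dcls_bij h h' (fun x => x ∘ r) ((isPolyMap_comp r).isFracOn _) ⟨?_, ?_, ?_⟩
    (fun _ _ _ => rfl) hP
  · exact fun x hx => (hS x).1 hx
  · intro x _ y _ hxy
    funext i
    simpa using congrFun hxy (r.symm i)
  · intro y hy
    refine ⟨y ∘ r.symm, (hS _).2 ?_, ?_⟩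
    · simpa [Function.comp_assoc] using hy
    · simp [Function.comp_assoc]

/-- Coordinates which vanish on a set do not contribute to its dimension. -/
lemma dim_diag_add_card_le {ι : Type} [Fintype ι] {n : ℕ} {S : Set (ι → ℝ)} {e : ι → ℤ}
    {P : MvPolynomial ι ℝ} (h : DiagValid n S e P) (Z : Finset ι)
    (hZ : ∀ i ∈ Z, ∀ x ∈ S, x i = 0) : (diag h).dim + Z.card ≤ Fintype.card ι := by
  classical
  suffices (diag h).dim ≤ (Zᶜ : Finset ι).card by
    rw [Finset.card_compl] at this
    have := Finset.card_le_univ Z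
    omega
  refine csSup_le' ?_
  rintro _ ⟨J, rfl, hJ⟩
  -- An index of `J` in `Z` would give a further projection to a line whose image has non-empty
  -- interior and yet is contained in `{0}`.
  have hsub : (show Finset ι from J) ⊆ Zᶜ := by
    intro i hi
    rw [Finset.mem_compl]
    intro hiZ
    have h1 := interior_range_of_comp (fun _ : Unit => (⟨i, hi⟩ : {i // i ∈ J}))
      (fun _ _ _ => rfl) (fun x : S => x) (g := fun x (_ : Unit) => x.1 i) (fun _ => rfl) hJ
    have h2 : (Set.range fun (x : S) (_ : Unit) => x.1 i) ⊆ {0} := by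
      rintro _ ⟨x, rfl⟩
      exact funext fun _ => hZ i hiZ x.1 x.2
    have h3 := h1.mono (interior_mono h2)
    have : (𝓝[≠] (0 : Unit → ℝ)).NeBot := Module.punctured_nhds_neBot ℝ (Unit → ℝ) 0
    rw [interior_singleton] at h3
    exact Set.not_nonempty_empty h3
  exact Finset.card_le_card hsub

open Classical in
/-- The first index of a non-zero entry of a tuple, or the length of the tuple if it is zero. -/
noncomputable def firstNonzero {q : ℕ} (u : Fin q → ℝ) : Fin (q + 1) :=
  {p : Fin (q + 1) | ∀ j : Fin q, (j : ℕ) < p → u j = 0}.toFinset.sup id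

/-- The supremum is attained, and the defining condition passes to smaller `p`. Inequalities `p ≤
firstNonzero u` are thus closed algebraic conditions, as stratifications require. -/
lemma le_firstNonzero_iff {q : ℕ} {u : Fin q → ℝ} {p : Fin (q + 1)} :
    p ≤ firstNonzero u ↔ ∀ j : Fin q, (j : ℕ) < p → u j = 0 := by
  classical
  constructor
  · intro hp
    have hne : {p : Fin (q + 1) | ∀ j : Fin q, (j : ℕ) < p → u j = 0}.toFinset.Nonempty :=
      ⟨0, by simp⟩
    obtain ⟨b, hb, hb'⟩ := Finset.exists_mem_eq_sup _ hne id
    rw [Set.mem_toFinset] at hb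
    rw [firstNonzero, hb'] at hp
    exact fun j hj => hb j (lt_of_lt_of_le hj hp)
  · intro h
    exact Finset.le_sup (f := id) (by rwa [Set.mem_toFinset])

lemma firstNonzero_eq_castSucc_iff {q : ℕ} {u : Fin q → ℝ} {i : Fin q} :
    firstNonzero u = i.castSucc ↔ (∀ j < i, u j = 0) ∧ u i ≠ 0 := by
  have h1 := le_firstNonzero_iff (u := u) (p := i.castSucc)
  have h2 := le_firstNonzero_iff (u := u) (p := i.succ)
  have h3 : firstNonzero u = i.castSucc ↔ i.castSucc ≤ firstNonzero u ∧ ¬ i.succ ≤ firstNonzero u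
      := by
    simp only [Fin.ext_iff, Fin.le_def, Fin.val_castSucc, Fin.val_succ]
    omega
  rw [h3, h1, h2]
  constructor
  · rintro ⟨h4, h5⟩
    refine ⟨fun j hj => h4 j hj, fun h6 => h5 fun j hj => ?_⟩
    rcases Nat.lt_succ_iff_lt_or_eq.1 hj with h | h
    · exact h4 j h
    · rwa [Fin.ext h]
  · rintro ⟨h4, h5⟩
    exact ⟨fun j hj => h4 j hj, fun h6 => h5 (h6 i (Nat.lt_succ_self _))⟩

lemma firstNonzero_eq_last_iff {q : ℕ} {u : Fin q → ℝ} :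
    firstNonzero u = Fin.last q ↔ ∀ j, u j = 0 := by
  rw [← Fin.last_le_iff, le_firstNonzero_iff]
  exact ⟨fun h j => h j j.2, fun h j _ => h j⟩

lemma firstNonzero_congr {q : ℕ} {u u' : Fin q → ℝ} (h : ∀ j, u j = 0 ↔ u' j = 0) :
    firstNonzero u = firstNonzero u' := by
  refine le_antisymm ?_ ?_
  · exact le_firstNonzero_iff.2 fun j hj => (h j).1 (le_firstNonzero_iff.1 le_rfl j hj)
  · exact le_firstNonzero_iff.2 fun j hj => (h j).2 (le_firstNonzero_iff.1 le_rfl j hj)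

lemma DiagValid.strata {ι P : Type} [Finite ι] [Fintype P] [PartialOrder P] {n : ℕ}
    {S : Set (ι → ℝ)} {e : ι → ℤ} {p : MvPolynomial ι ℝ} (h : DiagValid n S e p)
    (ord : (ι → ℝ) → P) (C : P → Set (ι → ℝ)) (hA : ∀ a, IsAS (C a))
    (hord : ∀ a x, a ≤ ord x ↔ x ∈ C a) (hinv : ∀ l x, ord (dact e l x) = ord x) (a : P) :
    DiagValid n (S ∩ ord ⁻¹' {a}) e p := by
  -- A stratum is a closed set minus finitely many smaller ones, so it is `AS`.
  have h3 : ord ⁻¹' {a} = C a ∩ ⋂ b : {b // a < b}, (C b.1)ᶜ := by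
    ext x
    simp only [Set.mem_inter_iff, Set.mem_iInter, Set.mem_compl_iff, Set.mem_preimage,
      Set.mem_singleton_iff, ← hord]
    constructor
    · rintro rfl
      exact ⟨le_rfl, fun b h => not_le_of_gt b.2 h⟩
    · rintro ⟨h4, h5⟩
      by_contra hne
      exact h5 ⟨_, lt_of_le_of_ne h4 (Ne.symm hne)⟩ le_rfl
  refine h.sub Set.inter_subset_left (h.isAS.inter ?_) fun l x hx => ⟨h.inv l x hx.1, ?_⟩
  · rw [h3]
    exact (hA a).inter (IsAS.iInter fun b => (hA b.1).compl)
  · rw [Set.mem_preimage, hinv]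
    exact hx.2

/-- Additivity for the stratification by the first polynomials of lists of polynomials that do not
vanish. -/
lemma dcls_firstNonzero {ι κ : Type} [Finite ι] [Finite κ] {q n : ℕ} {S : Set (ι → ℝ)}
    {e : ι → ℤ} {P : MvPolynomial ι ℝ} (h : DiagValid n S e P)
    (u : κ → Fin q → MvPolynomial ι ℝ)
    (hu : ∀ l : ℝˣ, ∀ x k j, MvPolynomial.eval (dact e l x) (u k j) = 0 ↔
      MvPolynomial.eval x (u k j) = 0) [Fintype (κ → Fin (q + 1))] :
    (∀ p : κ → Fin (q + 1), DiagValid n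
      (S ∩ (fun x k => firstNonzero fun j => MvPolynomial.eval x (u k j)) ⁻¹' {p}) e P) ∧
    dcls n S e P = ∑ p : κ → Fin (q + 1), dcls n
      (S ∩ (fun x k => firstNonzero fun j => MvPolynomial.eval x (u k j)) ⁻¹' {p}) e P := by
  -- For the product order on the tuples of first indices, the sets `p ≤ ord x` are given by the
  -- vanishing of finitely many of the polynomials.
  have hset : ∀ p : κ → Fin (q + 1), {x : ι → ℝ | ∀ r : {r : κ × Fin q // (r.2 : ℕ) < p r.1},
      MvPolynomial.eval x (u r.1.1 r.1.2) = MvPolynomial.eval x 0} =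
      {x | p ≤ fun k => firstNonzero fun j => MvPolynomial.eval x (u k j)} := by
    intro p
    ext x
    simp only [Set.mem_ofPred_eq, Pi.le_def, le_firstNonzero_iff, map_zero]
    exact ⟨fun h k j hj => h ⟨(k, j), hj⟩, fun h r => h r.1.1 r.1.2 r.2⟩
  have hA : ∀ p : κ → Fin (q + 1),
      IsAS {x | p ≤ fun k => firstNonzero fun j => MvPolynomial.eval x (u k j)} := fun p => by
    rw [← hset]
    exact isAS_forall_eval_eq _ _
  have hinv : ∀ (l : ℝˣ) (x : ι → ℝ),
      (fun k => firstNonzero fun j => MvPolynomial.eval (dact e l x) (u k j)) =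
        fun k => firstNonzero fun j => MvPolynomial.eval x (u k j) := fun l x =>
    funext fun k => firstNonzero_congr fun j => hu l x k j
  refine ⟨h.strata _ _ hA (fun p x => Iff.rfl) hinv,
    dcls_strata h _ _ (fun p => ?_) hA (fun p x => Iff.rfl) hinv⟩
  rw [← hset]
  simp only [Set.ofPred_forall]
  exact isClosed_iInter fun r =>
    isClosed_eq (MvPolynomial.continuous_eval _) (MvPolynomial.continuous_eval _)

/-! ### Jets of higher order -/

/-- The weights of the action of `ℝ^*` on jets. -/
def jetWeight (d N : ℕ) (p : Fin d × Fin (N + 1)) : ℤ := (p.2 : ℕ)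

lemma dact_eq_zero_iff {ι : Type} (e : ι → ℤ) (l : ℝˣ) (x : ι → ℝ) (i : ι) :
    dact e l x i = 0 ↔ x i = 0 := by
  rw [dact, mul_eq_zero_iff_left (Units.ne_zero _)]

lemma dact_jetWeight {d N : ℕ} (l : ℝˣ) (a : Fin d × Fin (N + 1) → ℝ) :
    dact (jetWeight d N) l a = scaleJet l a := by
  funext p
  simp [dact, jetWeight, scaleJet]

/-- The jets `γ` of order `N` with `γ(0) = 0` and `f(γ(t)) ≡ c t^n mod t^{n+1}`, `c ≠ 0`. -/
def jetSetN {d : ℕ} (f : MvPolynomial (Fin d) ℝ) (n N : ℕ) : Set (Fin d × Fin (N + 1) → ℝ) :=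
  {a | (∀ i, a (i, 0) = 0) ∧ (∀ j < n, (evalJet f a).coeff j = 0) ∧ (evalJet f a).coeff n ≠ 0}

lemma isAS_jetSetN {d : ℕ} (f : MvPolynomial (Fin d) ℝ) (n N : ℕ) : IsAS (jetSetN f n N) := by
  have h := (isAS_forall_eval_eq
      (fun i : Fin d => (MvPolynomial.X (i, 0) : MvPolynomial (Fin d × Fin (N + 1)) ℝ))
      fun _ => 0).inter
    ((isAS_forall_eval_eq (fun j : Fin n => jetCoeff N f j) fun _ => 0).inter
      (isAS_ne_zero (jetCoeff N f n)))
  convert h using 1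
  ext a
  simp only [jetSetN, Set.mem_ofPred_eq, Set.mem_inter_iff, MvPolynomial.eval_X, map_zero,
    eval_jetCoeff]
  refine and_congr_right fun _ => and_congr_left fun _ => ?_
  exact ⟨fun h j => h j j.2, fun h j hj => h ⟨j, hj⟩⟩

lemma coeff_evalJet_dact {d N : ℕ} (f : MvPolynomial (Fin d) ℝ) (l : ℝˣ)
    (a : Fin d × Fin (N + 1) → ℝ) (j : ℕ) :
    (evalJet f (dact (jetWeight d N) l a)).coeff j = (evalJet f a).coeff j * (l : ℝ) ^ j := by
  rw [dact_jetWeight, evalJet_scaleJet, Polynomial.comp_C_mul_X_coeff]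

lemma diagValid_jetSetN {d : ℕ} (f : MvPolynomial (Fin d) ℝ) (n N : ℕ) :
    DiagValid n (jetSetN f n N) (jetWeight d N) (jetCoeff N f n) where
  isAS := isAS_jetSetN f n N
  ne_zero a ha := by rw [eval_jetCoeff]; exact ha.2.2
  inv l a ha := by
    refine ⟨fun i => by simp [dact, ha.1 i], fun j hj => ?_, ?_⟩
    · rw [coeff_evalJet_dact, ha.2.1 j hj, zero_mul]
    · rw [coeff_evalJet_dact]
      exact mul_ne_zero ha.2.2 (pow_ne_zero _ l.ne_zero)
  hom l a _ := by rw [eval_jetCoeff, eval_jetCoeff, coeff_evalJet_dact, mul_comm]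

lemma cls_jets {d : ℕ} (f : MvPolynomial (Fin d) ℝ) (n : ℕ) :
    K0n.cls (jets f n) = dcls n (jetSetN f n n) (jetWeight d n) (jetCoeff n f n) := by
  refine cls_eq_dcls (diagValid_jetSetN f n n) (jets f n) id
    (IsPolyMap.isFracOn (fun j => ⟨MvPolynomial.X j, by simp⟩) _) (fun x => ⟨x.1, x.2⟩) ⟨?_, ?_⟩
    (fun _ => rfl) (fun l x => Subtype.ext (dact_jetWeight l x.1)) fun x => ?_
  · intro x y hxy
    exact Subtype.ext (congrArg Subtype.val hxy)
  · rintro ⟨x, hx⟩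
    exact ⟨⟨x, hx⟩, rfl⟩
  · rw [eval_jetCoeff]
    rfl

lemma coeff_aeval_congr {d n : ℕ} (f : MvPolynomial (Fin d) ℝ) {γ γ' : Fin d → Polynomial ℝ}
    (h : ∀ i, ∀ j ≤ n, (γ i).coeff j = (γ' i).coeff j) :
    ∀ j ≤ n, (MvPolynomial.aeval γ f).coeff j = (MvPolynomial.aeval γ' f).coeff j := by
  induction f using MvPolynomial.induction_on with
  | C a => simp
  | add p q hp hq =>
    intro j hj
    rw [map_add, map_add, Polynomial.coeff_add, Polynomial.coeff_add, hp j hj, hq j hj]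
  | mul_X p i hp =>
    intro j hj
    rw [map_mul, map_mul, MvPolynomial.aeval_X, MvPolynomial.aeval_X, Polynomial.coeff_mul,
      Polynomial.coeff_mul]
    refine Finset.sum_congr rfl fun x hx => ?_
    rw [Finset.HasAntidiagonal.mem_antidiagonal] at hx
    rw [hp _ (by omega), h i _ (by omega)]

/-- The coordinates of the jets of order `N` which are not coordinates of their truncations. -/
abbrev JetTail (d n N : ℕ) : Type := {p : Fin d × Fin (N + 1) // n < (p.2 : ℕ)}

/-- The splitting of the coordinates of a jet of order `N`. -/
def jetSplit (d : ℕ) {n N : ℕ} (h : n ≤ N) :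
    (Fin d × Fin (n + 1)) ⊕ JetTail d n N ≃ Fin d × Fin (N + 1) where
  toFun := Sum.elim (fun p => (p.1, p.2.castLE (by omega))) Subtype.val
  invFun p := if h : n < (p.2 : ℕ) then Sum.inr ⟨p, h⟩ else Sum.inl (p.1, ⟨p.2, by omega⟩)
  left_inv := by
    rintro (⟨i, j⟩ | ⟨⟨i, j⟩, hj⟩)
    · have : ¬ n < (j : ℕ) := by omega
      simp [this]
    · have hj : n < (j : ℕ) := hj
      simp [hj]
  right_inv := by
    rintro ⟨i, j⟩
    by_cases hj : n < (j : ℕ) <;> simp [hj]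

lemma card_jetTail (d : ℕ) {n N : ℕ} (h : n ≤ N) :
    Nat.card (JetTail d n N) = d * (N - n) := by
  have h1 := Nat.card_congr (jetSplit d h)
  rw [Nat.card_sum, Nat.card_prod, Nat.card_prod, Nat.card_fin, Nat.card_fin, Nat.card_fin] at h1
  obtain ⟨c, rfl⟩ := Nat.exists_eq_add_of_le h
  rw [Nat.add_sub_cancel_left]
  nlinarith

/-- The classes of the arcs at two levels of truncation. -/
lemma dcls_jetSetN {d : ℕ} (f : MvPolynomial (Fin d) ℝ) {n N : ℕ} (h : n ≤ N) :
    dcls n (jetSetN f n N) (jetWeight d N) (jetCoeff N f n) =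
      dcls n (jetSetN f n n) (jetWeight d n) (jetCoeff n f n) * affLine n ^ (d * (N - n)) := by
  rw [← card_jetTail d h, ← dcls_lift (diagValid_jetSetN f n n)
    fun p : JetTail d n N => jetWeight d N p.1]
  have hw : (Sum.elim (jetWeight d n) fun p : JetTail d n N => jetWeight d N p.1) =
      jetWeight d N ∘ jetSplit d h := by
    funext p
    rcases p with p | p <;> rfl
  -- The coefficients of `f(γ)` up to order `n` depend only on the truncation of `γ`, so the jets of
  -- order `N` form a cylinder with `d (N - n)` free coordinates.
  have hc : ∀ a : Fin d × Fin (N + 1) → ℝ, ∀ j ≤ n, (evalJet f a).coeff j =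
      (evalJet f ((a ∘ jetSplit d h) ∘ Sum.inl)).coeff j := by
    intro a
    refine coeff_aeval_congr f fun i j hj => ?_
    rw [coeff_jetArc, coeff_jetArc, dif_pos (by omega), dif_pos (by omega)]
    rfl
  have hv := (diagValid_jetSetN f n n).lift fun p : JetTail d n N => jetWeight d N p.1
  rw [hw] at hv ⊢
  refine dcls_reindex (jetSplit d h) (diagValid_jetSetN f n N) hv (fun a => ?_) fun a _ => ?_
  · refine and_congr (forall_congr' fun i => Iff.rfl) (and_congr (forall₂_congr fun j hj => ?_) ?_)
    · rw [hc a j hj.le]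
    · rw [hc a n le_rfl]
  · rw [MvPolynomial.eval_rename, eval_jetCoeff, eval_jetCoeff, hc a n le_rfl]

/-- The jets whose components have the orders `k i`. -/
def jetStratum {d : ℕ} (f : MvPolynomial (Fin d) ℝ) (n N : ℕ) (k : Fin d → Fin (N + 1 + 1)) :
    Set (Fin d × Fin (N + 1) → ℝ) :=
  jetSetN f n N ∩ {a | (fun i => firstNonzero fun j => a (i, j)) = k}

lemma dcls_jetSetN_eq_sum {d : ℕ} (f : MvPolynomial (Fin d) ℝ) (n N : ℕ) :
    (∀ k, DiagValid n (jetStratum f n N k) (jetWeight d N) (jetCoeff N f n)) ∧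
    dcls n (jetSetN f n N) (jetWeight d N) (jetCoeff N f n) =
      ∑ k, dcls n (jetStratum f n N k) (jetWeight d N) (jetCoeff N f n) := by
  have h := dcls_firstNonzero (diagValid_jetSetN f n N)
    (fun i j => (MvPolynomial.X (i, j) : MvPolynomial (Fin d × Fin (N + 1)) ℝ)) fun l a i j => by
      rw [MvPolynomial.eval_X, MvPolynomial.eval_X, dact_eq_zero_iff]
  simp only [MvPolynomial.eval_X] at h
  exact h

lemma diagValid_jetStratum {d : ℕ} (f : MvPolynomial (Fin d) ℝ) (n N : ℕ)
    (k : Fin d → Fin (N + 1 + 1)) :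
    DiagValid n (jetStratum f n N k) (jetWeight d N) (jetCoeff N f n) :=
  (dcls_jetSetN_eq_sum f n N).1 k

/-- Restricting to `k i ≤ N` leaves out the value `N + 1` of `firstNonzero`, which means that the
component vanishes as a jet and has no leading coefficient. -/
lemma mem_jetStratum_iff {d : ℕ} {f : MvPolynomial (Fin d) ℝ} {n N : ℕ} {k : Fin d → ℕ}
    (hk : ∀ i, k i ≤ N) {a : Fin d × Fin (N + 1) → ℝ} :
    a ∈ jetStratum f n N (fun i => ⟨k i, by have := hk i; omega⟩) ↔ a ∈ jetSetN f n N ∧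
      ∀ i, (∀ j < k i, (jetArc a i).coeff j = 0) ∧ (jetArc a i).coeff (k i) ≠ 0 := by
  refine and_congr_right fun _ => ?_
  rw [Set.mem_ofPred_eq, funext_iff]
  refine forall_congr' fun i => ?_
  have h1 : k i < N + 1 := by have := hk i; omega
  rw [show (⟨k i, by omega⟩ : Fin (N + 1 + 1)) = (⟨k i, h1⟩ : Fin (N + 1)).castSucc from rfl,
    firstNonzero_eq_castSucc_iff, coeff_jetArc, dif_pos h1]
  refine and_congr_left fun _ => ⟨fun h j hj => ?_, fun h j hj => ?_⟩
  · rw [coeff_jetArc, dif_pos (by omega)]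
    exact h _ hj
  · rw [← coeff_jetArc_of_lt a i j]
    exact h _ hj

/-- A stratum where some component has order `0` is empty. -/
lemma jetStratum_eq_empty_of_zero {d : ℕ} (f : MvPolynomial (Fin d) ℝ) (n N : ℕ)
    {k : Fin d → Fin (N + 1 + 1)} {i : Fin d} (hi : k i = 0) : jetStratum f n N k = ∅ := by
  rw [Set.eq_empty_iff_forall_notMem]
  rintro a ⟨ha, hk⟩
  have h1 : (0 : Fin (N + 1)).castSucc = firstNonzero fun j => a (i, j) := by
    rw [← hk] at hi
    exact hi.symm
  exact (firstNonzero_eq_castSucc_iff.1 h1.symm).2 (ha.1 i)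

/-- A stratum where some component vanishes has small dimension. -/
lemma dim_jetStratum_of_last {d : ℕ} (f : MvPolynomial (Fin d) ℝ) (n N : ℕ)
    {k : Fin d → Fin (N + 1 + 1)} {i : Fin d} (hi : k i = Fin.last _) :
    (diag (diagValid_jetStratum f n N k)).dim + N ≤ d * N := by
  classical
  -- The vanishing coordinates are the `d` constant terms and the `N + 1` coefficients of the
  -- component `i`, with one in common: `d + N` out of `d (N + 1)`.
  have h := dim_diag_add_card_le (diagValid_jetStratum f n N k)
    ((Finset.univ.filter fun p : Fin d × Fin (N + 1) => p.2 = 0) ∪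
      (Finset.univ.filter fun p : Fin d × Fin (N + 1) => p.1 = i)) fun p hp a ha => ?_
  · have h1 : (Finset.univ.filter fun p : Fin d × Fin (N + 1) => p.2 = 0).card = d := by
      have : (Finset.univ.filter fun p : Fin d × Fin (N + 1) => p.2 = 0) =
          Finset.univ ×ˢ {0} := by ext ⟨p1, p2⟩; simp [eq_comm]
      rw [this, Finset.card_product]
      simp
    have h2 : (Finset.univ.filter fun p : Fin d × Fin (N + 1) => p.1 = i).card = N + 1 := by
      have : (Finset.univ.filter fun p : Fin d × Fin (N + 1) => p.1 = i) =
          {i} ×ˢ Finset.univ := by ext ⟨p1, p2⟩; simp [eq_comm]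
      rw [this, Finset.card_product]
      simp
    have h3 : ((Finset.univ.filter fun p : Fin d × Fin (N + 1) => p.2 = 0) ∩
        (Finset.univ.filter fun p : Fin d × Fin (N + 1) => p.1 = i)).card = 1 := by
      rw [Finset.card_eq_one]
      exact ⟨(i, 0), by ext p; simp [Prod.ext_iff, and_comm]⟩
    have h4 := Finset.card_union_add_card_inter
      (Finset.univ.filter fun p : Fin d × Fin (N + 1) => p.2 = 0)
      (Finset.univ.filter fun p : Fin d × Fin (N + 1) => p.1 = i)
    rw [h1, h2, h3] at h4
    rw [Fintype.card_prod, Fintype.card_fin, Fintype.card_fin, mul_add, mul_one] at h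
    omega
  · simp only [Finset.mem_union, Finset.mem_filter, Finset.mem_univ, true_and] at hp
    obtain ⟨p1, p2⟩ := p
    rcases hp with hp | hp
    · have hp : p2 = 0 := hp
      rw [hp]
      exact ha.1.1 p1
    · have hp : p1 = i := hp
      have h1 : (firstNonzero fun j => a (i, j)) = Fin.last _ := by
        rw [← hi]
        exact congrFun ha.2 i
      rw [hp]
      exact firstNonzero_eq_last_iff.1 h1 p2

/-! ### The class of the jets with components of given orders -/

lemma initialForm_homogeneous {d : ℕ} (f : MvPolynomial (Fin d) ℝ) (k : Fin d → ℕ) (m : ℕ) :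
    MvPolynomial.IsWeightedHomogeneous k (initialForm f k m) m := by
  refine MvPolynomial.IsWeightedHomogeneous.sum _ _ _ fun ν hν => ?_
  refine MvPolynomial.isWeightedHomogeneous_monomial _ _ _ ?_
  rw [Finsupp.weight_apply, Finsupp.sum_fintype _ _ (by simp), ← (Finset.mem_filter.1 hν).2]
  exact Finset.sum_congr rfl fun i _ => by rw [smul_eq_mul, mul_comm]

/-- The coordinates of a jet beyond its leading coefficients. -/
abbrev JetRest {d : ℕ} (N : ℕ) (k : Fin d → ℕ) : Type :=
  {p : Fin d × Fin (N + 1) // k p.1 < (p.2 : ℕ)}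

/-- The component `i` has `N - k i` coefficients after the leading one. This is the origin of the
factor `𝕃^{-∑ k_i}`. -/
lemma card_jetRest {d N : ℕ} {k : Fin d → ℕ} (hk : ∀ i, k i ≤ N) :
    Nat.card (JetRest N k) + ∑ i, k i = d * N := by
  classical
  have h1 : Nat.card (JetRest N k) = ∑ i, (N - k i) := by
    let e : JetRest N k ≃ Σ i, Fin (N - k i) :=
      { toFun := fun p => ⟨p.1.1, ⟨p.1.2 - k p.1.1 - 1, by have := p.2; omega⟩⟩
        invFun := fun q => ⟨(q.1, ⟨q.2 + k q.1 + 1, by omega⟩), by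
          show k q.1 < q.2 + k q.1 + 1
          omega⟩
        left_inv := by
          rintro ⟨⟨i, j⟩, hj⟩
          have hj : k i < (j : ℕ) := hj
          refine Subtype.ext (Prod.ext rfl (Fin.ext ?_))
          show (j : ℕ) - k i - 1 + k i + 1 = j
          omega
        right_inv := by
          rintro ⟨i, j⟩
          refine Sigma.ext rfl (heq_of_eq (Fin.ext ?_))
          show (j : ℕ) + k i + 1 - k i - 1 = j
          omega }
    rw [Nat.card_congr e, Nat.card_eq_fintype_card, Fintype.card_sigma]
    simp
  rw [h1, ← Finset.sum_add_distrib]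
  rw [Finset.sum_congr rfl fun i _ => Nat.sub_add_cancel (hk i)]
  simp

section

variable {d : ℕ} {f : MvPolynomial (Fin d) ℝ} {n N : ℕ} {k : Fin d → ℕ}

/-- If all monomials of `f` have weight `> n`, then the stratum of order `k` is empty. -/
lemma jetStratum_eq_empty (hk : ∀ i, k i ≤ N) (hm : ∀ ν ∈ f.support, n < ∑ i, k i * ν i) :
    jetStratum f n N (fun i => ⟨k i, by have := hk i; omega⟩) = ∅ := by
  rw [Set.eq_empty_iff_forall_notMem]
  intro a ha
  obtain ⟨h1, h2⟩ := (mem_jetStratum_iff hk).1 ha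
  exact h1.2.2 (coeff_aeval_lt (m := n + 1) hm (fun i => (h2 i).1) (Nat.lt_succ_self n))

lemma coeff_jetArc_le {N : ℕ} (a : Fin d × Fin (N + 1) → ℝ) (i : Fin d) {j : ℕ} (hj : j ≤ N) :
    (jetArc a i).coeff j = a (i, ⟨j, Nat.lt_succ_of_le hj⟩) := by
  rw [coeff_jetArc, dif_pos (Nat.lt_succ_of_le hj)]

lemma coeff_jetArc_gt {N : ℕ} (a : Fin d × Fin (N + 1) → ℝ) (i : Fin d) {j : ℕ} (hj : N < j) :
    (jetArc a i).coeff j = 0 := by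
  rw [coeff_jetArc, dif_neg (by omega)]

/-- The class of a stratum on which the leading coefficient of `f(γ(t))` has order `n`. -/
lemma dcls_jetStratum_of_eq (hk : ∀ i, k i ≤ N) (hk0 : ∀ i, 0 < k i)
    (hm : ∀ ν ∈ f.support, n ≤ ∑ i, k i * ν i) :
    dcls n (jetStratum f n N (fun i => ⟨k i, by have := hk i; omega⟩)) (jetWeight d N)
        (jetCoeff N f n) =
      dcls n (torusComplSet (initialForm f k n)) (fun i => (k i : ℤ)) (initialForm f k n) *
        affLine n ^ Nat.card (JetRest N k) := by
  have hT := diagValid_torusCompl (initialForm_homogeneous f k n)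
  rw [← dcls_lift hT fun p : JetRest N k => jetWeight d N p.1]
  -- A jet is sent to its leading coefficients and the ones that follow. The coefficients of `f(γ)`
  -- before order `n` vanish automatically, and that of order `n` is the initial form at the leading
  -- coefficients; the later coefficients of the jet are free.
  refine dcls_bij (diagValid_jetStratum f n N _) (hT.lift _)
    (fun a => Sum.elim (fun i => a (i, ⟨k i, Nat.lt_succ_of_le (hk i)⟩)) fun p => a p.1)
    (IsPolyMap.isFracOn ?_ _) ⟨?_, ?_, ?_⟩ ?_ ?_
  · rintro (i | p)
    · exact ⟨MvPolynomial.X (i, ⟨k i, Nat.lt_succ_of_le (hk i)⟩), fun a => by simp⟩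
    · exact ⟨MvPolynomial.X p.1, fun a => by simp⟩
  · intro a ha
    obtain ⟨h1, h2⟩ := (mem_jetStratum_iff hk).1 ha
    have h3 := coeff_aeval_eq hm (fun i => (h2 i).1)
    simp only [coeff_jetArc_le _ _ (hk _)] at h2 h3
    exact ⟨fun i => (h2 i).2, fun h => h1.2.2 (h3.trans h)⟩
  · intro a ha a' ha' haa
    obtain ⟨-, h2⟩ := (mem_jetStratum_iff hk).1 ha
    obtain ⟨-, h2'⟩ := (mem_jetStratum_iff hk).1 ha'
    funext ⟨i, j⟩
    rcases lt_trichotomy (j : ℕ) (k i) with hj | hj | hj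
    · rw [← coeff_jetArc_of_lt a, ← coeff_jetArc_of_lt a', (h2 i).1 j hj, (h2' i).1 j hj]
    · have := congrFun haa (Sum.inl i)
      have hj' : j = ⟨k i, Nat.lt_succ_of_le (hk i)⟩ := Fin.ext hj
      rw [hj']
      exact this
    · exact congrFun haa (Sum.inr ⟨(i, j), hj⟩)
  · intro z hz
    let a : Fin d × Fin (N + 1) → ℝ := fun p => if h : k p.1 < (p.2 : ℕ) then z (Sum.inr ⟨p, h⟩)
      else if (p.2 : ℕ) = k p.1 then z (Sum.inl p.1) else 0
    have ha0 : ∀ i, ∀ j < k i, (jetArc a i).coeff j = 0 := fun i j hj => by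
      have h1 : ¬ k i < j := by omega
      have h2 : ¬ j = k i := by omega
      have := hk i
      rw [coeff_jetArc_le a i (by omega)]
      simp [a, h1, h2]
    have ha1 : ∀ i, (jetArc a i).coeff (k i) = z (Sum.inl i) := fun i => by
      rw [coeff_jetArc_le a i (hk i)]
      simp [a]
    have hc := coeff_aeval_eq hm ha0
    simp only [ha1] at hc
    refine ⟨a, (mem_jetStratum_iff hk).2 ⟨⟨fun i => ?_, fun j hj => ?_, ?_⟩, fun i =>
      ⟨ha0 i, by rw [ha1]; exact hz.1 i⟩⟩, funext ?_⟩
    · rw [← coeff_jetArc_of_lt a i 0]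
      exact ha0 i _ (hk0 i)
    · exact coeff_aeval_lt hm ha0 hj
    · rw [evalJet, hc]
      exact hz.2
    · rintro (i | p)
      · exact (coeff_jetArc_le a i (hk i)).symm.trans (ha1 i)
      · exact dif_pos p.2
  · intro l a _
    funext r
    rcases r with i | p <;> rfl
  · intro a ha
    obtain ⟨-, h2⟩ := (mem_jetStratum_iff hk).1 ha
    have h3 := coeff_aeval_eq hm (fun i => (h2 i).1)
    simp only [coeff_jetArc_le _ _ (hk _)] at h3
    rw [MvPolynomial.eval_rename, eval_jetCoeff]
    exact h3.symm

end

/-! ### Strata of jets on which the initial form vanishes -/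

/-- The monomials of `∂_i g` have weight `m - k i`, an integer in order not to separate the case `m
< k i`. The vanishing of a partial derivative is therefore an invariant condition. -/
lemma eval_pderiv_dact {d : ℕ} {g : MvPolynomial (Fin d) ℝ} {k : Fin d → ℕ} {m : ℕ}
    (h : MvPolynomial.IsWeightedHomogeneous k g m) (i : Fin d) (l : ℝˣ) (x : Fin d → ℝ) :
    MvPolynomial.eval (dact (fun i => (k i : ℤ)) l x) (MvPolynomial.pderiv i g) =
      (l : ℝ) ^ ((m : ℤ) - k i) * MvPolynomial.eval x (MvPolynomial.pderiv i g) := by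
  classical
  refine eval_dact (fun ν hν => ?_) l x
  rw [MvPolynomial.mem_support_iff, MvPolynomial.coeff_pderiv] at hν
  have h1 := weighted_sum_eq_int h (MvPolynomial.mem_support_iff.2 (left_ne_zero_of_mul hν))
  simp only [Finsupp.add_apply, Nat.cast_add, mul_add, Finset.sum_add_distrib,
    Finsupp.single_apply] at h1
  simp at h1
  omega

/-- A monomial containing `x_i` has weight at least `k i`. Hence a non-zero partial derivative
forces `k i ≤ m`, which leaves room in jets of order `N ≥ n` for the `n - m` coefficients of the
component `i` to be solved for. -/
lemma pderiv_eq_zero_of_lt {d : ℕ} {g : MvPolynomial (Fin d) ℝ} {k : Fin d → ℕ} {m : ℕ}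
    (h : MvPolynomial.IsWeightedHomogeneous k g m) {i : Fin d} (hi : m < k i) :
    MvPolynomial.pderiv i g = 0 := by
  classical
  ext ν
  rw [MvPolynomial.coeff_zero]
  by_contra hν
  rw [MvPolynomial.coeff_pderiv] at hν
  have h1 := weighted_sum_eq h (MvPolynomial.mem_support_iff.2 (left_ne_zero_of_mul hν))
  simp only [Finsupp.add_apply, mul_add, Finset.sum_add_distrib, Finsupp.single_apply] at h1
  simp at h1
  omega

/-- The points at which the first non-zero partial derivative of `g` has index `p`. -/
def pivotSet {d : ℕ} (g : MvPolynomial (Fin d) ℝ) (p : Fin (d + 1)) : Set (Fin d → ℝ) :=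
  {x | firstNonzero (fun i => MvPolynomial.eval x (MvPolynomial.pderiv i g)) = p}

/-- The coordinates of a jet beyond its leading coefficients, except for the `q` coefficients of
the component `i` which follow the leading one. -/
abbrev JetRestPivot {d : ℕ} (N : ℕ) (k : Fin d → ℕ) (i : Fin d) (q : ℕ) : Type :=
  {p : Fin d × Fin (N + 1) // k p.1 < (p.2 : ℕ) ∧ ¬ (p.1 = i ∧ (p.2 : ℕ) ≤ k i + q)}

lemma card_jetRestPivot {d N : ℕ} {k : Fin d → ℕ} {i : Fin d} {q : ℕ} (h : k i + q ≤ N) :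
    Nat.card (JetRestPivot N k i q) + q = Nat.card (JetRest N k) := by
  let e : JetRestPivot N k i q ⊕ Fin q ≃ JetRest N k :=
    { toFun := Sum.elim (fun p => ⟨p.1, p.2.1⟩) fun l => ⟨(i, ⟨k i + l + 1, by omega⟩), by
        show k i < k i + l + 1
        omega⟩
      invFun := fun p => if h : p.1.1 = i ∧ (p.1.2 : ℕ) ≤ k i + q then
          Sum.inr ⟨p.1.2 - k i - 1, by
            have h1 := p.2
            rw [h.1] at h1
            omega⟩
        else Sum.inl ⟨p.1, p.2, h⟩
      left_inv := by
        rintro (⟨p, hp⟩ | l)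
        · simp [hp.2]
        · have h1 : k i + (l : ℕ) + 1 ≤ k i + q := by omega
          have h2 : k i + (l : ℕ) + 1 - k i - 1 = l := by omega
          simp [h1, h2]
      right_inv := by
        rintro ⟨⟨i', j⟩, hp⟩
        have hp : k i' < (j : ℕ) := hp
        by_cases h1 : i' = i ∧ (j : ℕ) ≤ k i + q
        · obtain ⟨rfl, h1⟩ := h1
          have h2 : k i' + ((j : ℕ) - k i' - 1) + 1 = j := by omega
          simp [h1, h2]
        · simp [h1] }
  rw [← Nat.card_congr e, Nat.card_sum, Nat.card_fin]

section

variable {d : ℕ} {f : MvPolynomial (Fin d) ℝ} {n N m : ℕ} {k : Fin d → ℕ}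

/-- The leading coefficients of a jet. -/
def jetLead (hk : ∀ i, k i ≤ N) (a : Fin d × Fin (N + 1) → ℝ) (i : Fin d) : ℝ :=
  a (i, ⟨k i, Nat.lt_succ_of_le (hk i)⟩)

lemma coeff_jetArc_lead (hk : ∀ i, k i ≤ N) (a : Fin d × Fin (N + 1) → ℝ) :
    (fun i => (jetArc a i).coeff (k i)) = jetLead hk a :=
  funext fun i => coeff_jetArc_le a i (hk i)

/-- The target of the trivialization of a stratum. -/
def jetTarget {d : ℕ} (g : MvPolynomial (Fin d) ℝ) : Set (Fin d ⊕ Unit → ℝ) :=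
  {z | z ∘ Sum.inl ∈ torusZeroSet g ∧ z (Sum.inr ()) ≠ 0}

/-- The target and the stratum (in `dcls_jetStratum_eq_sum`) are cut by the same condition on the
leading coefficients, so that they can be compared separately for each index of a non-zero partial
derivative. -/
lemma dcls_jetTarget_eq_sum {g : MvPolynomial (Fin d) ℝ} (n : ℕ)
    (h : MvPolynomial.IsWeightedHomogeneous k g m) :
    (∀ p, DiagValid n (jetTarget g ∩ {z | z ∘ Sum.inl ∈ pivotSet g p})
      (Sum.elim (fun i => (k i : ℤ)) fun _ => n) (MvPolynomial.X (Sum.inr ()))) ∧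
    dcls n (jetTarget g) (Sum.elim (fun i => (k i : ℤ)) fun _ => n)
      (MvPolynomial.X (Sum.inr ())) = ∑ p, dcls n (jetTarget g ∩ {z | z ∘ Sum.inl ∈ pivotSet g p})
      (Sum.elim (fun i => (k i : ℤ)) fun _ => n) (MvPolynomial.X (Sum.inr ())) := by
  have h1 := dcls_firstNonzero (diagValid_torusZero n h)
    (fun (_ : Unit) i => MvPolynomial.rename Sum.inl (MvPolynomial.pderiv i g)) fun l z _ i => by
      rw [MvPolynomial.eval_rename, MvPolynomial.eval_rename, dact_comp_inl, eval_pderiv_dact h,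
        mul_eq_zero_iff_left (zpow_ne_zero _ l.ne_zero)]
  simp only [MvPolynomial.eval_rename] at h1
  have hset : ∀ p : Unit → Fin (d + 1), ((fun (z : Fin d ⊕ Unit → ℝ) (_ : Unit) =>
      firstNonzero fun i => MvPolynomial.eval (z ∘ Sum.inl) (MvPolynomial.pderiv i g)) ⁻¹' {p}) =
      {z | z ∘ Sum.inl ∈ pivotSet g (p ())} := fun p => by
    ext z
    exact ⟨fun hz => congrFun hz (), fun hz => funext fun _ => hz⟩
  simp only [hset] at h1
  refine ⟨fun p => h1.1 fun _ => p, h1.2.trans ?_⟩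
  exact Fintype.sum_equiv (Equiv.funUnique Unit _) _ _ fun p => rfl

lemma dcls_jetStratum_eq_sum (hk : ∀ i, k i ≤ N) {g : MvPolynomial (Fin d) ℝ}
    (h : MvPolynomial.IsWeightedHomogeneous k g m) (K : Fin d → Fin (N + 1 + 1)) :
    (∀ p, DiagValid n (jetStratum f n N K ∩ {a | jetLead hk a ∈ pivotSet g p})
      (jetWeight d N) (jetCoeff N f n)) ∧
    dcls n (jetStratum f n N K) (jetWeight d N) (jetCoeff N f n) =
      ∑ p, dcls n (jetStratum f n N K ∩ {a | jetLead hk a ∈ pivotSet g p})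
        (jetWeight d N) (jetCoeff N f n) := by
  let r : Fin d → Fin d × Fin (N + 1) := fun i => (i, ⟨k i, Nat.lt_succ_of_le (hk i)⟩)
  have h1 := dcls_firstNonzero (diagValid_jetStratum f n N K)
    (fun (_ : Unit) i => MvPolynomial.rename r (MvPolynomial.pderiv i g)) fun l a _ i => by
      rw [MvPolynomial.eval_rename, MvPolynomial.eval_rename,
        show dact (jetWeight d N) l a ∘ r = dact (fun i => (k i : ℤ)) l (a ∘ r) from rfl,
        eval_pderiv_dact h, mul_eq_zero_iff_left (zpow_ne_zero _ l.ne_zero)]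
  simp only [MvPolynomial.eval_rename] at h1
  have hset : ∀ p : Unit → Fin (d + 1), ((fun (a : Fin d × Fin (N + 1) → ℝ) (_ : Unit) =>
      firstNonzero fun i => MvPolynomial.eval (a ∘ r) (MvPolynomial.pderiv i g)) ⁻¹' {p}) =
      {a | jetLead hk a ∈ pivotSet g (p ())} := fun p => by
    ext z
    exact ⟨fun hz => congrFun hz (), fun hz => funext fun _ => hz⟩
  simp only [hset] at h1
  refine ⟨fun p => h1.1 fun _ => p, h1.2.trans ?_⟩
  exact Fintype.sum_equiv (Equiv.funUnique Unit _) _ _ fun p => rfl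

/-- On jets with the same coefficients before the order `k + l`, which differ at order `k + l` in
the component `i` only, the coefficient of `f(γ(t))` of order `m + l` is affine. -/
lemma coeff_evalJet_sub (hk : ∀ i, k i ≤ N) (hm : ∀ ν ∈ f.support, m ≤ ∑ i, k i * ν i)
    {a a' : Fin d × Fin (N + 1) → ℝ} (h : ∀ i, ∀ j < k i, (jetArc a i).coeff j = 0) {l : ℕ}
    (hl : 0 < l) (ha : ∀ i, ∀ j < k i + l, (jetArc a i).coeff j = (jetArc a' i).coeff j)
    {i : Fin d} (hi : ∀ i' ≠ i, (jetArc a i').coeff (k i' + l) = (jetArc a' i').coeff (k i' + l)) :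
    (evalJet f a).coeff (m + l) - (evalJet f a').coeff (m + l) =
      MvPolynomial.eval (jetLead hk a) (MvPolynomial.pderiv i (initialForm f k m)) *
        ((jetArc a i).coeff (k i + l) - (jetArc a' i).coeff (k i + l)) := by
  rw [evalJet, evalJet, coeff_aeval_sub hm h hl ha, coeff_jetArc_lead hk,
    Finset.sum_eq_single i]
  · intro i' _ hi'
    rw [hi i' hi', sub_self, mul_zero]
  · simp

/-- The trivialization of the part of a stratum on which the partial derivative of the initial form
with index `i` does not vanish. -/
lemma dcls_jetStratum_pivot (hk : ∀ i, k i ≤ N) (hk0 : ∀ i, 0 < k i)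
    (hm : ∀ ν ∈ f.support, m ≤ ∑ i, k i * ν i) {q : ℕ} (hn : n = m + (q + 1)) {i₀ : Fin d}
    (hi₀ : k i₀ + (q + 1) ≤ N) :
    dcls n (jetStratum f n N (fun i => ⟨k i, by have := hk i; omega⟩) ∩
        {a | jetLead hk a ∈ pivotSet (initialForm f k m) i₀.castSucc})
        (jetWeight d N) (jetCoeff N f n) =
      dcls n (jetTarget (initialForm f k m) ∩
        {z | z ∘ Sum.inl ∈ pivotSet (initialForm f k m) i₀.castSucc})
        (Sum.elim (fun i => (k i : ℤ)) fun _ => n) (MvPolynomial.X (Sum.inr ())) *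
        affLine n ^ Nat.card (JetRestPivot N k i₀ (q + 1)) := by
  set g := initialForm f k m with hg
  have hhom := initialForm_homogeneous f k m
  have hW := (dcls_jetTarget_eq_sum n hhom).1 i₀.castSucc
  rw [← dcls_lift hW fun p : JetRestPivot N k i₀ (q + 1) => jetWeight d N p.1]
  have hpiv : ∀ {x : Fin d → ℝ}, x ∈ pivotSet g i₀.castSucc →
      MvPolynomial.eval x (MvPolynomial.pderiv i₀ g) ≠ 0 := fun hx =>
    (firstNonzero_eq_castSucc_iff.1 hx).2
  -- The coordinates kept are the leading coefficients, the angular component of `f(γ)` and all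
  -- later coefficients except the `q + 1` of the component `i₀` that follow its leading one. Those
  -- are determined by the equations on `f(γ)` at the orders `m + 1, ..., n`.
  refine dcls_bij ((dcls_jetStratum_eq_sum hk hhom _).1 _) (hW.lift _)
    (fun a => Sum.elim (Sum.elim (jetLead hk a) fun _ => (evalJet f a).coeff n) fun p => a p.1)
    (IsPolyMap.isFracOn ?_ _) ⟨?_, ?_, ?_⟩ ?_ ?_
  · rintro ((i | _) | p)
    · exact ⟨MvPolynomial.X (i, ⟨k i, Nat.lt_succ_of_le (hk i)⟩), fun a => by
        rw [MvPolynomial.eval_X]; rfl⟩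
    · exact ⟨jetCoeff N f n, fun a => by rw [eval_jetCoeff]; rfl⟩
    · exact ⟨MvPolynomial.X p.1, fun a => by rw [MvPolynomial.eval_X]; rfl⟩
  · rintro a ⟨ha, hap⟩
    obtain ⟨h1, h2⟩ := (mem_jetStratum_iff hk).1 ha
    have h3 := coeff_aeval_eq hm (fun i => (h2 i).1)
    rw [coeff_jetArc_lead hk] at h3
    refine ⟨⟨⟨fun i => ?_, ?_⟩, h1.2.2⟩, hap⟩
    · have := (h2 i).2
      rwa [coeff_jetArc_le a i (hk i)] at this
    · exact h3.symm.trans (h1.2.1 m (by omega))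
  · rintro a ⟨ha, hap⟩ a' ⟨ha', hap'⟩ haa
    obtain ⟨h1, h2⟩ := (mem_jetStratum_iff hk).1 ha
    obtain ⟨h1', h2'⟩ := (mem_jetStratum_iff hk).1 ha'
    have hlead : jetLead hk a = jetLead hk a' :=
      funext fun i => congrFun haa (Sum.inl (Sum.inl i))
    have hlast : (evalJet f a).coeff n = (evalJet f a').coeff n :=
      congrFun haa (Sum.inl (Sum.inr ()))
    have hrest : ∀ i j, k i < j → ¬ (i = i₀ ∧ j ≤ k i₀ + (q + 1)) →
        (jetArc a i).coeff j = (jetArc a' i).coeff j := by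
      intro i j hj hne
      by_cases hjN : j ≤ N
      · rw [coeff_jetArc_le a i hjN, coeff_jetArc_le a' i hjN]
        exact congrFun haa (Sum.inr ⟨(i, ⟨j, Nat.lt_succ_of_le hjN⟩), hj, hne⟩)
      · rw [coeff_jetArc_gt a i (by omega), coeff_jetArc_gt a' i (by omega)]
    -- Injectivity, by induction on the distance to the leading order. The omitted coefficient at
    -- distance `l + 1` is determined because `f(γ)` and `f(γ')` agree at order `m + l + 1` (both
    -- coefficients are zero before `n`, and they are equal at `n`) and the slope `∂_{i₀} g` is not
    -- zero.
    have key : ∀ l, ∀ i, ∀ j < k i + 1 + l, (jetArc a i).coeff j = (jetArc a' i).coeff j := by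
      intro l
      induction l with
      | zero =>
        intro i j hj
        rcases Nat.lt_succ_iff_lt_or_eq.1 hj with hj | rfl
        · rw [(h2 i).1 j hj, (h2' i).1 j hj]
        · rw [coeff_jetArc_le a i (hk i), coeff_jetArc_le a' i (hk i)]
          exact congrFun hlead i
      | succ l ih =>
        intro i j hj
        rcases Nat.lt_succ_iff_lt_or_eq.1 hj with hj | rfl
        · exact ih i j hj
        · rw [Nat.add_eq]
          by_cases hi : i = i₀ ∧ k i + 1 + l ≤ k i₀ + (q + 1)
          · obtain ⟨rfl, hi⟩ := hi
            have h4 := coeff_evalJet_sub hk hm (fun i => (h2 i).1) (Nat.succ_pos l)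
              (fun i j hj => ih i j (by omega)) (i := i) fun i' hi' =>
                hrest i' _ (by omega) fun h => hi' h.1
            have h5 : (evalJet f a).coeff (m + l.succ) = (evalJet f a').coeff (m + l.succ) := by
              rcases Nat.lt_or_ge (m + l.succ) n with hlt | hge
              · rw [h1.2.1 _ hlt, h1'.2.1 _ hlt]
              · rw [show m + l.succ = n by omega, hlast]
            rw [h5, sub_self] at h4
            have h6 := (mul_eq_zero.1 h4.symm).resolve_left (hpiv hap)
            rw [show k i + 1 + l = k i + l.succ by omega]
            exact sub_eq_zero.1 h6
          · refine hrest i _ (by omega) fun h => hi h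
    funext ⟨i, j⟩
    rw [← coeff_jetArc_of_lt a, ← coeff_jetArc_of_lt a']
    exact key j i j (by omega)
  · rintro z ⟨⟨⟨hz0, hz1⟩, hz2⟩, hz3⟩
    let x : Fin d → ℝ := fun i => z (Sum.inl (Sum.inl i))
    -- The candidate preimage, with unknowns `u 0, ..., u q` as the omitted coefficients: `u l`
    -- stands at order `k i₀ + (l + 1)` of the component `i₀`.
    let a : (ℕ → ℝ) → Fin d × Fin (N + 1) → ℝ := fun u p =>
      if h : k p.1 < (p.2 : ℕ) ∧ ¬ (p.1 = i₀ ∧ (p.2 : ℕ) ≤ k i₀ + (q + 1)) then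
        z (Sum.inr ⟨p, h⟩)
      else if (p.2 : ℕ) < k p.1 then 0
      else if (p.2 : ℕ) = k p.1 then x p.1 else u (p.2 - k i₀ - 1)
    have ha0 : ∀ u i, ∀ j < k i, (jetArc (a u) i).coeff j = 0 := fun u i j hj => by
      have h1 : ¬ k i < j := by omega
      have := hk i
      rw [coeff_jetArc_le _ i (by omega)]
      simp [a, h1, hj]
    have ha1 : ∀ u, jetLead hk (a u) = x := fun u => funext fun i => by
      simp [jetLead, a]
    have ha2 : ∀ u, ∀ l ≤ q, (jetArc (a u) i₀).coeff (k i₀ + (l + 1)) = u l := fun u l hl => by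
      have h1 : k i₀ + (l + 1) ≤ k i₀ + (q + 1) := by omega
      have h2 : ¬ k i₀ + (l + 1) < k i₀ := by omega
      rw [coeff_jetArc_le _ i₀ (by omega)]
      simp [a, h2, hl]
    have ha3 : ∀ u u' i j, ¬ (i = i₀ ∧ k i < j ∧ j ≤ k i₀ + (q + 1)) →
        (jetArc (a u) i).coeff j = (jetArc (a u') i).coeff j := fun u u' i j hj => by
      by_cases hjN : j ≤ N
      · rw [coeff_jetArc_le _ i hjN, coeff_jetArc_le _ i hjN]
        simp only [a]
        split_ifs with h1 h2 h3
        · rfl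
        · rfl
        · rfl
        · exact absurd h1 (by
            push Not
            refine ⟨by omega, fun h4 => by_contra fun h5 => hj ⟨h4, by omega, by omega⟩⟩)
      · rw [coeff_jetArc_gt _ i (by omega), coeff_jetArc_gt _ i (by omega)]
    -- The coefficient of `f(γ)` at order `m + (l + 1)` is affine in `u l`, once the earlier
    -- unknowns are fixed, with slope `∂_{i₀} g` at the leading coefficients. It is prescribed to be
    -- `0` for `l < q` and the given angular component for `l = q`, that is, at order `n`.
    obtain ⟨u, hu⟩ := exists_triangular_solution
      (fun u l => (evalJet f (a u)).coeff (m + (l + 1))) (hpiv hz3) (q + 1) (fun l hl u u' huu => by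
        have h1 := coeff_evalJet_sub hk hm (ha0 u) (a' := a u') (Nat.succ_pos l)
          (fun i j hj => by
            by_cases hij : i = i₀ ∧ k i < j ∧ j ≤ k i₀ + (q + 1)
            · obtain ⟨rfl, hij, -⟩ := hij
              obtain ⟨l', rfl⟩ : ∃ l', j = k i + (l' + 1) := ⟨j - k i - 1, by omega⟩
              rw [ha2 u l' (by omega), ha2 u' l' (by omega), huu l' (by omega)]
            · exact ha3 u u' i j hij) (i := i₀) fun i' hi' => ha3 u u' i' _ fun h => hi' h.1
        rw [ha1, ha2 u l (by omega), ha2 u' l (by omega)] at h1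
        exact h1) fun l => if l = q then z (Sum.inl (Sum.inr ())) else 0
    have hcm : (evalJet f (a u)).coeff m = 0 := by
      rw [evalJet, coeff_aeval_eq hm (ha0 u), coeff_jetArc_lead hk, ha1]
      exact hz1
    have hcn : (evalJet f (a u)).coeff n = z (Sum.inl (Sum.inr ())) := by
      rw [hn, hu q (by omega), if_pos rfl]
    refine ⟨a u, ⟨(mem_jetStratum_iff hk).2 ⟨⟨fun i => ?_, fun j hj => ?_, ?_⟩, fun i =>
      ⟨ha0 u i, ?_⟩⟩, ?_⟩, funext ?_⟩
    · rw [← coeff_jetArc_of_lt (a u) i 0]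
      exact ha0 u i _ (hk0 i)
    · rcases lt_trichotomy j m with hjm | rfl | hjm
      · exact coeff_aeval_lt hm (ha0 u) hjm
      · exact hcm
      · obtain ⟨l, rfl⟩ : ∃ l, j = m + (l + 1) := ⟨j - m - 1, by omega⟩
        rw [hu l (by omega), if_neg (by omega)]
    · rw [hcn]
      exact hz2
    · rw [coeff_jetArc_le _ i (hk i)]
      exact fun h => hz0 i ((congrFun (ha1 u) i).symm.trans h)
    · rw [Set.mem_ofPred_eq, ha1]
      exact hz3
    · rintro ((i | _) | p)
      · exact congrFun (ha1 u) i
      · exact hcn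
      · exact dif_pos p.2
  · intro l a _
    funext r
    rcases r with (i | _) | p
    · rfl
    · show (evalJet f (dact (jetWeight d N) l a)).coeff n = ((l ^ (n : ℤ) : ℝˣ) : ℝ) * _
      rw [coeff_evalJet_dact, mul_comm, zpow_natCast, Units.val_pow_eq_pow_val]
      rfl
    · rfl
  · intro a _
    rw [MvPolynomial.eval_rename, MvPolynomial.eval_X, eval_jetCoeff]
    rfl

/-- The class of a stratum on which the initial form of `f` vanishes. -/
lemma dcls_jetStratum_of_lt (hk : ∀ i, k i ≤ N) (hk0 : ∀ i, 0 < k i)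
    (hm : ∀ ν ∈ f.support, m ≤ ∑ i, k i * ν i) (hmn : m < n) (hnN : n ≤ N)
    (hnd : ¬ ∃ x : Fin d → ℝ, (∀ i, x i ≠ 0) ∧ MvPolynomial.eval x (initialForm f k m) = 0 ∧
      ∀ i, MvPolynomial.eval x (MvPolynomial.pderiv i (initialForm f k m)) = 0) :
    dcls n (jetStratum f n N (fun i => ⟨k i, by have := hk i; omega⟩)) (jetWeight d N)
        (jetCoeff N f n) * affLine n ^ (n - m) =
      K0AS.toK0n n (K0AS.cls (torusZero (initialForm f k m))) *
        affLine n ^ Nat.card (JetRest N k) := by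
  have hhom := initialForm_homogeneous f k m
  obtain ⟨q, hq⟩ : ∃ q, n = m + (q + 1) := ⟨n - m - 1, by omega⟩
  have hW := (dcls_jetTarget_eq_sum n hhom).2
  rw [jetTarget, dcls_torusZero n hhom] at hW
  -- The factor `affLine n ^ (n - m)` stands on the left of the statement so that nothing has to be
  -- inverted in `K₀ⁿ`.
  rw [hW, (dcls_jetStratum_eq_sum hk hhom _).2, Finset.sum_mul, Finset.sum_mul]
  refine Finset.sum_congr rfl fun p _ => ?_
  have hlead : ∀ a ∈ jetStratum f n N (fun i => ⟨k i, by have := hk i; omega⟩),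
      jetLead hk a ∈ torusZeroSet (initialForm f k m) := fun a ha => by
    obtain ⟨h1, h2⟩ := (mem_jetStratum_iff hk).1 ha
    have h3 := coeff_aeval_eq hm (fun i => (h2 i).1)
    rw [coeff_jetArc_lead hk] at h3
    refine ⟨fun i => ?_, h3.symm.trans (h1.2.1 m hmn)⟩
    have := (h2 i).2
    rwa [coeff_jetArc_le a i (hk i)] at this
  have hempty : torusZeroSet (initialForm f k m) ∩ pivotSet (initialForm f k m) p = ∅ →
      dcls n (jetStratum f n N (fun i => ⟨k i, by have := hk i; omega⟩) ∩
        {a | jetLead hk a ∈ pivotSet (initialForm f k m) p})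
        (jetWeight d N) (jetCoeff N f n) * affLine n ^ (n - m) =
      dcls n ({z | z ∘ Sum.inl ∈ torusZeroSet (initialForm f k m) ∧ z (Sum.inr ()) ≠ 0} ∩
        {z | z ∘ Sum.inl ∈ pivotSet (initialForm f k m) p})
        (Sum.elim (fun i => (k i : ℤ)) fun _ => n) (MvPolynomial.X (Sum.inr ())) *
        affLine n ^ Nat.card (JetRest N k) := by
    intro he
    rw [Set.eq_empty_iff_forall_notMem] at he
    have h1 : jetStratum f n N (fun i => ⟨k i, by have := hk i; omega⟩) ∩
        {a | jetLead hk a ∈ pivotSet (initialForm f k m) p} = ∅ :=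
      Set.eq_empty_iff_forall_notMem.2 fun a ha => he _ ⟨hlead a ha.1, ha.2⟩
    have h2 : {z : Fin d ⊕ Unit → ℝ | z ∘ Sum.inl ∈ torusZeroSet (initialForm f k m) ∧
        z (Sum.inr ()) ≠ 0} ∩ {z | z ∘ Sum.inl ∈ pivotSet (initialForm f k m) p} = ∅ :=
      Set.eq_empty_iff_forall_notMem.2 fun z hz => he _ ⟨hz.1.1, hz.2⟩
    rw [h1, h2, dcls_empty, dcls_empty, zero_mul, zero_mul]
  -- The last index means that all partial derivatives vanish, which non-degeneracy excludes. For
  -- another index `i`, either `k i ≤ m`, and `k i + (n - m) ≤ n ≤ N` makes the trivialization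
  -- available, or the derivative of index `i` is identically zero and both pieces are empty.
  induction p using Fin.lastCases with
  | last =>
    refine hempty (Set.eq_empty_iff_forall_notMem.2 fun x hx => hnd ⟨x, hx.1.1, hx.1.2, ?_⟩)
    exact firstNonzero_eq_last_iff.1 hx.2
  | cast i =>
    by_cases hi : k i ≤ m
    · have h1 := dcls_jetStratum_pivot hk hk0 hm hq (i₀ := i) (by omega)
      rw [h1, ← card_jetRestPivot (i := i) (q := q + 1) (by omega : k i + (q + 1) ≤ N),
        show n - m = q + 1 by omega, mul_assoc, ← pow_add]
      rfl
    · refine hempty (Set.eq_empty_iff_forall_notMem.2 fun x hx => ?_)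
      refine (firstNonzero_eq_castSucc_iff.1 hx.2).2 ?_
      rw [pderiv_eq_zero_of_lt hhom (by omega), map_zero]

end

/-! ### Compact faces of the Newton polyhedron -/

section

variable {d : ℕ} {f : MvPolynomial (Fin d) ℝ}

lemma natCast_mem_newtonPolyhedron {ν : Fin d →₀ ℕ} (hν : ν ∈ f.support) :
    (fun i => (ν i : ℝ)) ∈ newtonPolyhedron f :=
  subset_convexHull ℝ _ ⟨ν, hν, fun _ => le_rfl⟩

lemma nonneg_of_mem_newtonPolyhedron {x : Fin d → ℝ} (hx : x ∈ newtonPolyhedron f) (i : Fin d) :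
    0 ≤ x i := by
  have h : newtonPolyhedron f ⊆ {x | 0 ≤ x i} := by
    refine convexHull_min ?_ ?_
    · rintro x ⟨ν, -, hx⟩
      exact (Nat.cast_nonneg _).trans (hx i)
    · exact convex_halfSpace_ge (f := fun x : Fin d → ℝ => x i) ⟨fun _ _ => rfl, fun _ _ => rfl⟩ 0
  exact h hx

/-- The generating orthants have this property and it passes to convex hulls. A face whose linear
form does not decrease in a coordinate direction therefore contains a ray and is not compact. -/
lemma add_single_mem_newtonPolyhedron {x : Fin d → ℝ} (hx : x ∈ newtonPolyhedron f) (i : Fin d)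
    {s : ℝ} (hs : 0 ≤ s) : x + Pi.single i s ∈ newtonPolyhedron f := by
  have h : newtonPolyhedron f ⊆ {x | x + Pi.single i s ∈ newtonPolyhedron f} := by
    refine convexHull_min ?_ ?_
    · rintro x ⟨ν, hν, hx⟩
      refine subset_convexHull ℝ _ ⟨ν, hν, fun j => (hx j).trans ?_⟩
      rw [Pi.add_apply, le_add_iff_nonneg_right]
      exact (Pi.single_nonneg.2 hs : (0 : Fin d → ℝ) ≤ Pi.single i s) j
    · exact (convex_convexHull ℝ _).translate_preimage_left _
  exact h hx

lemma not_isCompact_of_ray {τ : Set (Fin d → ℝ)} {x : Fin d → ℝ} {i : Fin d}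
    (h : ∀ s : ℝ, 0 ≤ s → x + Pi.single i s ∈ τ) : ¬ IsCompact τ := by
  intro hc
  obtain ⟨B, hB⟩ := (hc.image (continuous_apply i)).bddAbove
  have h1 := hB ⟨_, h (|B| + |x i| + 1) (by positivity), rfl⟩
  simp only [Pi.add_apply, Pi.single_eq_same] at h1
  have := le_abs_self B
  have := neg_abs_le (x i)
  linarith

/-- The points of a set `τ` which are exponents of `f`. -/
def faceExponents (f : MvPolynomial (Fin d) ℝ) (τ : Set (Fin d → ℝ)) : Set (Fin d →₀ ℕ) :=
  {ν | ν ∈ f.support ∧ (fun i => (ν i : ℝ)) ∈ τ}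

lemma finite_faceExponents (τ : Set (Fin d → ℝ)) : (faceExponents f τ).Finite :=
  f.support.finite_toSet.subset fun _ h => h.1

/-- The face on which a linear form with negative coefficients attains its maximum is the convex
hull of its exponents. -/
lemma eq_convexHull_faceExponents {l : (Fin d → ℝ) →L[ℝ] ℝ} (hl : ∀ i, l (Pi.single i 1) < 0)
    {τ : Set (Fin d → ℝ)} (hne : τ.Nonempty)
    (hτ : τ = {x ∈ newtonPolyhedron f | ∀ y ∈ newtonPolyhedron f, l y ≤ l x}) :
    τ = convexHull ℝ ((fun (ν : Fin d →₀ ℕ) i => (ν i : ℝ)) '' faceExponents f τ) := by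
  obtain ⟨x₀, hx₀⟩ := hne
  have hx₀' := hx₀
  rw [hτ] at hx₀'
  have hmem : ∀ x, x ∈ τ ↔ x ∈ newtonPolyhedron f ∧ l x = l x₀ := by
    intro x
    rw [hτ]
    constructor
    · rintro ⟨h1, h2⟩
      exact ⟨h1, le_antisymm (hx₀'.2 x h1) (h2 x₀ hx₀'.1)⟩
    · rintro ⟨h1, h2⟩
      exact ⟨h1, fun y hy => h2 ▸ hx₀'.2 y hy⟩
  set V := (fun (ν : Fin d →₀ ℕ) i => (ν i : ℝ)) '' faceExponents f τ with hV
  refine Set.Subset.antisymm ?_ ?_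
  · have hQ : newtonPolyhedron f ⊆ {x | l x ≤ l x₀ ∧ (l x = l x₀ → x ∈ convexHull ℝ V)} := by
      refine convexHull_min ?_ ?_
      · rintro x ⟨ν, hν, hx⟩
        refine ⟨hx₀'.2 x (subset_convexHull ℝ _ ⟨ν, hν, hx⟩), fun hlx => ?_⟩
        have hν' := hx₀'.2 _ (natCast_mem_newtonPolyhedron hν)
        have hsum : l x = l (fun i => (ν i : ℝ)) + ∑ i, (x i - ν i) * l (Pi.single i 1) := by
          have h1 : x = (fun i => (ν i : ℝ)) + ∑ i, (x i - ν i) • Pi.single i (1 : ℝ) := by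
            ext j
            simp [Finset.sum_apply, Pi.single_apply]
          conv_lhs => rw [h1]
          simp only [map_add, map_sum, map_smul, smul_eq_mul]
        have hterm : ∀ i ∈ Finset.univ, (x i - ν i) * l (Pi.single i 1) ≤ 0 := fun i _ =>
          mul_nonpos_of_nonneg_of_nonpos (sub_nonneg.2 (hx i)) (hl i).le
        have hz : ∑ i, (x i - ν i) * l (Pi.single i 1) = 0 :=
          le_antisymm (Finset.sum_nonpos hterm) (by linarith)
        have hxν : (fun i => (ν i : ℝ)) = x := funext fun i => by
          have := (Finset.sum_eq_zero_iff_of_nonpos hterm).1 hz i (Finset.mem_univ i)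
          have := (mul_eq_zero.1 this).resolve_right (hl i).ne
          linarith
        refine subset_convexHull ℝ _ ⟨ν, ⟨hν, ?_⟩, hxν⟩
        rw [hxν, hmem]
        exact ⟨subset_convexHull ℝ _ ⟨ν, hν, hx⟩, hlx⟩
      · rintro x ⟨hx1, hx2⟩ y ⟨hy1, hy2⟩ a b ha hb hab
        have hlin : l (a • x + b • y) = a * l x + b * l y := by simp
        refine ⟨?_, fun h => ?_⟩
        · rw [hlin]
          have hb' : b = 1 - a := by linarith
          subst hb'
          nlinarith
        · rw [hlin] at h
          rcases ha.eq_or_lt with rfl | ha'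
          · have hb1 : b = 1 := by linarith
            subst hb1
            simp only [zero_smul, one_smul, zero_add]
            exact hy2 (by linarith)
          · rcases hb.eq_or_lt with rfl | hb'
            · have ha1 : a = 1 := by linarith
              subst ha1
              simp only [zero_smul, one_smul, add_zero]
              exact hx2 (by linarith)
            · have h1 : a * (l x₀ - l x) + b * (l x₀ - l y) = 0 := by
                have : a * l x₀ + b * l x₀ = l x₀ := by rw [← add_mul, hab, one_mul]
                linarith
              have h2 : 0 ≤ a * (l x₀ - l x) := mul_nonneg ha (by linarith)
              have h3 : 0 ≤ b * (l x₀ - l y) := mul_nonneg hb (by linarith)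
              have h4 : a * (l x₀ - l x) = 0 := by linarith
              have h5 : b * (l x₀ - l y) = 0 := by linarith
              have h6 := (mul_eq_zero.1 h4).resolve_left ha'.ne'
              have h7 := (mul_eq_zero.1 h5).resolve_left hb'.ne'
              exact convex_convexHull ℝ V (hx2 (by linarith)) (hy2 (by linarith)) ha hb hab
    exact fun x hx => (hQ ((hmem x).1 hx).1).2 ((hmem x).1 hx).2
  · refine convexHull_min ?_ ?_
    · rintro _ ⟨ν, hν, rfl⟩
      exact hν.2
    · have : τ = newtonPolyhedron f ∩ {x | l x = l x₀} := Set.ext hmem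
      rw [this]
      exact (convex_convexHull ℝ _).inter (convex_hyperplane (f := l) l.isLinear _)

/-- If the linear form defining the face were non-negative on some basis vector, the face would
contain a ray in that direction. So its coefficients are all negative and
`eq_convexHull_faceExponents` applies. -/
lemma CompactFace.eq_convexHull (τ : CompactFace f) :
    τ.1 = convexHull ℝ ((fun (ν : Fin d →₀ ℕ) i => (ν i : ℝ)) '' faceExponents f τ.1) := by
  obtain ⟨τ, hne, hexp, hc⟩ := τ
  obtain ⟨l, hl⟩ := hexp hne
  refine eq_convexHull_faceExponents (l := l) (fun i => ?_) hne hl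
  obtain ⟨x, hx⟩ := hne
  have hx' := hx
  rw [hl] at hx'
  have hlx : ∀ s : ℝ, l (x + Pi.single i s) = l x + s * l (Pi.single i 1) := fun s => by
    have : (Pi.single i s : Fin d → ℝ) = s • Pi.single i (1 : ℝ) := by
      rw [← Pi.single_smul, smul_eq_mul, mul_one]
    rw [map_add, this, map_smul, smul_eq_mul]
  by_contra hcon
  push Not at hcon
  refine not_isCompact_of_ray (x := x) (i := i) (fun s hs => ?_) hc
  rw [hl]
  refine ⟨add_single_mem_newtonPolyhedron hx'.1 i hs, fun y hy => (hx'.2 y hy).trans ?_⟩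
  rw [hlx]
  have := mul_nonneg hs hcon
  linarith

/-- A compact face is determined by the exponents it contains, a subset of the finite support. -/
lemma finite_compactFace (f : MvPolynomial (Fin d) ℝ) : Finite (CompactFace f) := by
  have : Finite {s : Set (Fin d →₀ ℕ) // s ⊆ (f.support : Set (Fin d →₀ ℕ))} :=
    f.support.finite_toSet.finite_subsets.to_subtype
  refine Finite.of_injective (β := {s : Set (Fin d →₀ ℕ) // s ⊆ (f.support : Set (Fin d →₀ ℕ))})
    (fun τ : CompactFace f => ⟨faceExponents f τ.1, fun ν hν => hν.1⟩) fun τ τ' h => ?_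
  have h := congrArg Subtype.val h
  simp only at h
  exact Subtype.ext (by rw [τ.eq_convexHull, τ'.eq_convexHull, h])

lemma suppFun_le {k : Fin d → ℝ} (hk : ∀ i, 0 ≤ k i) {x : Fin d → ℝ}
    (hx : x ∈ newtonPolyhedron f) : suppFun f k ≤ ∑ i, k i * x i := by
  refine csInf_le ⟨0, ?_⟩ ⟨x, hx, rfl⟩
  rintro _ ⟨y, hy, rfl⟩
  exact Finset.sum_nonneg fun i _ => mul_nonneg (hk i) (nonneg_of_mem_newtonPolyhedron hy i)

/-- The trace of a vector with positive integral entries is a compact face. -/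
lemma exists_compactFace_trace (hf : f ≠ 0) {k : Fin d → ℕ} (hk : ∀ i, 0 < k i) :
    ∃ τ : CompactFace f, τ.1 = trace f fun i => (k i : ℝ) := by
  obtain ⟨ν, hν, hν'⟩ := suppFun_eq hf k
  have hνt : (fun i => (ν i : ℝ)) ∈ trace f fun i => (k i : ℝ) :=
    ⟨natCast_mem_newtonPolyhedron hν, by rw [hν']; push_cast; rfl⟩
  -- Faces are defined by maxima of linear forms, whence the sign. Positivity of `k` makes the form
  -- negative on the basis vectors, so the face is the convex hull of finitely many points, hence
  -- compact.
  let l : (Fin d → ℝ) →L[ℝ] ℝ := -∑ i, (k i : ℝ) • ContinuousLinearMap.proj i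
  have hl : ∀ x, l x = -∑ i, (k i : ℝ) * x i := fun x => by
    simp [l]
  have heq : (trace f fun i => (k i : ℝ)) =
      {x ∈ newtonPolyhedron f | ∀ y ∈ newtonPolyhedron f, l y ≤ l x} := by
    ext x
    refine and_congr_right fun hx => ?_
    simp only [hl, neg_le_neg_iff]
    constructor
    · intro h y hy
      rw [h]
      exact suppFun_le (fun i => Nat.cast_nonneg _) hy
    · intro h
      refine le_antisymm ?_ (suppFun_le (fun i => Nat.cast_nonneg _) hx)
      exact (h _ hνt.1).trans_eq hνt.2
  refine ⟨⟨trace f fun i => (k i : ℝ), ⟨_, hνt⟩, fun _ => ⟨l, heq⟩, ?_⟩, rfl⟩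
  rw [eq_convexHull_faceExponents (l := l) (fun i => ?_) ⟨_, hνt⟩ heq]
  · exact ((finite_faceExponents _).image _).isCompact_convexHull ℝ
  · rw [hl, neg_lt_zero, Finset.sum_eq_single i]
    · simpa using hk i
    · intro j _ hj
      simp [hj]
    · simp

/-- If `k i = 0`, then moving in the direction `i` does not change `k · x`, and the face contains a
ray. -/
lemma pos_of_mem_latticeCone (τ : CompactFace f) {k : Fin d → ℕ} (hk : k ∈ latticeCone f τ.1)
    (i : Fin d) : 0 < k i := by
  rw [Nat.pos_iff_ne_zero]
  intro h0
  obtain ⟨x, hx⟩ := τ.2.1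
  have ht : (trace f fun i => (k i : ℝ)) = τ.1 := hk.2
  rw [← ht] at hx
  refine not_isCompact_of_ray (x := x) (i := i) (fun s hs => ?_) τ.2.2.2
  rw [← ht]
  refine ⟨add_single_mem_newtonPolyhedron hx.1 i hs, ?_⟩
  rw [← hx.2]
  refine Finset.sum_congr rfl fun j _ => ?_
  rcases eq_or_ne j i with rfl | hj
  · simp [h0]
  · simp [hj]

lemma suppNat_le (k : Fin d → ℕ) {ν : Fin d →₀ ℕ} (hν : ν ∈ f.support) :
    suppNat f k ≤ ∑ i, k i * ν i := by
  have hf : f ≠ 0 := by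
    rintro rfl
    simp at hν
  have := suppFun_le (f := f) (k := fun i => (k i : ℝ)) (fun i => Nat.cast_nonneg _)
    (natCast_mem_newtonPolyhedron hν)
  rw [← suppNat_cast hf] at this
  exact_mod_cast this

/-- The minimum is attained at an exponent of `f`. With positive weights it can be zero only at the
exponent `0`, excluded by `f(0) = 0`. -/
lemma suppNat_pos (hf : f ≠ 0) (hf0 : MvPolynomial.eval 0 f = 0) {k : Fin d → ℕ}
    (hk : ∀ i, 0 < k i) : 0 < suppNat f k := by
  obtain ⟨ν, hν, h⟩ := suppFun_eq hf k
  rw [← suppNat_cast hf] at h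
  have h : suppNat f k = ∑ i, k i * ν i := by exact_mod_cast h
  rw [h, Nat.pos_iff_ne_zero]
  intro h0
  have hν0 : ν = 0 := by
    ext i
    have := Finset.sum_eq_zero_iff.1 h0 i (Finset.mem_univ i)
    exact (mul_eq_zero.1 this).resolve_left (hk i).ne'
  rw [hν0, MvPolynomial.mem_support_iff] at hν
  apply hν
  rw [← hf0, MvPolynomial.eval_zero, MvPolynomial.constantCoeff_eq]

/-- This identifies the polynomials in the definition of non-degeneracy with the initial forms along
arcs. -/
lemma facePoly_trace (hf : f ≠ 0) (k : Fin d → ℕ) :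
    facePoly f (trace f fun i => (k i : ℝ)) = initialForm f k (suppNat f k) := by
  classical
  rw [facePoly, initialForm]
  refine Finset.sum_congr (Finset.filter_congr fun ν hν => ?_) fun _ _ => rfl
  constructor
  · intro h
    have : ∑ i, (k i : ℝ) * (ν i : ℝ) = suppNat f k := by
      rw [suppNat_cast hf]
      exact h.2
    exact_mod_cast this
  · intro h
    refine ⟨natCast_mem_newtonPolyhedron hν, ?_⟩
    rw [← suppNat_cast hf, ← h]
    push_cast
    rfl

lemma CompactFace.ne_zero (τ : CompactFace f) : f ≠ 0 := by
  rintro rfl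
  obtain ⟨x, hx⟩ := τ.2.1
  have hx := τ.2.2.1.subset hx
  simp [newtonPolyhedron] at hx

lemma facePoly_eq_initialForm (τ : CompactFace f) {k : Fin d → ℕ} (hk : k ∈ latticeCone f τ.1) :
    facePoly f τ.1 = initialForm f k (suppNat f k) := by
  rw [← facePoly_trace τ.ne_zero, ← hk.2]

end

/-! ### Classes in `𝓜` and its completion -/

/-- The morphism `K₀ⁿ → 𝓜`. -/
noncomputable def K0n.toM {n : ℕ} (hn : 0 < n) : K0n n →+* M :=
  (algebraMap K0 M).comp (K0.of n hn)

lemma K0n.toM_affLine {n : ℕ} (hn : 0 < n) : K0n.toM hn (affLine n) = ((M.L : Mˣ) : M) := by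
  rw [K0n.toM, RingHom.comp_apply, of_affLine]
  rfl

lemma ASSet.dim_le_card (X : ASSet) : X.dim ≤ Nat.card X.ι := by
  cases nonempty_fintype X.ι
  refine csSup_le' ?_
  rintro _ ⟨J, rfl, -⟩
  rw [Nat.card_eq_fintype_card]
  exact Finset.card_le_univ J

/-- The shift by `1` appears because the unit is represented by `ℝ^*`, which is of dimension at most
one. -/
lemma M.L_zpow_mem_filtration (i : ℤ) : ((M.L ^ (-i) : Mˣ) : M) ∈ M.filtration (i - 1) := by
  refine AddSubgroup.subset_closure ⟨1, one_pos, MonVar.one 1, i, ?_, ?_⟩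
  · have h : (MonVar.one 1).dim ≤ 1 := by
      refine (ASSet.dim_le_card _).trans_eq ?_
      show Nat.card Unit = 1
      simp
    have : ((MonVar.one 1).dim : ℤ) ≤ 1 := by exact_mod_cast h
    omega
  · rw [K0.cls, K0n.cls_one, map_one, map_one, one_mul]

/-- The property passes to the completion, where a family is then summable as soon as it tends to
zero. -/
instance : NonarchimedeanRing M := M.filtration_basis.nonarchimedean

lemma M.hasBasis_nhds_zero :
    (𝓝 (0 : M)).HasBasis (fun _ : ℤ => True) fun i => (M.filtration i : Set M) :=
  M.filtration_basis.hasBasis_nhds_zero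

lemma M.tendsto_toHat_zero {α : Type*} {l : Filter α} {u : α → M}
    (h : ∀ i : ℤ, ∀ᶠ a in l, u a ∈ M.filtration i) :
    Tendsto (fun a => M.toHat (u a)) l (𝓝 0) := by
  have h1 : Tendsto u l (𝓝 0) := M.hasBasis_nhds_zero.tendsto_right_iff.2 fun i _ => h i
  have h2 : Continuous M.toHat := UniformSpace.Completion.continuous_coe M
  have h3 := (h2.tendsto 0).comp h1
  rwa [map_zero] at h3

/-- `𝕃^{-∑ k_i}` tends to `0`. -/
lemma M.tendsto_cofinite_toHat {d : ℕ} {s : Set (Fin d → ℕ)} (p : s → Prop) [DecidablePred p] :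
    Tendsto (fun k : s => if p k then M.toHat ((M.L ^ (-(∑ i, k.1 i : ℤ)) : Mˣ) : M) else 0)
      cofinite (𝓝 0) := by
  have : ∀ k : s, (if p k then M.toHat ((M.L ^ (-(∑ i, k.1 i : ℤ)) : Mˣ) : M) else 0) =
      M.toHat (if p k then ((M.L ^ (-(∑ i, k.1 i : ℤ)) : Mˣ) : M) else 0) := fun k => by
    split_ifs <;> simp
  simp only [this]
  refine M.tendsto_toHat_zero fun i => ?_
  -- Outside this finite box some entry of `k` exceeds `i + 1`, hence so does `∑ k_i`, and `𝕃^{-∑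
  -- k_i}` lies in `F^i` in spite of the loss of one.
  have hfin : {k : Fin d → ℕ | k ≤ fun _ => i.toNat + 1}.Finite := Set.finite_Iic _
  have hfin' : {k : s | k.1 ≤ fun _ => i.toNat + 1}.Finite :=
    hfin.preimage Subtype.val_injective.injOn
  filter_upwards [hfin'.compl_mem_cofinite] with k hk
  split_ifs
  · refine M.filtration_anti ?_ (M.L_zpow_mem_filtration _)
    have hk : ¬ k.1 ≤ fun _ => i.toNat + 1 := hk
    rw [Pi.le_def] at hk
    push Not at hk
    obtain ⟨j, hj⟩ := hk
    have h1 : k.1 j ≤ ∑ j, k.1 j := Finset.single_le_sum (fun _ _ => Nat.zero_le _)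
      (Finset.mem_univ j)
    have h2 : ((∑ j, k.1 j : ℕ) : ℤ) = ∑ j, (k.1 j : ℤ) := by push_cast; rfl
    omega
  · exact zero_mem _

/-! ### Coefficients -/

/-- The identity `geomFrac_mul` is a recursion for the coefficients: each is `𝕃⁻¹` times the
preceding one, starting with `𝕃⁻¹` in degree one. -/
lemma coeff_geomFrac_succ (j : ℕ) :
    PowerSeries.coeff (j + 1) geomFrac = M.toHat ((M.L ^ (-(j + 1 : ℤ)) : Mˣ) : M) := by
  have h := geomFrac_mul
  rw [mul_sub, mul_one, mul_left_comm, ← mul_assoc] at h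
  have h0 : PowerSeries.coeff 0 geomFrac = 0 := by
    have := congrArg (PowerSeries.coeff 0) h
    simpa using this
  have hs : ∀ j, PowerSeries.coeff (j + 1) geomFrac =
      M.toHat ((M.L⁻¹ : Mˣ) : M) * PowerSeries.coeff j geomFrac +
        PowerSeries.coeff (j + 1) (PowerSeries.C (M.toHat ((M.L⁻¹ : Mˣ) : M)) * PowerSeries.X) :=
    fun j => by
      have := congrArg (PowerSeries.coeff (j + 1)) h
      rw [map_sub, PowerSeries.coeff_succ_mul_X, PowerSeries.coeff_C_mul] at this
      rw [← this]
      ring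
  induction j with
  | zero =>
    rw [hs, h0, mul_zero, zero_add, PowerSeries.coeff_succ_mul_X]
    simp
  | succ j ih =>
    rw [hs, ih, PowerSeries.coeff_succ_mul_X, PowerSeries.coeff_C, if_neg (by omega), add_zero,
      ← map_mul, ← Units.val_mul]
    congr 2
    rw [← zpow_neg_one, ← zpow_add]
    congr 1
    push_cast
    ring

lemma coeff_geomFrac_zero : PowerSeries.coeff 0 geomFrac = 0 := by
  simp [geomFrac]

section

variable {d : ℕ} {f : MvPolynomial (Fin d) ℝ}

open Classical in
/-- The class of the complement of `f_τ = 0` in the torus. -/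
noncomputable def faceClass (f : MvPolynomial (Fin d) ℝ) (τ : CompactFace f) : K0 :=
  -- The choice of `k` is immaterial by `cls_torusCompl_eq`. When `f(0) = 0` the default value is
  -- used only for an empty cone, so it is multiplied by an empty sum.
  if h : ∃ k, k ∈ latticeCone f τ.1 ∧ 0 < suppNat f k then
    K0.cls h.choose_spec.2 (torusCompl (facePoly f τ.1) h.choose (suppNat f h.choose)
      (facePoly_homogeneous h.choose_spec.1))
  else 0

lemma cls_eq_faceClass (τ : CompactFace f) {k : Fin d → ℕ} (hk : k ∈ latticeCone f τ.1)
    (hm : 0 < suppNat f k) :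
    K0.cls hm (torusCompl (facePoly f τ.1) k (suppNat f k) (facePoly_homogeneous hk)) =
      faceClass f τ := by
  have h : ∃ k, k ∈ latticeCone f τ.1 ∧ 0 < suppNat f k := ⟨k, hk, hm⟩
  rw [faceClass, dif_pos h]
  exact cls_torusCompl_eq _ _ _ _

/-- The contribution of `k` to the coefficient of order `n`. -/
noncomputable def faceTerm (f : MvPolynomial (Fin d) ℝ) (n : ℕ) (τ : CompactFace f)
    (k : Fin d → ℕ) : M :=
  (if suppNat f k = n then algebraMap K0 M (faceClass f τ)
    else if suppNat f k < n then
      algebraMap K0 M (K0AS.toK0 (K0AS.cls (torusZero (facePoly f τ.1)))) *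
        ((M.L ^ (-((n - suppNat f k : ℕ) : ℤ)) : Mˣ) : M)
    else 0) * ((M.L ^ (-(∑ i, k i : ℤ)) : Mˣ) : M)

/-- The factor `T^{m(k)}` selects the coefficient of order `n - m(k)` of the bracket: the constant
term when `m(k) = n`, a term of the geometric series when `m(k) < n`. These are the cases met by the
strata of jets. -/
lemma coeff_mul_coneTerm (n : ℕ) (τ : CompactFace f) (k : Fin d → ℕ) :
    PowerSeries.coeff n ((PowerSeries.C (K0.toHat (faceClass f τ)) +
      PowerSeries.C (K0.toHat (K0AS.toK0 (K0AS.cls (torusZero (facePoly f τ.1))))) * geomFrac) *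
        coneTerm f k) = M.toHat (faceTerm f n τ k) := by
  have h1 : coneTerm f k = PowerSeries.C (M.toHat ((M.L ^ (-(∑ i, k i : ℤ)) : Mˣ) : M)) *
      PowerSeries.X ^ suppNat f k := by
    ext j
    rw [coneTerm, PowerSeries.coeff_monomial, PowerSeries.coeff_C_mul_X_pow]
  rw [h1, ← mul_assoc, PowerSeries.coeff_mul_X_pow', faceTerm]
  rcases lt_trichotomy (suppNat f k) n with h | h | h
  · rw [if_pos h.le, if_neg h.ne, if_pos h, PowerSeries.coeff_mul_C, map_add,
      PowerSeries.coeff_C_mul, PowerSeries.coeff_C, if_neg (by omega), zero_add]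
    obtain ⟨j, hj⟩ : ∃ j, n - suppNat f k = j + 1 := ⟨n - suppNat f k - 1, by omega⟩
    rw [hj, coeff_geomFrac_succ, map_mul, map_mul]
    push_cast
    rfl
  · rw [if_pos h.le, if_pos h, h, Nat.sub_self, PowerSeries.coeff_mul_C, map_add,
      PowerSeries.coeff_C_mul, coeff_geomFrac_zero, mul_zero, add_zero,
      PowerSeries.coeff_zero_C, map_mul]
    rfl
  · rw [if_neg (by omega), if_neg (by omega), if_neg (by omega), zero_mul, map_zero]

/-- In each degree the family consists of some of the `𝕃^{-∑ k_i}`, completed by zeros, and these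
tend to zero. -/
lemma summable_coneTerm (τ : CompactFace f) :
    Summable fun k : latticeCone f τ.1 => coneTerm f k := by
  rw [PowerSeries.WithPiTopology.summable_iff_summable_coeff]
  intro n
  refine NonarchimedeanAddGroup.summable_of_tendsto_cofinite_zero ?_
  simp only [coneTerm, PowerSeries.coeff_monomial]
  exact M.tendsto_cofinite_toHat fun k : latticeCone f τ.1 => n = suppNat f k

/-- The class of the stratum of order `k` in `𝓜`. -/
lemma toM_jetStratum (hf : NonDegenerate f) (τ : CompactFace f) {k : Fin d → ℕ}
    (hkτ : k ∈ latticeCone f τ.1) (hm : 0 < suppNat f k) {n N : ℕ} (hn : 0 < n) (hnN : n ≤ N)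
    (hk : ∀ i, k i ≤ N) :
    K0n.toM hn (dcls n (jetStratum f n N (fun i => ⟨k i, by have := hk i; omega⟩))
      (jetWeight d N) (jetCoeff N f n)) * ((M.L ^ (-((d * N : ℕ) : ℤ)) : Mˣ) : M) =
      faceTerm f n τ k := by
  have hk0 := pos_of_mem_latticeCone τ hkτ
  have hle : ∀ ν ∈ f.support, suppNat f k ≤ ∑ i, k i * ν i := fun ν hν => suppNat_le k hν
  -- After normalization by `𝕃^{-dN}` the level `N` disappears from the class of the stratum.
  have hcard : ((Nat.card (JetRest N k) : ℤ)) - (d * N : ℕ) = -∑ i, (k i : ℤ) := by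
    have h1 : ((Nat.card (JetRest N k) + ∑ i, k i : ℕ) : ℤ) = (d * N : ℕ) := by
      rw [card_jetRest hk]
    push_cast at h1 ⊢
    linarith
  have hL : ((M.L : Mˣ) : M) ^ Nat.card (JetRest N k) * ((M.L ^ (-((d * N : ℕ) : ℤ)) : Mˣ) : M) =
      ((M.L ^ (-(∑ i, k i : ℤ)) : Mˣ) : M) := by
    rw [← Units.val_pow_eq_pow_val, ← zpow_natCast, ← Units.val_mul, ← zpow_add, ← sub_eq_add_neg,
      hcard]
  rw [faceTerm]
  rcases lt_trichotomy (suppNat f k) n with h | h | h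
  · rw [if_neg h.ne, if_pos h]
    have hnd : ¬ ∃ x : Fin d → ℝ, (∀ i, x i ≠ 0) ∧
        MvPolynomial.eval x (initialForm f k (suppNat f k)) = 0 ∧
        ∀ i, MvPolynomial.eval x (MvPolynomial.pderiv i (initialForm f k (suppNat f k))) = 0 := by
      rw [← facePoly_eq_initialForm τ hkτ]
      exact hf τ
    -- The factor `𝕃^{n - m(k)}` in this identity can now be inverted; its inverse is the
    -- coefficient of the geometric series.
    have h1 := congrArg (K0n.toM hn) (dcls_jetStratum_of_lt hk hk0 hle h hnN hnd)
    rw [map_mul, map_mul, map_pow, map_pow, K0n.toM_affLine,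
      ← facePoly_eq_initialForm τ hkτ] at h1
    have h2 : K0n.toM hn (K0AS.toK0n n (K0AS.cls (torusZero (facePoly f τ.1)))) =
        algebraMap K0 M (K0AS.toK0 (K0AS.cls (torusZero (facePoly f τ.1)))) := by
      rw [K0n.toM, RingHom.comp_apply, K0AS.of_toK0n]
    rw [h2] at h1
    rw [mul_right_comm, ← hL, ← mul_assoc, ← h1]
    have h3 : ((M.L : Mˣ) : M) ^ (n - suppNat f k) *
        ((M.L ^ (-((n - suppNat f k : ℕ) : ℤ)) : Mˣ) : M) = 1 := by
      rw [← Units.val_pow_eq_pow_val, ← zpow_natCast, ← Units.val_mul, ← zpow_add, add_neg_cancel,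
        zpow_zero, Units.val_one]
    linear_combination (-(K0n.toM hn (dcls n (jetStratum f n N (fun i => ⟨k i, by
      have := hk i; omega⟩)) (jetWeight d N) (jetCoeff N f n)) *
        ((M.L ^ (-((d * N : ℕ) : ℤ)) : Mˣ) : M))) * h3
  · subst h
    rw [if_pos rfl, dcls_jetStratum_of_eq hk hk0 hle, map_mul, map_pow, K0n.toM_affLine, mul_assoc,
      hL, ← cls_eq_faceClass τ hkτ hm, K0.cls, cls_torusCompl, facePoly_eq_initialForm τ hkτ]
    rfl
  · rw [if_neg h.ne', if_neg (by omega), jetStratum_eq_empty hk fun ν hν => by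
      have := hle ν hν
      omega]
    rw [dcls_empty, map_zero, zero_mul, zero_mul]

/-! ### Sums over boxes -/

/-- The vectors with entries between `1` and `N`. -/
def posBox (d N : ℕ) : Finset (Fin d → ℕ) := Fintype.piFinset fun _ => Finset.Icc 1 N

lemma mem_posBox {N : ℕ} {k : Fin d → ℕ} : k ∈ posBox d N ↔ ∀ i, 1 ≤ k i ∧ k i ≤ N := by
  simp [posBox]

lemma posBox_mono (d : ℕ) : Monotone (posBox d) := fun _ _ h _ hk =>
  mem_posBox.2 fun i => ⟨(mem_posBox.1 hk i).1, (mem_posBox.1 hk i).2.trans h⟩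

lemma exists_mem_posBox {k : Fin d → ℕ} (hk : ∀ i, 0 < k i) : ∃ N, k ∈ posBox d N :=
  ⟨∑ i, k i, mem_posBox.2 fun i => ⟨hk i, Finset.single_le_sum (fun _ _ => Nat.zero_le _)
    (Finset.mem_univ i)⟩⟩

open Classical in
/-- The class in `𝓜` of the stratum of order `k`, as a sum over the compact faces. -/
lemma toM_jetStratum_eq_sum [Fintype (CompactFace f)] (hf0 : MvPolynomial.eval 0 f = 0)
    (hf : NonDegenerate f) {n N : ℕ} (hn : 0 < n) (hnN : n ≤ N) {k : Fin d → ℕ}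
    (hk0 : ∀ i, 0 < k i) (hk : ∀ i, k i ≤ N) :
    K0n.toM hn (dcls n (jetStratum f n N (fun i => ⟨k i, by have := hk i; omega⟩))
      (jetWeight d N) (jetCoeff N f n)) * ((M.L ^ (-((d * N : ℕ) : ℤ)) : Mˣ) : M) =
      ∑ τ : CompactFace f, if k ∈ latticeCone f τ.1 then faceTerm f n τ k else 0 := by
  -- For `f = 0` the polyhedron is empty: there are no faces, and all strata are empty.
  rcases eq_or_ne f 0 with rfl | hf'
  · have : IsEmpty (CompactFace (0 : MvPolynomial (Fin d) ℝ)) := ⟨fun τ => τ.ne_zero rfl⟩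
    rw [Fintype.sum_empty, jetStratum_eq_empty hk (by simp), dcls_empty, map_zero, zero_mul]
  · obtain ⟨τ, hτ⟩ := exists_compactFace_trace hf' hk0
    have hkτ : k ∈ latticeCone f τ.1 := ⟨fun i => Nat.cast_nonneg _, hτ.symm⟩
    -- Only one face contributes, since `k` determines its trace.
    rw [Fintype.sum_eq_single τ, if_pos hkτ,
      toM_jetStratum hf τ hkτ (suppNat_pos hf' hf0 hk0) hn hnN hk]
    intro τ' hne
    exact if_neg fun h => hne (Subtype.ext (h.2.symm.trans hkτ.2))

/-- The dimension is at most `dN - N` and the exponent of `𝕃` is `-dN`, so these strata are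
negligible as `N → ∞`. -/
lemma toM_jetStratum_of_last {n N : ℕ} (hn : 0 < n) {k : Fin d → Fin (N + 1 + 1)} {i : Fin d}
    (hi : k i = Fin.last _) :
    K0n.toM hn (dcls n (jetStratum f n N k) (jetWeight d N) (jetCoeff N f n)) *
      ((M.L ^ (-((d * N : ℕ) : ℤ)) : Mˣ) : M) ∈ M.filtration N := by
  rw [dcls_of_valid (diagValid_jetStratum f n N k)]
  refine AddSubgroup.subset_closure ⟨n, hn, _, _, ?_, rfl⟩
  have := dim_jetStratum_of_last f n N hi
  omega

/-- The class of the jets in `𝓜`, in terms of the strata of the jets of higher order. -/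
lemma toM_jets (f : MvPolynomial (Fin d) ℝ) {n N : ℕ} (hn : 0 < n) (hnN : n ≤ N) :
    algebraMap K0 M (K0.cls hn (jets f n)) * ((M.L ^ (-(n * d : ℤ)) : Mˣ) : M) =
      ∑ k, K0n.toM hn (dcls n (jetStratum f n N k) (jetWeight d N) (jetCoeff N f n)) *
        ((M.L ^ (-((d * N : ℕ) : ℤ)) : Mˣ) : M) := by
  rw [← Finset.sum_mul, ← map_sum, ← (dcls_jetSetN_eq_sum f n N).2, dcls_jetSetN f hnN, map_mul,
    map_pow, K0n.toM_affLine, ← cls_jets, mul_assoc, ← Units.val_pow_eq_pow_val, ← zpow_natCast,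
    ← Units.val_mul, ← zpow_add]
  have : (-(n * d : ℤ)) = ((d * (N - n) : ℕ) : ℤ) + -((d * N : ℕ) : ℤ) := by
    push_cast [hnN]
    ring
  rw [this]
  rfl

open Classical in
/-- The coefficients of the zeta function, approximated by sums over boxes. -/
lemma toM_jets_sub_mem [Fintype (CompactFace f)] (hf0 : MvPolynomial.eval 0 f = 0)
    (hf : NonDegenerate f) {n N : ℕ} (hn : 0 < n) (hnN : n ≤ N) :
    algebraMap K0 M (K0.cls hn (jets f n)) * ((M.L ^ (-(n * d : ℤ)) : Mˣ) : M) -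
      ∑ τ : CompactFace f, ∑ k ∈ posBox d N,
        (if k ∈ latticeCone f τ.1 then faceTerm f n τ k else 0) ∈ M.filtration N := by
  rw [toM_jets f hn hnN, Finset.sum_comm]
  -- The tuples satisfying `p` correspond to the points of the box and cancel exactly. Of the
  -- others, those with an entry `0` give empty strata and those with an entry `N + 1` contribute to
  -- `F^N`.
  let p : (Fin d → Fin (N + 1 + 1)) → Prop := fun K => ∀ i, K i ≠ 0 ∧ K i ≠ Fin.last _
  rw [← Finset.sum_filter_add_sum_filter_not _ p, add_sub_right_comm]
  refine add_mem ?_ (sum_mem fun K hK => ?_)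
  · rw [sub_eq_zero.2]
    · exact zero_mem _
    refine Finset.sum_bij (fun K _ i => (K i : ℕ)) (fun K hK => ?_) (fun K _ K' _ h => ?_)
      (fun k hk => ?_) fun K hK => ?_
    · refine mem_posBox.2 fun i => ?_
      have h := (Finset.mem_filter.1 hK).2 i
      have h1 := Fin.val_ne_iff.2 h.1
      have h2 := Fin.val_ne_iff.2 h.2
      have h3 := (K i).2
      simp only [Fin.val_zero, Fin.val_last] at h1 h2
      omega
    · exact funext fun i => Fin.ext (congrFun h i)
    · have hk := mem_posBox.1 hk
      refine ⟨fun i => ⟨k i, by have := (hk i).2; omega⟩, ?_, rfl⟩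
      refine Finset.mem_filter.2 ⟨Finset.mem_univ _, fun i => ⟨?_, ?_⟩⟩
      · have := (hk i).1
        exact Fin.val_ne_iff.1 (by simp only [Fin.val_zero]; omega)
      · have := (hk i).2
        exact Fin.val_ne_iff.1 (by simp only [Fin.val_last]; omega)
    · have h := (Finset.mem_filter.1 hK).2
      refine toM_jetStratum_eq_sum hf0 hf hn hnN (fun i => ?_) fun i => ?_
      · exact Nat.pos_of_ne_zero (Fin.val_ne_iff.2 (h i).1)
      · have h2 := Fin.val_ne_iff.2 (h i).2
        have h3 := (K i).2
        simp only [Fin.val_last] at h2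
        omega
  · have h := (Finset.mem_filter.1 hK).2
    simp only [p, not_forall, not_and_or, not_not] at h
    obtain ⟨i, hi | hi⟩ := h
    · rw [jetStratum_eq_empty_of_zero f n N hi, dcls_empty, map_zero, zero_mul]
      exact zero_mem _
    · exact toM_jetStratum_of_last hn hi

open Classical in
/-- The coefficients of the zeta function are limits of sums over boxes. -/
lemma tendsto_sum_posBox [Fintype (CompactFace f)] (hf0 : MvPolynomial.eval 0 f = 0)
    (hf : NonDegenerate f) (n : ℕ) :
    Tendsto (fun N => ∑ τ : CompactFace f, ∑ k ∈ posBox d N,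
      M.toHat (if k ∈ latticeCone f τ.1 then faceTerm f n τ k else 0)) atTop
      (𝓝 (M.toHat (PowerSeries.coeff n (zeta f)))) := by
  have h : Tendsto (fun N : ℕ => M.toHat (PowerSeries.coeff n (zeta f) -
      ∑ τ : CompactFace f, ∑ k ∈ posBox d N,
        (if k ∈ latticeCone f τ.1 then faceTerm f n τ k else 0))) atTop (𝓝 0) := by
    refine M.tendsto_toHat_zero fun i => ?_
    filter_upwards [eventually_ge_atTop (max n i.toNat)] with N hN
    refine M.filtration_anti (show i ≤ (N : ℤ) by omega) ?_
    rw [zeta, PowerSeries.coeff_mk]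
    -- In degree `0` both sides vanish, as `m(k) ≥ 1` for every `k` in the cone of a compact face.
    rcases Nat.eq_zero_or_pos n with rfl | hn
    · rw [dif_neg (lt_irrefl _), Finset.sum_eq_zero, sub_zero]
      · exact zero_mem _
      refine fun τ _ => Finset.sum_eq_zero fun k _ => ?_
      split_ifs with hk
      · have := suppNat_pos τ.ne_zero hf0 (pos_of_mem_latticeCone τ hk)
        rw [faceTerm, if_neg this.ne', if_neg (Nat.not_lt_zero _), zero_mul]
      · rfl
    · rw [dif_pos hn]
      exact toM_jets_sub_mem hf0 hf hn (by omega)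
  have h2 := h.const_sub (M.toHat (PowerSeries.coeff n (zeta f)))
  simp only [map_sub, map_sum, sub_sub_cancel, sub_zero] at h2
  exact h2

-- Multiplication by a fixed power series and extraction of a coefficient are continuous, and the
-- sum over the cone is unconditional. It may be computed along the boxes, which exhaust the cone
-- because its elements have positive entries.
open Classical in
lemma tendsto_sum_posBox_faceTerm (n : ℕ) (τ : CompactFace f) :
    Tendsto (fun N => ∑ k ∈ posBox d N,
      M.toHat (if k ∈ latticeCone f τ.1 then faceTerm f n τ k else 0)) atTop
      (𝓝 (PowerSeries.coeff n ((PowerSeries.C (K0.toHat (faceClass f τ)) +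
        PowerSeries.C (K0.toHat (K0AS.toK0 (K0AS.cls (torusZero (facePoly f τ.1))))) *
          geomFrac) * ∑' k : latticeCone f τ.1, coneTerm f k))) := by
  have h := ((summable_coneTerm τ).hasSum.mul_left (PowerSeries.C (K0.toHat (faceClass f τ)) +
    PowerSeries.C (K0.toHat (K0AS.toK0 (K0AS.cls (torusZero (facePoly f τ.1))))) * geomFrac)).map
      (PowerSeries.coeff n) (PowerSeries.WithPiTopology.continuous_coeff MHat n)
  have h2 : Tendsto (fun N => (posBox d N).subtype (· ∈ latticeCone f τ.1)) atTop atTop := by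
    refine tendsto_atTop_finset_of_monotone (fun N N' hN => ?_) fun k => ?_
    · exact Finset.subtype_mono (posBox_mono d hN)
    · obtain ⟨N, hN⟩ := exists_mem_posBox (pos_of_mem_latticeCone τ k.2)
      exact ⟨N, Finset.mem_subtype.2 hN⟩
  refine (Tendsto.comp h h2).congr fun N => ?_
  simp only [Function.comp_apply, coeff_mul_coneTerm, apply_ite M.toHat, map_zero]
  rw [← Finset.sum_filter,
    Finset.sum_subtype_eq_sum_filter (f := fun k => M.toHat (faceTerm f n τ k))]

end

end ArcSym

/-! ### The formula for the zeta function -/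

theorem mainTheorem9 (d : ℕ) (f : MvPolynomial (Fin d) ℝ) (hf0 : MvPolynomial.eval 0 f = 0)
    (hf : NonDegenerate f) :
    Finite (CompactFace f) ∧
    ∃ c : CompactFace f → K0,
      (∀ (τ : CompactFace f) (k : Fin d → ℕ) (hk : k ∈ latticeCone f τ.1),
        ∃ hm : 0 < suppNat f k,
          K0.cls hm (torusCompl (facePoly f τ.1) k (suppNat f k) (facePoly_homogeneous hk)) =
            c τ) ∧
      (∀ τ : CompactFace f, Summable fun k : latticeCone f τ.1 => coneTerm f k) ∧
      PowerSeries.map M.toHat (zeta f) =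
        ∑ᶠ τ : CompactFace f,
          (PowerSeries.C (K0.toHat (c τ)) +
            PowerSeries.C (K0.toHat (K0AS.toK0 (K0AS.cls (torusZero (facePoly f τ.1))))) *
              geomFrac) *
          ∑' k : latticeCone f τ.1, coneTerm f k := by
  have hfin := finite_compactFace f
  refine ⟨hfin, faceClass f, fun τ k hk => ?_, summable_coneTerm, ?_⟩
  · exact ⟨suppNat_pos τ.ne_zero hf0 (pos_of_mem_latticeCone τ hk), cls_eq_faceClass τ hk _⟩
  · cases nonempty_fintype (CompactFace f)
    ext n
    rw [PowerSeries.coeff_map, finsum_eq_sum_of_fintype, map_sum]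
    -- Both coefficients are limits of the same sums over boxes, and the completion is Hausdorff.
    exact tendsto_nhds_unique (tendsto_sum_posBox hf0 hf n)
      (tendsto_finsetSum _ fun τ _ => tendsto_sum_posBox_faceTerm n τ)
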